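/- Let $A$ and $L$ be (associative, unital) rings. An $A$-coring is an $A$-bimodule $\mathcal C$ with a coassociative coproduct $\Delta:\mathcal C\to\mathcal C\otimes_A\mathcal C$, $c\mapsto c^{(1)}\otimes_A c^{(2)}$, and a counit $\epsilon:\mathcal C\to A$, both $A$-bilinear; a right $\mathcal C$-comodule is a right $A$-module $M$ with a right $A$-linear, coassociative and counital coaction $\varrho:M\to M\otimes_A\mathcal C$, $m\mapsto m^{[0]}\otimes_A m^{[1]}$; for a ring $S$, an $S$-$\mathcal C$ bicomodule is an $S$-$A$ bimodule and right $\mathcal C$-comodule whose coaction is left $S$-linear. Let $\mathcal C$ be an $A$-coring and $\mathcal D$ an $L$-coring (with coproduct $d\mapsto d_{(1)}\otimes_L d_{(2)}$) that is a right extension of $\mathcal C$: $\mathcal C$ is an $A$-$L$ bimodule with a left $A$-linear right $\mathcal D$-coaction $\tau_{\mathcal C}:c\mapsto c_{[0]}\otimes_L c_{[1]}$ such that $\Delta$ is right $\mathcal D$-colinear (and right $L$-linear), where $\mathcal D$ coacts on the second factor of $\mathcal C\otimes_A\mathcal C$. Each right $\mathcal C$-comodule $M$ is a right $L$-module by $ml=m^{[0]}\epsilon(m^{[1]}l)$.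 Assume that the extension is pure: for every right $\mathcal C$-comodule $(M,\varrho)$ the equaliser $$M\xrightarrow{\ \varrho\ }M\otimes_A\mathcal C\rightrightarrows M\otimes_A\mathcal C\otimes_A\mathcal C$$ of $\varrho\otimes_A\mathcal C$ and $M\otimes_A\Delta$ in right $L$-modules is preserved by $-\otimes_L\mathcal D\otimes_L\mathcal D$. Then $M$ is a right $\mathcal D$-comodule by the unique coaction $\tau_M:M\to M\otimes_L\mathcal D$ with $(\varrho\otimes_L\mathcal D)\circ\tau_M=(M\otimes_A\tau_{\mathcal C})\circ\varrho$, i.e. $\tau_M(m)=m^{[0]}\epsilon({m^{[1]}}_{[0]})\otimes_L{m^{[1]}}_{[1]}$. Let $\Sigma$ be an $L$-$\mathcal C$ bicomodule, $T=\mathrm{End}^{\mathcal C}(\Sigma)$ (an $L$-ring by $l\mapsto(x\mapsto lx)$) and $\Sigma^*=\mathrm{Hom}_A(\Sigma,A)$, an $A$-$L$ bimodule by $(a\xi l)(x)=a\xi(lx)$. Then $\Sigma$, with $\tau_\Sigma$, and $T\otimes_L\mathcal D$, with the coaction $t\otimes d\mapsto t\otimes d_{(1)}\otimes d_{(2)}$,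 are $T$-$\mathcal D$ bicomodules. Put $$\widetilde Q=\{q\in{}_A\mathrm{Hom}_L(\mathcal C,\Sigma^*)\mid c^{(1)}q(c^{(2)})(x)=q(c)(x^{[0]})x^{[1]}\ \ \forall x\in\Sigma,\,c\in\mathcal C\}$$ and let $$\widetilde{\mathbb M}(\Sigma)=\big({}_L\mathrm{Hom}_L(\mathcal D,T),\ {}^{\mathcal C}\mathrm{End}^{\mathcal D}(\mathcal C)^{op},\ {}_L\mathrm{Hom}^{\mathcal D}(\mathcal D,\Sigma),\ \widetilde Q,\ \blacklozenge,\ \lozenge\big)$$ be the Morita context with the ring and bimodule structures $(vv')(d)=v(d_{(1)})v'(d_{(2)})$, $(uu')(c)=u'(u(c))$, $(vp)(d)=v(d_{(1)})(p(d_{(2)}))$, $(pu)(d)=p(d)^{[0]}\epsilon(u(p(d)^{[1]}))$, $(qv)(c)=q(c_{[0]})v(c_{[1]})$, $(uq)(c)=q(u(c))$, and the connecting maps $$\blacklozenge:\widetilde Q\otimes_{{}_L\mathrm{Hom}_L(\mathcal D,T)}{}_L\mathrm{Hom}^{\mathcal D}(\mathcal D,\Sigma)\to{}^{\mathcal C}\mathrm{End}^{\mathcal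 D}(\mathcal C)^{op},\qquad (q\blacklozenge p)(c)=q(c_{[0]})\big(p(c_{[1]})^{[0]}\big)\,p(c_{[1]})^{[1]},$$ $$\lozenge:{}_L\mathrm{Hom}^{\mathcal D}(\mathcal D,\Sigma)\otimes_{{}^{\mathcal C}\mathrm{End}^{\mathcal D}(\mathcal C)^{op}}\widetilde Q\to{}_L\mathrm{Hom}_L(\mathcal D,T),\qquad (p\lozenge q)(d)=p(d)^{[0]}q\big(p(d)^{[1]}\big)(-).$$ The context is strict if $\blacklozenge$ and $\lozenge$ are both surjective. The comodule $\Sigma$ is a Galois $\mathcal C$-comodule if for every right $A$-module $N$ the map $\mathrm{Hom}_A(\Sigma,N)\otimes_T\Sigma\to N\otimes_A\mathcal C$, $\phi\otimes x\mapsto\phi(x^{[0]})\otimes x^{[1]}$, is bijective. Then: (1) $\blacklozenge$ is surjective if and only if $\Sigma$ is a Galois $\mathcal C$-comodule and there is a non-negative integer $s$ such that $\Sigma$ is a direct summand of $(T\otimes_L\mathcal D)^s$ as a $T$-$\mathcal D$ bicomodule. (2) $\widetilde{\mathbb M}(\Sigma)$ is strict if and only if $\Sigma$ is a Galois $\mathcal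 C$-comodule and there are non-negative integers $s$ and $z$ such that, as $T$-$\mathcal D$ bicomodules, $\Sigma$ is a direct summand of $(T\otimes_L\mathcal D)^s$ and $T\otimes_L\mathcal D$ is a direct summand of $\Sigma^z$. -/

import Mathlib

open MulOpposite

universe u

namespace CoringMorita

/-! ### Tensor products over a (not necessarily commutative) ring

Right modules over a ring `A` are modules over `Aᵐᵒᵖ`. -/

section Tensor

/-- The relations `m a ⊗ n = m ⊗ a n`. -/
def balancedRel (A M N : Type*) [Ring A] [AddCommGroup M] [AddCommGroup N] [Module Aᵐᵒᵖ M]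
    [Module A N] : AddSubgroup (TensorProduct ℤ M N) :=
  AddSubgroup.closure {z | ∃ (m : M) (a : A) (n : N),
    z = TensorProduct.tmul ℤ (op a • m) n - TensorProduct.tmul ℤ m (a • n)}

/-- `BTensor A M N` is the tensor product `M ⊗_A N` of a right `A`-module `M` and a left
`A`-module `N`. -/
def BTensor (A M N : Type*) [Ring A] [AddCommGroup M] [AddCommGroup N] [Module Aᵐᵒᵖ M]
    [Module A N] : Type _ :=
  TensorProduct ℤ M N ⧸ balancedRel A M N

variable {A M N P : Type*} [Ring A] [AddCommGroup M] [AddCommGroup N] [AddCommGroup P]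
  [Module Aᵐᵒᵖ M] [Module A N]

namespace BTensor

instance : AddCommGroup (BTensor A M N) :=
  inferInstanceAs (AddCommGroup (TensorProduct ℤ M N ⧸ balancedRel A M N))

/-- The quotient map from the tensor product over `ℤ`. -/
def mk : TensorProduct ℤ M N →+ BTensor A M N :=
  QuotientAddGroup.mk' (balancedRel A M N)

variable (A) in
/-- The pure tensor `m ⊗_A n`. -/
def tmul (m : M) (n : N) : BTensor A M N :=
  mk (TensorProduct.tmul ℤ m n)

theorem add_tmul (m m' : M) (n : N) : tmul A (m + m') n = tmul A m n + tmul A m' n := by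
  simp only [tmul, TensorProduct.add_tmul, map_add]

theorem tmul_add (m : M) (n n' : N) : tmul A m (n + n') = tmul A m n + tmul A m n' := by
  simp only [tmul, TensorProduct.tmul_add, map_add]

theorem smul_tmul (m : M) (a : A) (n : N) : tmul A (op a • m) n = tmul A m (a • n) := by
  rw [← sub_eq_zero]
  simp only [tmul]
  rw [← map_sub]
  exact (QuotientAddGroup.eq_zero_iff _).2 (AddSubgroup.subset_closure ⟨m, a, n, rfl⟩)

theorem tmul_zero (m : M) : tmul A m (0 : N) = 0 := by
  simp only [tmul, TensorProduct.tmul_zero, map_zero]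

theorem zero_tmul (n : N) : tmul A (0 : M) n = 0 := by
  simp only [tmul, TensorProduct.zero_tmul, map_zero]

theorem induction {p : BTensor A M N → Prop} (z : BTensor A M N)
    (h : ∀ m n, p (tmul A m n)) (hadd : ∀ x y, p x → p y → p (x + y)) : p z := by
  obtain ⟨z, rfl⟩ : ∃ y, mk y = z := QuotientAddGroup.mk'_surjective _ z
  induction z using TensorProduct.induction_on with
  | zero =>
    have := h 0 0
    rwa [zero_tmul] at this
  | tmul m n => exact h m n
  | add x y hx hy =>
    rw [map_add]
    exact hadd _ _ hx hy

/-- Two additive maps out of a tensor product agree if they agree on pure tensors. -/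
theorem hom_ext {f g : BTensor A M N →+ P} (h : ∀ m n, f (tmul A m n) = g (tmul A m n)) :
    f = g := by
  ext z
  induction z using BTensor.induction with
  | h m n => exact h m n
  | hadd x y hx hy => rw [map_add, map_add, hx, hy]

/-- The additive map on `M ⊗_A N` given by a biadditive balanced map. -/
def lift (f : M → N → P) (hl : ∀ m m' n, f (m + m') n = f m n + f m' n)
    (hr : ∀ m n n', f m (n + n') = f m n + f m n')
    (hb : ∀ m (a : A) n, f (op a • m) n = f m (a • n)) : BTensor A M N →+ P :=
  QuotientAddGroup.lift (balancedRel A M N)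
    (TensorProduct.liftAddHom (R := ℤ)
      (AddMonoidHom.mk' (fun m => AddMonoidHom.mk' (f m) (hr m))
        (fun m m' => AddMonoidHom.ext (hl m m')))
      (fun r m n => by
        change (AddMonoidHom.mk' (fun m => f m n) (fun m m' => hl m m' n)) (r • m)
          = (AddMonoidHom.mk' (f m) (hr m)) (r • n)
        rw [map_zsmul, map_zsmul]
        rfl))
    ((AddSubgroup.closure_le _).2 (by
      rintro _ ⟨m, a, n, rfl⟩
      rw [SetLike.mem_coe, AddMonoidHom.mem_ker, map_sub, sub_eq_zero]
      exact hb m a n))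

@[simp] theorem lift_tmul (f : M → N → P) (hl : ∀ m m' n, f (m + m') n = f m n + f m' n)
    (hr : ∀ m n n', f m (n + n') = f m n + f m n')
    (hb : ∀ m (a : A) n, f (op a • m) n = f m (a • n)) (m : M) (n : N) :
    lift f hl hr hb (tmul A m n) = f m n :=
  rfl

/-- The map `f ⊗_A g` for a right `A`-linear map `f` and a left `A`-linear map `g`. -/
def map {M' N' : Type*} [AddCommGroup M'] [AddCommGroup N'] [Module Aᵐᵒᵖ M'] [Module A N']
    (f : M →+ M') (g : N →+ N') (hf : ∀ (a : A) m, f (op a • m) = op a • f m)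
    (hg : ∀ (a : A) n, g (a • n) = a • g n) : BTensor A M N →+ BTensor A M' N' :=
  lift (fun m n => tmul A (f m) (g n)) (fun m m' n => by rw [map_add, add_tmul])
    (fun m n n' => by rw [map_add, tmul_add]) (fun m a n => by rw [hf, hg, smul_tmul])

@[simp] theorem map_tmul {M' N' : Type*} [AddCommGroup M'] [AddCommGroup N'] [Module Aᵐᵒᵖ M']
    [Module A N'] (f : M →+ M') (g : N →+ N') (hf : ∀ (a : A) m, f (op a • m) = op a • f m)
    (hg : ∀ (a : A) n, g (a • n) = a • g n) (m : M) (n : N) :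
    map f g hf hg (tmul A m n) = tmul A (f m) (g n) :=
  rfl

/-- `f ⊗_A N`. -/
def rmap {M' : Type*} [AddCommGroup M'] [Module Aᵐᵒᵖ M'] (N : Type*) [AddCommGroup N] [Module A N]
    (f : M →+ M') (hf : ∀ (a : A) m, f (op a • m) = op a • f m) :
    BTensor A M N →+ BTensor A M' N :=
  map f (AddMonoidHom.id N) hf (fun _ _ => rfl)

@[simp] theorem rmap_tmul {M' : Type*} [AddCommGroup M'] [Module Aᵐᵒᵖ M'] (f : M →+ M')
    (hf : ∀ (a : A) m, f (op a • m) = op a • f m) (m : M) (n : N) :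
    rmap N f hf (tmul A m n) = tmul A (f m) n :=
  rfl

/-- `M ⊗_A g`. -/
def lmap {N' : Type*} [AddCommGroup N'] [Module A N'] (M : Type*) [AddCommGroup M]
    [Module Aᵐᵒᵖ M] (g : N →+ N') (hg : ∀ (a : A) n, g (a • n) = a • g n) :
    BTensor A M N →+ BTensor A M N' :=
  map (AddMonoidHom.id M) g (fun _ _ => rfl) hg

@[simp] theorem lmap_tmul {N' : Type*} [AddCommGroup N'] [Module A N'] (g : N →+ N')
    (hg : ∀ (a : A) n, g (a • n) = a • g n) (m : M) (n : N) :
    lmap M g hg (tmul A m n) = tmul A m (g n) :=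
  rfl

section left

variable {S : Type*} [Ring S] [Module S M] [SMulCommClass S Aᵐᵒᵖ M]

/-- `s (m ⊗ n) = s m ⊗ n`. -/
instance leftModule : Module S (BTensor A M N) where
  smul s := rmap N (DistribSMul.toAddMonoidHom M s) (fun a m => smul_comm s (op a) m)
  one_smul z := by
    induction z using BTensor.induction with
    | h m n => exact congrArg (tmul A · n) (one_smul S m)
    | hadd x y hx hy => exact (map_add _ x y).trans (congrArg₂ _ hx hy)
  mul_smul s t z := by
    induction z using BTensor.induction with
    | h m n => exact congrArg (tmul A · n) (mul_smul s t m)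
    | hadd x y hx hy =>
      refine (map_add _ x y).trans ((congrArg₂ _ hx hy).trans ?_)
      exact ((congrArg _ (map_add _ x y)).trans (map_add _ _ _)).symm
  smul_zero s := map_zero _
  smul_add s := map_add _
  add_smul s t z := by
    induction z using BTensor.induction with
    | h m n => exact (congrArg (tmul A · n) (add_smul s t m)).trans (add_tmul _ _ _)
    | hadd x y hx hy =>
      refine (map_add _ x y).trans ((congrArg₂ _ hx hy).trans ?_)
      refine (add_add_add_comm _ _ _ _).trans ?_
      exact (congrArg₂ _ (map_add _ x y) (map_add _ x y)).symm
  zero_smul z := by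
    induction z using BTensor.induction with
    | h m n => exact (congrArg (tmul A · n) (zero_smul S m)).trans (zero_tmul _)
    | hadd x y hx hy => exact (map_add _ x y).trans ((congrArg₂ _ hx hy).trans (add_zero _))

@[simp] theorem left_smul_tmul (s : S) (m : M) (n : N) :
    s • tmul A m n = tmul A (s • m) n :=
  rfl

end left

section right

variable {S : Type*} [Ring S] [Module Sᵐᵒᵖ N] [SMulCommClass A Sᵐᵒᵖ N]

/-- `(m ⊗ n) s = m ⊗ n s`. -/
instance rightModule : Module Sᵐᵒᵖ (BTensor A M N) where
  smul s := lmap M (DistribSMul.toAddMonoidHom N s) (fun a n => (smul_comm a s n).symm)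
  one_smul z := by
    induction z using BTensor.induction with
    | h m n => exact congrArg (tmul A m) (one_smul Sᵐᵒᵖ n)
    | hadd x y hx hy => exact (map_add _ x y).trans (congrArg₂ _ hx hy)
  mul_smul s t z := by
    induction z using BTensor.induction with
    | h m n => exact congrArg (tmul A m) (mul_smul s t n)
    | hadd x y hx hy =>
      refine (map_add _ x y).trans ((congrArg₂ _ hx hy).trans ?_)
      exact ((congrArg _ (map_add _ x y)).trans (map_add _ _ _)).symm
  smul_zero s := map_zero _
  smul_add s := map_add _
  add_smul s t z := by
    induction z using BTensor.induction with
    | h m n => exact (congrArg (tmul A m) (add_smul s t n)).trans (tmul_add _ _ _)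
    | hadd x y hx hy =>
      refine (map_add _ x y).trans ((congrArg₂ _ hx hy).trans ?_)
      refine (add_add_add_comm _ _ _ _).trans ?_
      exact (congrArg₂ _ (map_add _ x y) (map_add _ x y)).symm
  zero_smul z := by
    induction z using BTensor.induction with
    | h m n => exact (congrArg (tmul A m) (zero_smul Sᵐᵒᵖ n)).trans (tmul_zero _)
    | hadd x y hx hy => exact (map_add _ x y).trans ((congrArg₂ _ hx hy).trans (add_zero _))

@[simp] theorem right_smul_tmul (s : S) (m : M) (n : N) :
    op s • tmul A m n = tmul A m (op s • n) :=
  rfl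

end right

instance {S S' : Type*} [Ring S] [Module S M] [SMulCommClass S Aᵐᵒᵖ M] [Ring S'] [Module S'ᵐᵒᵖ N]
    [SMulCommClass A S'ᵐᵒᵖ N] : SMulCommClass S S'ᵐᵒᵖ (BTensor A M N) where
  smul_comm s t z := by
    induction z using BTensor.induction with
    | h m n => rfl
    | hadd x y hx hy => rw [smul_add, smul_add, smul_add, smul_add, hx, hy]

section assoc

variable {B : Type*} [Ring B] [Module Bᵐᵒᵖ N] [SMulCommClass A Bᵐᵒᵖ N] [Module B P]

/-- The canonical map `(M ⊗_A N) ⊗_B P → M ⊗_A (N ⊗_B P)`. -/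
def assocHom : BTensor B (BTensor A M N) P →+ BTensor A M (BTensor B N P) :=
  lift (fun z p => lmap (N' := BTensor B N P) M
      (AddMonoidHom.mk' (fun n => tmul B n p) (fun n n' => add_tmul n n' p)) (fun _ _ => rfl) z)
    (fun z z' p => map_add _ z z')
    (fun z p p' => by
      induction z using BTensor.induction with
      | h m n => exact (congrArg (tmul A m) (tmul_add n p p')).trans (tmul_add _ _ _)
      | hadd x y hx hy => rw [map_add, map_add, map_add, hx, hy, add_add_add_comm])
    (fun z b p => by
      induction z using BTensor.induction with
      | h m n => exact congrArg (tmul A m) (smul_tmul n b p)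
      | hadd x y hx hy => rw [smul_add, map_add, map_add, hx, hy])

/-- The canonical map `M ⊗_A (N ⊗_B P) → (M ⊗_A N) ⊗_B P`. -/
def assocInv : BTensor A M (BTensor B N P) →+ BTensor B (BTensor A M N) P :=
  lift (fun m z => rmap (M' := BTensor A M N) P
      (AddMonoidHom.mk' (fun n => tmul A m n) (fun n n' => tmul_add m n n')) (fun _ _ => rfl) z)
    (fun m m' z => by
      induction z using BTensor.induction with
      | h n p => exact (congrArg (tmul B · p) (add_tmul m m' n)).trans (add_tmul _ _ _)
      | hadd x y hx hy => rw [map_add, map_add, map_add, hx, hy, add_add_add_comm])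
    (fun m z z' => map_add _ z z')
    (fun m a z => by
      induction z using BTensor.induction with
      | h n p => exact congrArg (tmul B · p) (smul_tmul m a n)
      | hadd x y hx hy => rw [smul_add, map_add, map_add, hx, hy])

@[simp] theorem assocHom_tmul (m : M) (n : N) (p : P) :
    assocHom (tmul B (tmul A m n) p) = tmul A m (tmul B n p) :=
  rfl

@[simp] theorem assocInv_tmul (m : M) (n : N) (p : P) :
    assocInv (tmul A m (tmul B n p)) = tmul B (tmul A m n) p :=
  rfl

/-- The associativity isomorphism `(M ⊗_A N) ⊗_B P ≃ M ⊗_A (N ⊗_B P)`. -/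
def assoc : BTensor B (BTensor A M N) P ≃+ BTensor A M (BTensor B N P) where
  toFun := assocHom
  invFun := assocInv
  map_add' := map_add _
  left_inv z := by
    induction z using BTensor.induction with
    | h z p =>
      induction z using BTensor.induction with
      | h m n => rfl
      | hadd x y hx hy => rw [add_tmul, map_add, map_add, hx, hy]
    | hadd x y hx hy => rw [map_add, map_add, hx, hy]
  right_inv z := by
    induction z using BTensor.induction with
    | h m z =>
      induction z using BTensor.induction with
      | h n p => rfl
      | hadd x y hx hy => rw [tmul_add, map_add, map_add, hx, hy]
    | hadd x y hx hy => rw [map_add, map_add, hx, hy]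

@[simp] theorem assoc_tmul (m : M) (n : N) (p : P) :
    assoc (tmul B (tmul A m n) p) = tmul A m (tmul B n p) :=
  rfl

@[simp] theorem assoc_symm_tmul (m : M) (n : N) (p : P) :
    assoc.symm (tmul A m (tmul B n p)) = tmul B (tmul A m n) p :=
  rfl

end assoc

end BTensor

end Tensor

/-! ### Corings, comodules and bicomodules -/

section Basic

/-- The map `M ⊗_A C → M`, `m ⊗ c ↦ m g(c)`, for a left `A`-linear map `g : C → A`. -/
def contract {A C : Type*} [Ring A] [AddCommGroup C] [Module A C] (M : Type*) [AddCommGroup M]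
    [Module Aᵐᵒᵖ M] (g : C →+ A) (hg : ∀ (a : A) c, g (a • c) = a * g c) : BTensor A M C →+ M :=
  BTensor.lift (fun m c => op (g c) • m) (fun m m' c => smul_add _ _ _)
    (fun m c c' => by rw [map_add, op_add, add_smul])
    (fun m a c => by rw [hg, op_mul, mul_smul])

/-- The map `M ⊗_A C → C`, `m ⊗ c ↦ g(m) c`, for a right `A`-linear map `g : M → A`. -/
def lcontract {A M : Type*} [Ring A] [AddCommGroup M] [Module Aᵐᵒᵖ M] (C : Type*)
    [AddCommGroup C] [Module A C] (g : M →+ A) (hg : ∀ (a : A) m, g (op a • m) = g m * a) :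
    BTensor A M C →+ C :=
  BTensor.lift (fun m c => g m • c) (fun m m' c => by rw [map_add, add_smul])
    (fun m c c' => smul_add _ _ _) (fun m a c => by rw [hg, mul_smul])

@[simp] theorem contract_tmul {A C M : Type*} [Ring A] [AddCommGroup C] [Module A C]
    [AddCommGroup M] [Module Aᵐᵒᵖ M] (g : C →+ A) (hg : ∀ (a : A) c, g (a • c) = a * g c)
    (m : M) (c : C) : contract M g hg (BTensor.tmul A m c) = op (g c) • m :=
  rfl

@[simp] theorem lcontract_tmul {A C M : Type*} [Ring A] [AddCommGroup C] [Module A C]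
    [AddCommGroup M] [Module Aᵐᵒᵖ M] (g : M →+ A) (hg : ∀ (a : A) m, g (op a • m) = g m * a)
    (m : M) (c : C) : lcontract C g hg (BTensor.tmul A m c) = g m • c :=
  rfl

/-- An `A`-coring structure on the `A`-`A` bimodule `C`. -/
class Coring (A C : Type*) [Ring A] [AddCommGroup C] [Module A C] [Module Aᵐᵒᵖ C]
    [SMulCommClass A Aᵐᵒᵖ C] where
  comul : C →+ BTensor A C C
  counit : C →+ A
  comul_smul : ∀ (a : A) (c : C), comul (a • c) = a • comul c
  comul_op_smul : ∀ (a : A) (c : C), comul (op a • c) = op a • comul c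
  counit_smul : ∀ (a : A) (c : C), counit (a • c) = a * counit c
  counit_op_smul : ∀ (a : A) (c : C), counit (op a • c) = counit c * a
  coassoc : ∀ c : C, BTensor.assoc (BTensor.rmap C comul comul_op_smul (comul c))
    = BTensor.lmap C comul comul_smul (comul c)
  contract_comul : ∀ c : C, contract C counit counit_smul (comul c) = c
  lcontract_comul : ∀ c : C, lcontract C counit counit_op_smul (comul c) = c

/-- The coproduct `Δ`. -/
abbrev comul (A C : Type*) [Ring A] [AddCommGroup C] [Module A C] [Module Aᵐᵒᵖ C]
    [SMulCommClass A Aᵐᵒᵖ C] [Coring A C] : C →+ BTensor A C C :=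
  Coring.comul

/-- The counit `ε`. -/
abbrev counit (A C : Type*) [Ring A] [AddCommGroup C] [Module A C] [Module Aᵐᵒᵖ C]
    [SMulCommClass A Aᵐᵒᵖ C] [Coring A C] : C →+ A :=
  Coring.counit

/-- A right comodule structure for the `A`-coring `C` on the right `A`-module `M`. -/
class RightComodule (A C M : Type*) [Ring A] [AddCommGroup C] [Module A C] [Module Aᵐᵒᵖ C]
    [SMulCommClass A Aᵐᵒᵖ C] [Coring A C] [AddCommGroup M] [Module Aᵐᵒᵖ M] where
  coact : M →+ BTensor A M C
  coact_op_smul : ∀ (a : A) (m : M), coact (op a • m) = op a • coact m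
  coassoc : ∀ m : M, BTensor.assoc (BTensor.rmap C coact coact_op_smul (coact m))
    = BTensor.lmap M (comul A C) Coring.comul_smul (coact m)
  contract_coact : ∀ m : M, contract M (counit A C) Coring.counit_smul (coact m) = m

/-- The right coaction `M → M ⊗_A C`. -/
abbrev coaction (A C M : Type*) [Ring A] [AddCommGroup C] [Module A C] [Module Aᵐᵒᵖ C]
    [SMulCommClass A Aᵐᵒᵖ C] [Coring A C] [AddCommGroup M] [Module Aᵐᵒᵖ M]
    [RightComodule A C M] : M →+ BTensor A M C :=
  RightComodule.coact

/-- `f` is a morphism of right `C`-comodules. -/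
structure IsColinear (A C : Type*) {M N : Type*} [Ring A] [AddCommGroup C] [Module A C]
    [Module Aᵐᵒᵖ C] [SMulCommClass A Aᵐᵒᵖ C] [Coring A C] [AddCommGroup M] [Module Aᵐᵒᵖ M]
    [RightComodule A C M] [AddCommGroup N] [Module Aᵐᵒᵖ N] [RightComodule A C N]
    (f : M →+ N) : Prop where
  op_smul : ∀ (a : A) (m : M), f (op a • m) = op a • f m
  coact : ∀ m : M, coaction A C N (f m) = BTensor.rmap C f op_smul (coaction A C M m)

/-- `M` is an `S`-`C` bicomodule: an `S`-`A` bimodule and a right `C`-comodule whose coaction is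
left `S`-linear. -/
class IsBicomodule (S A C M : Type*) [Ring S] [Ring A] [AddCommGroup C] [Module A C]
    [Module Aᵐᵒᵖ C] [SMulCommClass A Aᵐᵒᵖ C] [Coring A C] [AddCommGroup M] [Module Aᵐᵒᵖ M]
    [RightComodule A C M] [Module S M] [SMulCommClass S Aᵐᵒᵖ M] : Prop where
  coact_smul : ∀ (s : S) (m : M), coaction A C M (s • m) = s • coaction A C M m

end Basic

section TensorLemmas

namespace BTensor

variable {A M M' M'' N N' : Type*} [Ring A] [AddCommGroup M] [AddCommGroup N] [AddCommGroup M']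
  [AddCommGroup M''] [AddCommGroup N']
  [Module Aᵐᵒᵖ M] [Module A N] [Module Aᵐᵒᵖ M'] [Module Aᵐᵒᵖ M''] [Module A N']

theorem rmap_congr (f g : M →+ M') (h : ∀ m, f m = g m)
    {hf : ∀ (a : A) m, f (op a • m) = op a • f m} {hg : ∀ (a : A) m, g (op a • m) = op a • g m}
    (z : BTensor A M N) : rmap N f hf z = rmap N g hg z := by
  obtain rfl : f = g := AddMonoidHom.ext h
  rfl

theorem lmap_congr (f g : N →+ N') (h : ∀ n, f n = g n)
    {hf : ∀ (a : A) n, f (a • n) = a • f n} {hg : ∀ (a : A) n, g (a • n) = a • g n}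
    (z : BTensor A M N) : lmap M f hf z = lmap M g hg z := by
  obtain rfl : f = g := AddMonoidHom.ext h
  rfl

theorem rmap_id (z : BTensor A M N)
    (h : ∀ (a : A) (m : M), AddMonoidHom.id M (op a • m) = op a • AddMonoidHom.id M m) :
    rmap N (AddMonoidHom.id M) h z = z := by
  induction z using BTensor.induction with
  | h m n => rfl
  | hadd x y hx hy => rw [map_add, hx, hy]

theorem lmap_id (z : BTensor A M N)
    (h : ∀ (a : A) (n : N), AddMonoidHom.id N (a • n) = a • AddMonoidHom.id N n) :
    lmap M (AddMonoidHom.id N) h z = z := by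
  induction z using BTensor.induction with
  | h m n => rfl
  | hadd x y hx hy => rw [map_add, hx, hy]

theorem rmap_comp' (f : M →+ M') (g : M' →+ M'')
    (hf : ∀ (a : A) m, f (op a • m) = op a • f m) (hg : ∀ (a : A) m, g (op a • m) = op a • g m)
    (z : BTensor A M N) : rmap N g hg (rmap N f hf z)
      = rmap N (g.comp f) (fun a m => (congrArg g (hf a m)).trans (hg a (f m))) z := by
  induction z using BTensor.induction with
  | h m n => rfl
  | hadd x y hx hy => simp only [map_add, hx, hy]

theorem lmap_comp' {N'' : Type*} [AddCommGroup N''] [Module A N''] (f : N →+ N') (g : N' →+ N'')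
    (hf : ∀ (a : A) n, f (a • n) = a • f n) (hg : ∀ (a : A) n, g (a • n) = a • g n)
    (z : BTensor A M N) : lmap M g hg (lmap M f hf z)
      = lmap M (g.comp f) (fun a n => (congrArg g (hf a n)).trans (hg a (f n))) z := by
  induction z using BTensor.induction with
  | h m n => rfl
  | hadd x y hx hy => simp only [map_add, hx, hy]

theorem lmap_rmap (f : M →+ M') (g : N →+ N')
    (hf : ∀ (a : A) m, f (op a • m) = op a • f m) (hg : ∀ (a : A) n, g (a • n) = a • g n)
    (z : BTensor A M N) : lmap M' g hg (rmap N f hf z) = rmap N' f hf (lmap M g hg z) := by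
  induction z using BTensor.induction with
  | h m n => rfl
  | hadd x y hx hy => simp only [map_add, hx, hy]

theorem rmap_op_smul {S : Type*} [Ring S] [Module Sᵐᵒᵖ N] [SMulCommClass A Sᵐᵒᵖ N] (f : M →+ M')
    (hf : ∀ (a : A) m, f (op a • m) = op a • f m) (s : S) (z : BTensor A M N) :
    rmap N f hf (op s • z) = op s • rmap N f hf z := by
  induction z using BTensor.induction with
  | h m n => rfl
  | hadd x y hx hy => simp only [map_add, smul_add, hx, hy]

theorem rmap_smul {S : Type*} [Ring S] [Module S M] [SMulCommClass S Aᵐᵒᵖ M] [Module S M']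
    [SMulCommClass S Aᵐᵒᵖ M'] (f : M →+ M') (hf : ∀ (a : A) m, f (op a • m) = op a • f m)
    (hS : ∀ (s : S) m, f (s • m) = s • f m) (s : S) (z : BTensor A M N) :
    rmap N f hf (s • z) = s • rmap N f hf z := by
  induction z using BTensor.induction with
  | h m n => simp [hS]
  | hadd x y hx hy => simp only [map_add, smul_add, hx, hy]

theorem lmap_smul {S : Type*} [Ring S] [Module S M] [SMulCommClass S Aᵐᵒᵖ M] (g : N →+ N')
    (hg : ∀ (a : A) n, g (a • n) = a • g n) (s : S) (z : BTensor A M N) :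
    lmap M g hg (s • z) = s • lmap M g hg z := by
  induction z using BTensor.induction with
  | h m n => rfl
  | hadd x y hx hy => simp only [map_add, smul_add, hx, hy]

theorem lmap_op_smul {S : Type*} [Ring S] [Module Sᵐᵒᵖ N] [SMulCommClass A Sᵐᵒᵖ N]
    [Module Sᵐᵒᵖ N'] [SMulCommClass A Sᵐᵒᵖ N'] (g : N →+ N')
    (hg : ∀ (a : A) n, g (a • n) = a • g n) (hS : ∀ (s : S) n, g (op s • n) = op s • g n) (s : S)
    (z : BTensor A M N) : lmap M g hg (op s • z) = op s • lmap M g hg z := by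
  induction z using BTensor.induction with
  | h m n => simp [hS]
  | hadd x y hx hy => simp only [map_add, smul_add, hx, hy]

section

variable {B P P' : Type*} [Ring B] [Module Bᵐᵒᵖ N] [SMulCommClass A Bᵐᵒᵖ N] [AddCommGroup P]
  [Module B P] [AddCommGroup P'] [Module B P'] [Module Bᵐᵒᵖ N'] [SMulCommClass A Bᵐᵒᵖ N']

theorem assoc_rmap_rmap (f : M →+ M') (hf : ∀ (a : A) m, f (op a • m) = op a • f m)
    (z : BTensor B (BTensor A M N) P) :
    assoc (rmap P (rmap N f hf) (rmap_op_smul f hf) z) = rmap (BTensor B N P) f hf (assoc z) := by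
  induction z using BTensor.induction with
  | h z p =>
    induction z using BTensor.induction with
    | h m n => rfl
    | hadd x y hx hy => simp only [add_tmul, map_add, hx, hy]
  | hadd x y hx hy => simp only [map_add, hx, hy]

theorem assoc_rmap_lmap (g : N →+ N') (hg : ∀ (a : A) n, g (a • n) = a • g n)
    (hB : ∀ (b : B) n, g (op b • n) = op b • g n) (z : BTensor B (BTensor A M N) P) :
    assoc (rmap P (lmap M g hg) (lmap_op_smul g hg hB) z)
      = lmap M (rmap P g hB) (rmap_smul g hB hg) (assoc z) := by
  induction z using BTensor.induction with
  | h z p =>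
    induction z using BTensor.induction with
    | h m n => rfl
    | hadd x y hx hy => simp only [add_tmul, map_add, hx, hy]
  | hadd x y hx hy => simp only [map_add, hx, hy]

theorem assoc_lmap (g : P →+ P') (hg : ∀ (b : B) n, g (b • n) = b • g n)
    (z : BTensor B (BTensor A M N) P) :
    assoc (lmap (BTensor A M N) g hg z) = lmap M (lmap N g hg) (lmap_smul g hg) (assoc z) := by
  induction z using BTensor.induction with
  | h z p =>
    induction z using BTensor.induction with
    | h m n => rfl
    | hadd x y hx hy => simp only [add_tmul, map_add, hx, hy]
  | hadd x y hx hy => simp only [map_add, hx, hy]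

theorem assoc_smul {S : Type*} [Ring S] [Module S M] [SMulCommClass S Aᵐᵒᵖ M] (s : S)
    (z : BTensor B (BTensor A M N) P) : assoc (s • z) = s • assoc z := by
  induction z using BTensor.induction with
  | h z p =>
    induction z using BTensor.induction with
    | h m n => rfl
    | hadd x y hx hy => simp only [add_tmul, map_add, smul_add, hx, hy]
  | hadd x y hx hy => simp only [map_add, smul_add, hx, hy]

theorem assoc_op_smul {S : Type*} [Ring S] [Module Sᵐᵒᵖ P] [SMulCommClass B Sᵐᵒᵖ P] (s : S)
    (z : BTensor B (BTensor A M N) P) : assoc (op s • z) = op s • assoc z := by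
  induction z using BTensor.induction with
  | h z p =>
    induction z using BTensor.induction with
    | h m n => rfl
    | hadd x y hx hy => simp only [add_tmul, map_add, smul_add, hx, hy]
  | hadd x y hx hy => simp only [map_add, smul_add, hx, hy]

theorem assoc_symm_smul {S : Type*} [Ring S] [Module S M] [SMulCommClass S Aᵐᵒᵖ M] (s : S)
    (z : BTensor A M (BTensor B N P)) : assoc.symm (s • z) = s • assoc.symm z := by
  rw [AddEquiv.symm_apply_eq, assoc_smul, AddEquiv.apply_symm_apply]

theorem assoc_symm_op_smul {S : Type*} [Ring S] [Module Sᵐᵒᵖ P] [SMulCommClass B Sᵐᵒᵖ P] (s : S)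
    (z : BTensor A M (BTensor B N P)) : assoc.symm (op s • z) = op s • assoc.symm z := by
  rw [AddEquiv.symm_apply_eq, assoc_op_smul, AddEquiv.apply_symm_apply]

end

end BTensor

end TensorLemmas

section ContractLemmas

open BTensor

variable {A C M M' : Type*} [Ring A] [AddCommGroup C] [Module A C] [AddCommGroup M]
  [Module Aᵐᵒᵖ M] [AddCommGroup M'] [Module Aᵐᵒᵖ M']

theorem contract_rmap (g : C →+ A) (hg : ∀ (a : A) c, g (a • c) = a * g c) (f : M →+ M')
    (hf : ∀ (a : A) m, f (op a • m) = op a • f m) (z : BTensor A M C) :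
    contract M' g hg (rmap C f hf z) = f (contract M g hg z) := by
  induction z using BTensor.induction with
  | h m c => simp [hf]
  | hadd x y hx hy => simp only [map_add, hx, hy]

theorem contract_smul {S : Type*} [Ring S] [Module S M] [SMulCommClass S Aᵐᵒᵖ M] (g : C →+ A)
    (hg : ∀ (a : A) c, g (a • c) = a * g c) (s : S) (z : BTensor A M C) :
    contract M g hg (s • z) = s • contract M g hg z := by
  induction z using BTensor.induction with
  | h m c => simp [smul_comm]
  | hadd x y hx hy => simp only [map_add, smul_add, hx, hy]

theorem contract_assoc_symm {B N : Type*} [Ring B] [AddCommGroup N] [Module B N]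
    [Module Aᵐᵒᵖ N] [SMulCommClass B Aᵐᵒᵖ N] {M : Type*} [AddCommGroup M] [Module Bᵐᵒᵖ M]
    (g : C →+ A) (hg : ∀ (a : A) c, g (a • c) = a * g c) (z : BTensor B M (BTensor A N C)) :
    contract (BTensor B M N) g hg (assoc.symm z)
      = lmap M (contract N g hg) (contract_smul g hg) z := by
  induction z using BTensor.induction with
  | h m z =>
    induction z using BTensor.induction with
    | h n c => rfl
    | hadd x y hx hy => simp only [tmul_add, map_add, hx, hy]
  | hadd x y hx hy => simp only [map_add, hx, hy]

end ContractLemmas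

section Pow

open BTensor

variable {A C M : Type*} [Ring A] [AddCommGroup C] [Module A C]
    [Module Aᵐᵒᵖ C] [SMulCommClass A Aᵐᵒᵖ C] [Coring A C] [AddCommGroup M] [Module Aᵐᵒᵖ M]
    [RightComodule A C M] {ι : Type*} [DecidableEq ι]

/-- The `i`-th inclusion of `M` into the direct sum of copies of `M`. -/
abbrev incl (M : Type*) [AddCommGroup M] (i : ι) : M →+ (ι → M) :=
  AddMonoidHom.single (fun _ : ι => M) i

theorem incl_op_smul (i : ι) (a : A) (m : M) : incl M i (op a • m) = op a • incl M i m :=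
  Pi.single_smul (f := fun _ : ι => M) i (op a) m

variable [Fintype ι]

variable (A C M ι) in
/-- The componentwise coaction on the direct sum of copies of `M` indexed by `ι`. -/
def powCoact : (ι → M) →+ BTensor A (ι → M) C :=
  ∑ i, (rmap C (incl M i) (incl_op_smul i)).comp
    ((coaction A C M).comp (Pi.evalAddMonoidHom (fun _ : ι => M) i))

theorem powCoact_apply (m : ι → M) :
    powCoact A C M ι m = ∑ i, rmap C (incl M i) (incl_op_smul i) (coaction A C M (m i)) := by
  simp [powCoact, AddMonoidHom.finsetSum_apply]

theorem powCoact_incl (i : ι) (m : M) :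
    powCoact A C M ι (incl M i m) = rmap C (incl M i) (incl_op_smul i) (coaction A C M m) := by
  rw [powCoact_apply, Finset.sum_eq_single i]
  · simp
  · intro j _ hj
    simp [Pi.single_eq_of_ne hj]
  · simp

theorem powCoact_op_smul (a : A) (m : ι → M) :
    powCoact A C M ι (op a • m) = op a • powCoact A C M ι m := by
  simp only [powCoact_apply, Finset.smul_sum, Pi.smul_apply, RightComodule.coact_op_smul]
  refine Finset.sum_congr rfl fun i _ => ?_
  exact rmap_op_smul _ _ _ _

/-- The direct sum of copies of a comodule, with the componentwise coaction. -/
instance powComodule : RightComodule A C (ι → M) where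
  coact := powCoact A C M ι
  coact_op_smul := powCoact_op_smul
  coassoc m := by
    rw [powCoact_apply]
    simp only [map_sum]
    refine Finset.sum_congr rfl fun i _ => ?_
    rw [lmap_rmap, ← RightComodule.coassoc, ← assoc_rmap_rmap, rmap_comp', rmap_comp']
    refine congrArg _ (rmap_congr _ _ (fun m => ?_) _)
    exact powCoact_incl i m
  contract_coact m := by
    rw [powCoact_apply, map_sum]
    conv_rhs => rw [← Finset.univ_sum_single m]
    refine Finset.sum_congr rfl fun i _ => ?_
    rw [contract_rmap, RightComodule.contract_coact]
    rfl

instance powBicomodule {S : Type*} [Ring S] [Module S M] [SMulCommClass S Aᵐᵒᵖ M]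
    [IsBicomodule S A C M] : IsBicomodule S A C (ι → M) where
  coact_smul s m := by
    change powCoact A C M ι (s • m) = s • powCoact A C M ι m
    simp only [powCoact_apply, Finset.smul_sum, Pi.smul_apply]
    refine Finset.sum_congr rfl fun i _ => ?_
    rw [IsBicomodule.coact_smul, rmap_smul]
    exact fun s m => Pi.single_smul (f := fun _ : ι => M) i s m

end Pow

/-! ### Coring extensions and the induced comodules -/

/-- The `L`-coring `D` is a right extension of the `A`-coring `C`: the `A`-`L` bimodule `C` is a
right `D`-comodule such that the `D`-coaction is left `A`-linear and the coproduct of `C` is right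
`D`-colinear, where `C ⊗_A C` has the coaction of the second factor. -/
class CoringExtension (A C L D : Type*) [Ring A] [AddCommGroup C] [Module A C] [Module Aᵐᵒᵖ C]
    [SMulCommClass A Aᵐᵒᵖ C] [Coring A C] [Ring L] [AddCommGroup D] [Module L D] [Module Lᵐᵒᵖ D]
    [SMulCommClass L Lᵐᵒᵖ D] [Coring L D] [Module Lᵐᵒᵖ C] [SMulCommClass A Lᵐᵒᵖ C] extends
    RightComodule L D C where
  coact_smul : ∀ (a : A) (c : C), coact (a • c) = a • coact c
  comul_op_smul : ∀ (l : L) (c : C), comul A C (op l • c) = op l • comul A C c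
  comul_colinear : ∀ c : C, BTensor.rmap D (comul A C) comul_op_smul (coact c)
    = BTensor.assoc.symm (BTensor.lmap C coact coact_smul (comul A C c))

section Induced

set_option linter.unusedSectionVars false

open BTensor

variable {A C L D : Type u} [Ring A] [AddCommGroup C] [Module A C] [Module Aᵐᵒᵖ C]
  [SMulCommClass A Aᵐᵒᵖ C] [Coring A C] [Ring L] [AddCommGroup D] [Module L D] [Module Lᵐᵒᵖ D]
  [SMulCommClass L Lᵐᵒᵖ D] [Coring L D] [Module Lᵐᵒᵖ C] [SMulCommClass A Lᵐᵒᵖ C]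

theorem coact_contract {M : Type u} [AddCommGroup M] [Module Aᵐᵒᵖ M] [RightComodule A C M]
    (g : C →+ A) (hg : ∀ (a : A) c, g (a • c) = a * g c) (m : M) :
    coaction A C M (contract M g hg (coaction A C M m))
      = lmap M ((contract C g hg).comp (comul A C))
        (fun a c => (congrArg _ (Coring.comul_smul a c)).trans (contract_smul g hg a _))
        (coaction A C M m) := by
  rw [← contract_rmap g hg (coaction A C M) RightComodule.coact_op_smul,
    ← AddEquiv.symm_apply_apply assoc (rmap C _ _ _), RightComodule.coassoc, contract_assoc_symm,
    lmap_comp']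

theorem contract_counit_comp {f : C →+ C} (hf : ∀ (a : A) c, f (a • c) = a • f c)
    (hc : ∀ c, comul A C (f c) = lmap C f hf (comul A C c)) (c : C) :
    contract C ((counit A C).comp f)
      (fun a c => (congrArg _ (hf a c)).trans (Coring.counit_smul a (f c))) (comul A C c) = f c := by
  conv_rhs => rw [← Coring.contract_comul (A := A) (f c), hc]
  induction comul A C c using BTensor.induction with
  | h m n => rfl
  | hadd x y hx hy => simp only [map_add, hx, hy]

variable [CoringExtension A C L D]

/-- Right multiplication by `l ∈ L` on `C`. -/
abbrev rmulHom (C : Type u) {L : Type u} [Ring L] [AddCommGroup C] [Module Lᵐᵒᵖ C] (l : L) :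
    C →+ C :=
  DistribSMul.toAddMonoidHom C (op l)

theorem rmulHom_smul (l : L) (a : A) (c : C) : rmulHom C l (a • c) = a • rmulHom C l c :=
  (smul_comm a (op l) c).symm

section TensorCoact

variable {M : Type u} [AddCommGroup M] [Module Aᵐᵒᵖ M]

variable (A C L D M) in
/-- The map `M ⊗_A C → M ⊗_A C ⊗_L D` given by the `D`-coaction of `C`. -/
def tensorCoact : BTensor A M C →+ BTensor L (BTensor A M C) D :=
  assoc.symm.toAddMonoidHom.comp (lmap M (coaction L D C) (CoringExtension.coact_smul (A := A)))

/-- The map `n ↦ m ⊗ n`. -/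
def tmulHom {A M : Type*} (N : Type*) [Ring A] [AddCommGroup M] [AddCommGroup N] [Module Aᵐᵒᵖ M]
    [Module A N] (m : M) : N →+ BTensor A M N :=
  AddMonoidHom.mk' (fun n => tmul A m n) (fun n n' => tmul_add m n n')

theorem tmulHom_op_smul {S : Type*} {A M N : Type*} [Ring A] [AddCommGroup M] [AddCommGroup N]
    [Module Aᵐᵒᵖ M] [Module A N] [Ring S] [Module Sᵐᵒᵖ N] [SMulCommClass A Sᵐᵒᵖ N] (m : M) (s : S)
    (n : N) : tmulHom N m (op s • n) = op s • (tmulHom N m n : BTensor A M N) :=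
  rfl

theorem tensorCoact_tmul (m : M) (c : C) : tensorCoact A C L D M (tmul A m c)
    = rmap D (tmulHom C m) (tmulHom_op_smul m) (coaction L D C c) := by
  change assoc.symm (tmul A m (coaction L D C c)) = _
  induction coaction L D C c using BTensor.induction with
  | h c d => rfl
  | hadd x y hx hy => simp only [tmul_add, map_add, hx, hy]

theorem tensorCoact_rmap {M' : Type u} [AddCommGroup M'] [Module Aᵐᵒᵖ M'] (f : M →+ M')
    (hf : ∀ (a : A) m, f (op a • m) = op a • f m) (z : BTensor A M C) :
    tensorCoact A C L D M' (rmap C f hf z)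
      = rmap D (rmap C f hf) (rmap_op_smul f hf) (tensorCoact A C L D M z) := by
  induction z using BTensor.induction with
  | h m c =>
    rw [rmap_tmul, tensorCoact_tmul, tensorCoact_tmul, rmap_comp']
    rfl
  | hadd x y hx hy => simp only [map_add, hx, hy]

theorem tensorCoact_op_smul (l : L) (z : BTensor A M C) :
    tensorCoact A C L D M (op l • z) = op l • tensorCoact A C L D M z := by
  refine (congrArg assoc.symm (lmap_op_smul _ _ RightComodule.coact_op_smul l z)).trans ?_
  exact assoc_symm_op_smul l _

theorem tensorCoact_coassoc (z : BTensor A M C) :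
    assoc (rmap D (tensorCoact A C L D M) tensorCoact_op_smul (tensorCoact A C L D M z))
      = lmap (BTensor A M C) (comul L D) Coring.comul_smul (tensorCoact A C L D M z) := by
  induction z using BTensor.induction with
  | h m c =>
    rw [tensorCoact_tmul, lmap_rmap, ← RightComodule.coassoc, ← assoc_rmap_rmap, rmap_comp',
      rmap_comp']
    refine congrArg _ (rmap_congr _ _ (fun c => ?_) _)
    exact tensorCoact_tmul m c
  | hadd x y hx hy => simp only [map_add, hx, hy]

end TensorCoact

/-- The underlying right `L`-module, and right `D`-comodule, of a right `C`-comodule `M`. -/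
def UObj (_A _C _L _D M : Type u) : Type u :=
  M

variable {M : Type u} [AddCommGroup M] [Module Aᵐᵒᵖ M] [RightComodule A C M]

instance : AddCommGroup (UObj A C L D M) := inferInstanceAs (AddCommGroup M)

variable (A C L M) in
/-- The right action `m l = m^{[0]} ε(m^{[1]} l)`. -/
def indAct (l : L) : M →+ M :=
  (contract M ((counit A C).comp (rmulHom C l))
    (fun a c => (congrArg _ (rmulHom_smul l a c)).trans (Coring.counit_smul a _))).comp
    (coaction A C M)

theorem coact_indAct (h : ∀ (l : L) (c : C), comul A C (op l • c) = op l • comul A C c) (l : L)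
    (m : M) : coaction A C M (indAct A C L M l m) = op l • coaction A C M m := by
  refine (coact_contract _ (fun a c => (congrArg _ (rmulHom_smul l a c)).trans
    (Coring.counit_smul a _)) m).trans ?_
  exact lmap_congr _ _ (contract_counit_comp (rmulHom_smul l) (h l)) _

theorem coact_injective : Function.Injective (coaction A C M) := fun x y h => by
  rw [← RightComodule.contract_coact (A := A) (C := C) x, h, RightComodule.contract_coact]

theorem indAct_one (h : ∀ (l : L) (c : C), comul A C (op l • c) = op l • comul A C c) (m : M) :
    indAct A C L M 1 m = m :=
  coact_injective (A := A) (C := C) (by rw [coact_indAct h, op_one, one_smul])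

theorem indAct_mul (h : ∀ (l : L) (c : C), comul A C (op l • c) = op l • comul A C c) (l l' : L)
    (m : M) : indAct A C L M (l * l') m = indAct A C L M l' (indAct A C L M l m) :=
  coact_injective (A := A) (C := C) (by simp only [coact_indAct h, op_mul, mul_smul])

theorem indAct_add (h : ∀ (l : L) (c : C), comul A C (op l • c) = op l • comul A C c) (l l' : L)
    (m : M) : indAct A C L M (l + l') m = indAct A C L M l m + indAct A C L M l' m :=
  coact_injective (A := A) (C := C) (by simp only [coact_indAct h, op_add, add_smul, map_add])

theorem indAct_zero (h : ∀ (l : L) (c : C), comul A C (op l • c) = op l • comul A C c) (m : M) :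
    indAct A C L M 0 m = 0 :=
  coact_injective (A := A) (C := C) (by simp only [coact_indAct h, op_zero, zero_smul, map_zero])

variable (A C L D M) in
/-- The identity map `M → UObj A C L D M`. -/
def toU : M ≃+ UObj A C L D M :=
  AddEquiv.refl M

/-- The right `L`-module structure `m l = m^{[0]} ε(m^{[1]} l)`. -/
instance indModule : Module Lᵐᵒᵖ (UObj A C L D M) where
  smul l m := toU A C L D M (indAct A C L M (unop l) ((toU A C L D M).symm m))
  one_smul m := indAct_one (CoringExtension.comul_op_smul (D := D)) ((toU A C L D M).symm m)
  mul_smul s t m := indAct_mul (CoringExtension.comul_op_smul (D := D)) (unop t) (unop s)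
    ((toU A C L D M).symm m)
  smul_zero l := map_zero (indAct A C L M (unop l))
  smul_add l m n := map_add (indAct A C L M (unop l)) ((toU A C L D M).symm m)
    ((toU A C L D M).symm n)
  add_smul s t m := indAct_add (CoringExtension.comul_op_smul (D := D)) (unop s) (unop t)
    ((toU A C L D M).symm m)
  zero_smul m := indAct_zero (CoringExtension.comul_op_smul (D := D)) ((toU A C L D M).symm m)

variable (A C L D M) in
/-- The `C`-coaction, as a right `L`-linear map. -/
def coactU : UObj A C L D M →+ BTensor A M C :=
  (coaction A C M).comp (toU A C L D M).symm.toAddMonoidHom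

theorem coactU_injective : Function.Injective (coactU A C L D M) :=
  (coact_injective (A := A) (C := C) (M := M)).comp (toU A C L D M).symm.injective

theorem coactU_op_smul (l : L) (m : UObj A C L D M) :
    coactU A C L D M (op l • m) = op l • coactU A C L D M m :=
  coact_indAct (CoringExtension.comul_op_smul (D := D)) l ((toU A C L D M).symm m)

variable (A C M) in
/-- The map `ϱ ⊗_A C : M ⊗_A C → M ⊗_A C ⊗_A C`. -/
def coactTensor : BTensor A M C →+ BTensor A (BTensor A M C) C :=
  rmap C (coaction A C M) RightComodule.coact_op_smul

variable (A C M) in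
/-- The map `M ⊗_A Δ : M ⊗_A C → M ⊗_A C ⊗_A C`. -/
def tensorComul : BTensor A M C →+ BTensor A (BTensor A M C) C :=
  assoc.symm.toAddMonoidHom.comp (lmap M (comul A C) Coring.comul_smul)

theorem coactTensor_op_smul (l : L) (z : BTensor A M C) :
    coactTensor A C M (op l • z) = op l • coactTensor A C M z :=
  rmap_op_smul _ _ _ _

theorem tensorComul_op_smul
    (h : ∀ (l : L) (c : C), comul A C (op l • c) = op l • comul A C c) (l : L) (z : BTensor A M C) :
    tensorComul A C M (op l • z) = op l • tensorComul A C M z := by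
  refine (congrArg assoc.symm (lmap_op_smul _ _ h l z)).trans ?_
  exact assoc_symm_op_smul l _

variable (A C L D) in
/-- The right coring extension `D` of `C` is pure: for each right `C`-comodule `(M, ϱ)` the
equaliser `M → M ⊗_A C ⇉ M ⊗_A C ⊗_A C` of right `L`-modules is preserved by the functor
`- ⊗_L (D ⊗_L D)`. -/
class IsPureExtension : Prop where
  injective : ∀ (M : Type u) [AddCommGroup M] [Module Aᵐᵒᵖ M] [RightComodule A C M],
    Function.Injective (rmap (BTensor L D D) (coactU A C L D M) coactU_op_smul)
  exact : ∀ (M : Type u) [AddCommGroup M] [Module Aᵐᵒᵖ M] [RightComodule A C M]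
    (z : BTensor L (BTensor A M C) (BTensor L D D)),
    rmap (BTensor L D D) (coactTensor A C M) coactTensor_op_smul z
      = rmap (BTensor L D D) (tensorComul A C M)
        (tensorComul_op_smul (CoringExtension.comul_op_smul (D := D))) z →
    ∃ y, rmap (BTensor L D D) (coactU A C L D M) coactU_op_smul y = z

variable [IsPureExtension A C L D]

/-- The splitting `D ⊗_L D → D` of the coproduct of `D`. -/
abbrev splitD (L D : Type u) [Ring L] [AddCommGroup D] [Module L D] [Module Lᵐᵒᵖ D]
    [SMulCommClass L Lᵐᵒᵖ D] [Coring L D] : BTensor L D D →+ D :=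
  contract D (counit L D) Coring.counit_smul

theorem lmap_split {X : Type u} [AddCommGroup X] [Module Lᵐᵒᵖ X] (z : BTensor L X D) :
    lmap X (splitD L D) (contract_smul _ _) (lmap X (comul L D) Coring.comul_smul z) = z := by
  rw [lmap_comp']
  refine (lmap_congr _ (AddMonoidHom.id D) Coring.contract_comul z).trans (lmap_id z ?_)
  exact fun _ _ => rfl

variable (A C L D M) in
theorem coactU_tensor_injective :
    Function.Injective (rmap D (coactU A C L D M) coactU_op_smul) := fun x y h => by
  rw [← lmap_split x, ← lmap_split y]
  congr 1
  apply IsPureExtension.injective M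
  rw [← lmap_rmap, ← lmap_rmap, h]

theorem tensorCoact_tensorComul (z : BTensor A M C) :
    tensorCoact A C L D (BTensor A M C) (tensorComul A C M z)
      = rmap D (tensorComul A C M) (tensorComul_op_smul (CoringExtension.comul_op_smul (D := D)))
        (tensorCoact A C L D M z) := by
  induction z using BTensor.induction with
  | h m c =>
    have h1 : ∀ v : BTensor A C C, tensorCoact A C L D (BTensor A M C) (assoc.symm (tmul A m v))
        = rmap D (assoc.symm.toAddMonoidHom.comp (tmulHom (BTensor A C C) m))
          (fun l v => assoc_symm_op_smul l (tmul A m v))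
          (assoc.symm (lmap C (coaction L D C) (CoringExtension.coact_smul (A := A)) v)) := by
      intro v
      induction v using BTensor.induction with
      | h c c' =>
        rw [assoc_symm_tmul, tensorCoact_tmul, lmap_tmul]
        induction coaction L D C c' using BTensor.induction with
        | h c d => rfl
        | hadd x y hx hy => simp only [tmul_add, map_add, hx, hy]
      | hadd x y hx hy => simp only [tmul_add, map_add, hx, hy]
    rw [tensorCoact_tmul, rmap_comp']
    refine (h1 (comul A C c)).trans ?_
    rw [← CoringExtension.comul_colinear]
    exact rmap_comp' _ _ _ _ _
  | hadd x y hx hy => simp only [map_add, hx, hy]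

theorem exists_indCoact (m : UObj A C L D M) :
    ∃ y : BTensor L (UObj A C L D M) D, rmap D (coactU A C L D M) coactU_op_smul y
      = tensorCoact A C L D M (coactU A C L D M m) := by
  have key : rmap D (coactTensor A C M) coactTensor_op_smul
        (tensorCoact A C L D M (coactU A C L D M m))
      = rmap D (tensorComul A C M)
        (tensorComul_op_smul (CoringExtension.comul_op_smul (D := D)))
        (tensorCoact A C L D M (coactU A C L D M m)) := by
    rw [← tensorCoact_tensorComul]
    refine (tensorCoact_rmap (coaction A C M) RightComodule.coact_op_smul _).symm.trans ?_
    congr 1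
    exact (AddEquiv.symm_apply_eq _).2 (RightComodule.coassoc ((toU A C L D M).symm m)).symm |>.symm
  obtain ⟨y, hy⟩ := IsPureExtension.exact M (lmap _ (comul L D) Coring.comul_smul
    (tensorCoact A C L D M (coactU A C L D M m))) (by rw [← lmap_rmap, ← lmap_rmap, key])
  refine ⟨lmap _ (splitD L D) (contract_smul _ _) y, ?_⟩
  rw [← lmap_rmap, hy, lmap_split]

variable (A C L D M) in
/-- The right `D`-coaction of the right `C`-comodule `M`, `m ↦ m^{[0]} ε(m^{[1]}_{[0]}) ⊗ m^{[1]}_{[1]}`: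
it is determined by `(ϱ ⊗_L D) (τ m) = (M ⊗_A τ_C) (ϱ m)`, that is, by the identification of `M`
with the equaliser `M □_C C` inside `M ⊗_A C`, on which `D` coacts through `C`. -/
noncomputable def indCoact : UObj A C L D M →+ BTensor L (UObj A C L D M) D :=
  AddMonoidHom.mk' (fun m => Classical.choose (exists_indCoact m)) (fun x y => by
    apply coactU_tensor_injective
    refine (Classical.choose_spec (exists_indCoact (x + y))).trans ?_
    rw [map_add, map_add, map_add]
    exact (congrArg₂ _ (Classical.choose_spec (exists_indCoact x))
      (Classical.choose_spec (exists_indCoact y))).symm)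

theorem indCoact_spec (m : UObj A C L D M) :
    rmap D (coactU A C L D M) coactU_op_smul (indCoact A C L D M m)
      = tensorCoact A C L D M (coactU A C L D M m) :=
  Classical.choose_spec (exists_indCoact m)

theorem indCoact_op_smul (l : L) (m : UObj A C L D M) :
    indCoact A C L D M (op l • m) = op l • indCoact A C L D M m := by
  apply coactU_tensor_injective
  rw [indCoact_spec, coactU_op_smul, tensorCoact_op_smul, rmap_op_smul, indCoact_spec]

/-- The right `D`-comodule underlying a right `C`-comodule. -/
noncomputable instance indComodule : RightComodule L D (UObj A C L D M) where
  coact := indCoact A C L D M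
  coact_op_smul := indCoact_op_smul
  coassoc m := by
    apply IsPureExtension.injective M
    rw [← lmap_rmap, indCoact_spec, ← tensorCoact_coassoc, ← indCoact_spec, ← assoc_rmap_rmap,
      rmap_comp', rmap_comp']
    exact congrArg _ (rmap_congr _ _ indCoact_spec _)
  contract_coact m := by
    apply coactU_injective
    have h := congrArg (contract _ (counit L D) Coring.counit_smul) (indCoact_spec (D := D) m)
    rw [contract_rmap] at h
    refine h.trans ?_
    refine (contract_assoc_symm _ _ _).trans ?_
    rw [lmap_comp']
    refine (lmap_congr _ (AddMonoidHom.id C) RightComodule.contract_coact _).trans (lmap_id _ ?_)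
    exact fun _ _ => rfl

end Induced

/-! ### Regular and cofree comodules, endomorphisms, Galois comodules -/

section Comodules

open BTensor

variable {A C M : Type*} [Ring A] [AddCommGroup C] [Module A C] [Module Aᵐᵒᵖ C]
  [SMulCommClass A Aᵐᵒᵖ C] [Coring A C] [AddCommGroup M] [Module Aᵐᵒᵖ M]

/-- A coring is a right comodule over itself through its coproduct. -/
instance regularComodule : RightComodule A C C where
  coact := comul A C
  coact_op_smul := Coring.comul_op_smul
  coassoc := Coring.coassoc
  contract_coact := Coring.contract_comul

/-- The comodule `M ⊗_A C` with the coaction `M ⊗_A Δ`, for a right `A`-module `M`. -/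
instance cofreeComodule : RightComodule A C (BTensor A M C) where
  coact := assoc.symm.toAddMonoidHom.comp (lmap M (comul A C) Coring.comul_smul)
  coact_op_smul a z :=
    (congrArg assoc.symm (lmap_op_smul _ _ Coring.comul_op_smul a z)).trans
      (assoc_symm_op_smul a _)
  coassoc z := by
    induction z using BTensor.induction with
    | h m c =>
      have h1 : ∀ c : C, assoc.symm (tmul A m (comul A C c))
          = rmap C (tmulHom C m) (tmulHom_op_smul m) (comul A C c) := by
        intro c
        induction comul A C c using BTensor.induction with
        | h c d => rfl
        | hadd x y hx hy => simp only [tmul_add, map_add, hx, hy]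
      change assoc (rmap C _ _ (assoc.symm (tmul A m (comul A C c))))
        = lmap _ _ _ (assoc.symm (tmul A m (comul A C c)))
      rw [h1, lmap_rmap, ← Coring.coassoc, ← assoc_rmap_rmap, rmap_comp']
      refine congrArg _ ((rmap_comp' _ _ _ _ _).trans (rmap_congr _ _ (fun c => ?_) _))
      exact h1 c
    | hadd x y hx hy => simp only [map_add, hx, hy]
  contract_coact z := by
    refine (contract_assoc_symm _ _ _).trans ?_
    rw [lmap_comp']
    refine (lmap_congr _ (AddMonoidHom.id C) Coring.contract_comul _).trans (lmap_id _ ?_)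
    exact fun _ _ => rfl

instance cofreeBicomodule {S : Type*} [Ring S] [Module S M] [SMulCommClass S Aᵐᵒᵖ M] :
    IsBicomodule S A C (BTensor A M C) where
  coact_smul s z := (congrArg assoc.symm (lmap_smul _ _ s z)).trans (assoc_symm_smul s _)

variable [RightComodule A C M]

namespace IsColinear

variable {M' M'' : Type*} [AddCommGroup M'] [Module Aᵐᵒᵖ M'] [RightComodule A C M']
  [AddCommGroup M''] [Module Aᵐᵒᵖ M''] [RightComodule A C M'']

theorem id : IsColinear A C (AddMonoidHom.id M) :=
  ⟨fun _ _ => rfl, fun m => (rmap_id (coaction A C M m) fun _ _ => rfl).symm⟩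

theorem comp {g : M' →+ M''} {f : M →+ M'} (hg : IsColinear A C g) (hf : IsColinear A C f) :
    IsColinear A C (g.comp f) where
  op_smul a m := (congrArg g (hf.op_smul a m)).trans (hg.op_smul a (f m))
  coact m := (hg.coact (f m)).trans ((congrArg _ (hf.coact m)).trans (rmap_comp' _ _ _ _ _))

theorem add {f g : M →+ M'} (hf : IsColinear A C f) (hg : IsColinear A C g) :
    IsColinear A C (f + g) where
  op_smul a m := by simp [hf.op_smul, hg.op_smul]
  coact m := by
    rw [AddMonoidHom.add_apply, map_add, hf.coact, hg.coact]
    induction coaction A C M m using BTensor.induction with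
    | h m c => exact (add_tmul _ _ _).symm
    | hadd x y hx hy => simp only [map_add, ← hx, ← hy]; abel

theorem zero : IsColinear A C (0 : M →+ M') where
  op_smul a m := by simp
  coact m := by
    rw [AddMonoidHom.zero_apply, map_zero]
    induction coaction A C M m using BTensor.induction with
    | h m c => exact (zero_tmul _).symm
    | hadd x y hx hy => rw [map_add, ← hx, ← hy, add_zero]

theorem neg {f : M →+ M'} (hf : IsColinear A C f) : IsColinear A C (-f) where
  op_smul a m := by simp [hf.op_smul]
  coact m := by
    rw [AddMonoidHom.neg_apply, map_neg, hf.coact, neg_eq_iff_add_eq_zero]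
    induction coaction A C M m using BTensor.induction with
    | h m c =>
      refine (add_tmul _ _ _).symm.trans ?_
      exact (congrArg (tmul A · c) (add_neg_cancel (f m))).trans (zero_tmul c)
    | hadd x y hx hy => rw [map_add, map_add, add_add_add_comm, hx, hy, add_zero]

end IsColinear

variable (A C M) in
/-- The ring `End^C(M)` of endomorphisms of the right `C`-comodule `M`, as a subring of the ring of
right `A`-linear endomorphisms. -/
def endSubring : Subring (Module.End Aᵐᵒᵖ M) where
  carrier := {t | IsColinear A C t.toAddMonoidHom}
  mul_mem' hs ht := hs.comp ht
  one_mem' := IsColinear.id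
  add_mem' hs ht := hs.add ht
  zero_mem' := IsColinear.zero
  neg_mem' ht := ht.neg

variable (A C M) in
/-- The ring `T = End^C(M)`, with composition as multiplication. -/
def ComodEnd : Type _ :=
  endSubring A C M

instance : Ring (ComodEnd A C M) := inferInstanceAs (Ring (endSubring A C M))

instance : Module (ComodEnd A C M) M := inferInstanceAs (Module (endSubring A C M) M)

/-- The underlying right `A`-linear map of an endomorphism. -/
def ComodEnd.toLin : ComodEnd A C M →+* Module.End Aᵐᵒᵖ M := (endSubring A C M).subtype

theorem ComodEnd.smul_def (t : ComodEnd A C M) (m : M) : t • m = t.toLin m := rfl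

theorem ComodEnd.ext {s t : ComodEnd A C M} (h : ∀ m : M, s • m = t • m) : s = t :=
  Subtype.ext (LinearMap.ext h)

theorem ComodEnd.isColinear (t : ComodEnd A C M) : IsColinear A C t.toLin.toAddMonoidHom := t.2

instance : SMulCommClass (ComodEnd A C M) Aᵐᵒᵖ M where
  smul_comm t a m := map_smul t.toLin a m

/-- For a right `A`-module `N`, the ring `T = End^C(M)` acts on `Hom_A(M, N)` from the right by
composition. -/
instance homModule {N : Type*} [AddCommGroup N] [Module Aᵐᵒᵖ N] :
    Module (ComodEnd A C M)ᵐᵒᵖ (M →ₗ[Aᵐᵒᵖ] N) where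
  smul t f := f.comp (unop t).toLin
  one_smul _ := rfl
  mul_smul _ _ _ := rfl
  smul_zero _ := rfl
  smul_add _ _ _ := rfl
  add_smul s t f := LinearMap.ext fun m => map_add f ((unop s).toLin m) ((unop t).toLin m)
  zero_smul f := LinearMap.ext fun _ => map_zero f

variable (A C M) in
/-- The canonical map `Hom_A(M, N) ⊗_T M → N ⊗_A C`, `φ ⊗ x ↦ φ(x^{[0]}) ⊗ x^{[1]}`. -/
def can (N : Type*) [AddCommGroup N] [Module Aᵐᵒᵖ N] :
    BTensor (ComodEnd A C M) (M →ₗ[Aᵐᵒᵖ] N) M →+ BTensor A N C :=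
  lift (fun φ x => rmap C φ.toAddMonoidHom (fun a m => map_smul φ (op a) m) (coaction A C M x))
    (fun φ ψ x => by
      induction coaction A C M x using BTensor.induction with
      | h m c => exact add_tmul _ _ _
      | hadd x y hx hy => simp only [map_add, hx, hy]; abel)
    (fun φ x y => by rw [map_add, map_add])
    (fun φ t x => by
      refine Eq.trans ?_ (congrArg _ (t.isColinear.coact x)).symm
      exact (rmap_comp' t.toLin.toAddMonoidHom φ.toAddMonoidHom _ _ _).symm)

end Comodules

section Galois

variable (A C M : Type u) [Ring A] [AddCommGroup C] [Module A C] [Module Aᵐᵒᵖ C]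
  [SMulCommClass A Aᵐᵒᵖ C] [Coring A C] [AddCommGroup M] [Module Aᵐᵒᵖ M] [RightComodule A C M]

/-- The right `C`-comodule `M` is a Galois comodule: the canonical natural transformation
`Hom_A(M, -) ⊗_T M → - ⊗_A C` is an isomorphism. -/
def IsGaloisComodule : Prop :=
  ∀ (N : Type u) [AddCommGroup N] [Module Aᵐᵒᵖ N], Function.Bijective (can A C M N)

end Galois

/-! ### Direct summands of bicomodules -/

section Summand

variable (S A C M N : Type u) [Ring S] [Ring A] [AddCommGroup C] [Module A C] [Module Aᵐᵒᵖ C]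
  [SMulCommClass A Aᵐᵒᵖ C] [Coring A C]
  [AddCommGroup M] [Module Aᵐᵒᵖ M] [RightComodule A C M] [Module S M] [SMulCommClass S Aᵐᵒᵖ M]
  [IsBicomodule S A C M]
  [AddCommGroup N] [Module Aᵐᵒᵖ N] [RightComodule A C N] [Module S N] [SMulCommClass S Aᵐᵒᵖ N]
  [IsBicomodule S A C N]

/-- The `S`-`C` bicomodule `M` is a direct summand of the `S`-`C` bicomodule `N`: there are an
`S`-`C` bicomodule `X` and bicomodule maps `M → N ← X` that induce a bijection `M ⊕ X → N`. -/
def IsDirectSummand : Prop :=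
  ∃ (X : Type u) (_ : AddCommGroup X) (_ : Module Aᵐᵒᵖ X) (_ : RightComodule A C X)
    (_ : Module S X) (_ : SMulCommClass S Aᵐᵒᵖ X) (_ : IsBicomodule S A C X)
    (i : M →ₗ[S] N) (j : X →ₗ[S] N),
    IsColinear A C i.toAddMonoidHom ∧ IsColinear A C j.toAddMonoidHom ∧
      Function.Bijective (fun p : M × X => i p.1 + j p.2)

end Summand

/-! ### Morita contexts -/

section MoritaContext

/-- A Morita context `(R, S, P, Q, ◆, ◇)`, with connecting maps `◆ : Q ⊗_R P → S` and
`◇ : P ⊗_S Q → R`. -/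
structure MoritaContext (R S P Q : Type*) [Ring R] [Ring S] [AddCommGroup P] [Module R P]
    [Module Sᵐᵒᵖ P] [SMulCommClass R Sᵐᵒᵖ P] [AddCommGroup Q] [Module S Q] [Module Rᵐᵒᵖ Q]
    [SMulCommClass S Rᵐᵒᵖ Q] where
  black : BTensor R Q P →+ S
  white : BTensor S P Q →+ R
  black_smul : ∀ (s : S) z, black (s • z) = s * black z
  black_op_smul : ∀ (s : S) z, black (op s • z) = black z * s
  white_smul : ∀ (r : R) z, white (r • z) = r * white z
  white_op_smul : ∀ (r : R) z, white (op r • z) = white z * r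
  white_smul_eq : ∀ (p : P) (q : Q) (p' : P),
    white (BTensor.tmul S p q) • p' = op (black (BTensor.tmul R q p')) • p
  black_smul_eq : ∀ (q : Q) (p : P) (q' : Q),
    black (BTensor.tmul R q p) • q' = op (white (BTensor.tmul S p q')) • q

/-- A Morita context is strict if both connecting maps are surjective. -/
def MoritaContext.IsStrict {R S P Q : Type*} [Ring R] [Ring S] [AddCommGroup P] [Module R P]
    [Module Sᵐᵒᵖ P] [SMulCommClass R Sᵐᵒᵖ P] [AddCommGroup Q] [Module S Q] [Module Rᵐᵒᵖ Q]
    [SMulCommClass S Rᵐᵒᵖ Q] (c : MoritaContext R S P Q) : Prop :=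
  Function.Surjective c.black ∧ Function.Surjective c.white

end MoritaContext

section Extension

set_option linter.unusedSectionVars false

open BTensor

variable {A C L D : Type u} [Ring A] [AddCommGroup C] [Module A C] [Module Aᵐᵒᵖ C]
  [SMulCommClass A Aᵐᵒᵖ C] [Coring A C] [Ring L] [AddCommGroup D] [Module L D] [Module Lᵐᵒᵖ D]
  [SMulCommClass L Lᵐᵒᵖ D] [Coring L D] [Module Lᵐᵒᵖ C] [SMulCommClass A Lᵐᵒᵖ C]
  [CoringExtension A C L D]
  {M : Type u} [AddCommGroup M] [Module Aᵐᵒᵖ M] [RightComodule A C M]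

/-! #### The bicomodule structures over `T = End^C(M)` -/

variable (A C L D) in
/-- An additive map between `C`-comodules, as a map between the induced `D`-comodules. -/
def mapU {M' : Type u} [AddCommGroup M'] (f : M →+ M') : UObj A C L D M →+ UObj A C L D M' :=
  (toU A C L D M').toAddMonoidHom.comp (f.comp (toU A C L D M).symm.toAddMonoidHom)

theorem mapU_isColinear [IsPureExtension A C L D] {M' : Type u} [AddCommGroup M'] [Module Aᵐᵒᵖ M']
    [RightComodule A C M'] (f : M →+ M') (F : BTensor A M C →+ BTensor A M' C)
    (hF : ∀ m, coaction A C M' (f m) = F (coaction A C M m))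
    (hl : ∀ (l : L) z, F (op l • z) = op l • F z)
    (ht : ∀ z, tensorCoact A C L D M' (F z) = rmap D F hl (tensorCoact A C L D M z)) :
    IsColinear L D (mapU A C L D f) := by
  have hF' : ∀ m, coactU A C L D M' (mapU A C L D f m) = F (coactU A C L D M m) :=
    fun m => hF ((toU A C L D M).symm m)
  have hs : ∀ (l : L) m, mapU A C L D f (op l • m) = op l • mapU A C L D f m := fun l m => by
    apply coactU_injective
    rw [hF', coactU_op_smul, coactU_op_smul, hF', hl]
  refine ⟨hs, fun m => ?_⟩
  apply coactU_tensor_injective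
  refine (indCoact_spec _).trans ?_
  rw [hF', ht, ← indCoact_spec, rmap_comp', rmap_comp']
  exact rmap_congr _ _ (fun m => (hF' m).symm) _

instance modU : Module (ComodEnd A C M) (UObj A C L D M) :=
  inferInstanceAs (Module (ComodEnd A C M) M)

theorem toU_symm_smul (t : ComodEnd A C M) (m : UObj A C L D M) :
    (toU A C L D M).symm (t • m) = t • (toU A C L D M).symm m :=
  rfl

theorem coactU_smul (t : ComodEnd A C M) (m : UObj A C L D M) :
    coactU A C L D M (t • m) = t • coactU A C L D M m :=
  t.isColinear.coact ((toU A C L D M).symm m)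

instance : SMulCommClass (ComodEnd A C M) Lᵐᵒᵖ (UObj A C L D M) where
  smul_comm t l m := by
    apply coactU_injective
    induction l using MulOpposite.rec' with
    | h l => rw [coactU_smul, coactU_op_smul, coactU_op_smul, coactU_smul, smul_comm]

/-- `M` is a `T`-`D` bicomodule. -/
instance [IsPureExtension A C L D] : IsBicomodule (ComodEnd A C M) L D (UObj A C L D M) where
  coact_smul t m :=
    (mapU_isColinear t.toLin.toAddMonoidHom
      (rmap C t.toLin.toAddMonoidHom t.isColinear.op_smul) t.isColinear.coact
      (rmap_op_smul _ _) (tensorCoact_rmap _ _)).coact m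

variable [Module L M] [SMulCommClass L Aᵐᵒᵖ M] [IsBicomodule L A C M]

instance : Module L (UObj A C L D M) := inferInstanceAs (Module L M)

variable (A C L M) in
/-- The ring map `L → T`, `l ↦ (x ↦ l x)`. -/
def lToEnd : L →+* ComodEnd A C M where
  toFun l := ⟨{ toFun := fun x => l • x
                map_add' := smul_add l
                map_smul' := fun a x => smul_comm l a x },
              ⟨fun a x => smul_comm l (op a) x, fun m => IsBicomodule.coact_smul l m⟩⟩
  map_one' := ComodEnd.ext fun m => one_smul L m
  map_mul' l l' := ComodEnd.ext fun m => mul_smul l l' m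
  map_zero' := ComodEnd.ext fun m => zero_smul L m
  map_add' l l' := ComodEnd.ext fun m => add_smul l l' m

theorem lToEnd_smul (l : L) (m : M) : lToEnd A C L M l • m = l • m := rfl

theorem lToEnd_smulU (l : L) (m : UObj A C L D M) : lToEnd A C L M l • m = l • m := rfl

/-- The left `L`-module structure of the `L`-ring `T`. -/
instance endLeftModule : Module L (ComodEnd A C M) := Module.compHom _ (lToEnd A C L M)

/-- The right `L`-module structure of the `L`-ring `T`. -/
instance endRightModule : Module Lᵐᵒᵖ (ComodEnd A C M) :=
  Module.compHom _ (lToEnd A C L M).op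

theorem end_smul_def (l : L) (t : ComodEnd A C M) : l • t = lToEnd A C L M l * t := rfl

theorem end_op_smul_def (l : L) (t : ComodEnd A C M) : op l • t = t * lToEnd A C L M l := rfl

instance : SMulCommClass (ComodEnd A C M) Lᵐᵒᵖ (ComodEnd A C M) where
  smul_comm s l t := (mul_assoc s t (lToEnd A C L M (unop l))).symm

/-! #### The constituents of the Morita context -/

variable (A C L D M) in
/-- The group `_L Hom_L(D, T)`. -/
def homLL : AddSubgroup (D →+ ComodEnd A C M) where
  carrier := {v | (∀ (l : L) d, v (l • d) = l • v d) ∧ ∀ (l : L) d, v (op l • d) = op l • v d}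
  add_mem' {v w} hv hw := ⟨fun l d => by simp [hv.1, hw.1], fun l d => by simp [hv.2, hw.2]⟩
  zero_mem' := ⟨fun l d => by simp, fun l d => by simp⟩
  neg_mem' {v} hv := ⟨fun l d => by simp [hv.1], fun l d => by simp [hv.2]⟩

variable (A C L D M) in
/-- The convolution ring `_L Hom_L(D, T)`. -/
def ConvRing : Type u := homLL A C L D M

instance : AddCommGroup (ConvRing A C L D M) := inferInstanceAs (AddCommGroup (homLL A C L D M))

variable (A C L D) in
/-- `u : C → C` is left `C`-colinear and right `D`-colinear. -/
structure IsBicolinear (u : C →+ C) : Prop where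
  smul : ∀ (a : A) c, u (a • c) = a • u c
  comul : ∀ c, comul A C (u c) = lmap C u smul (comul A C c)
  colinear : IsColinear L D u

namespace IsBicolinear

variable {s t : C →+ C}

theorem id : IsBicolinear A C L D (AddMonoidHom.id C) :=
  ⟨fun _ _ => rfl, fun c => (lmap_id (CoringMorita.comul A C c) fun _ _ => rfl).symm,
    IsColinear.id⟩

theorem comp (hs : IsBicolinear A C L D s) (ht : IsBicolinear A C L D t) :
    IsBicolinear A C L D (s.comp t) :=
  ⟨fun a c => (congrArg s (ht.smul a c)).trans (hs.smul a (t c)),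
    fun c => (hs.comul (t c)).trans ((congrArg _ (ht.comul c)).trans (lmap_comp' _ _ _ _ _)),
    hs.colinear.comp ht.colinear⟩

theorem add (hs : IsBicolinear A C L D s) (ht : IsBicolinear A C L D t) :
    IsBicolinear A C L D (s + t) where
  smul a c := by rw [AddMonoidHom.add_apply, AddMonoidHom.add_apply, hs.smul, ht.smul, smul_add]
  comul c := by
    rw [AddMonoidHom.add_apply, map_add, hs.comul, ht.comul]
    induction CoringMorita.comul A C c using BTensor.induction with
    | h m c => exact (tmul_add _ _ _).symm
    | hadd x y hx hy => simp only [map_add, ← hx, ← hy]; abel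
  colinear := hs.colinear.add ht.colinear

theorem zero : IsBicolinear A C L D (0 : C →+ C) where
  smul a c := (smul_zero a).symm
  comul c := by
    rw [AddMonoidHom.zero_apply, map_zero]
    induction CoringMorita.comul A C c using BTensor.induction with
    | h m c => exact (tmul_zero _).symm
    | hadd x y hx hy => rw [map_add, ← hx, ← hy, add_zero]
  colinear := IsColinear.zero

theorem neg (ht : IsBicolinear A C L D t) : IsBicolinear A C L D (-t) where
  smul a c := by rw [AddMonoidHom.neg_apply, AddMonoidHom.neg_apply, ht.smul, smul_neg]
  comul c := by
    rw [AddMonoidHom.neg_apply, map_neg, ht.comul, neg_eq_iff_add_eq_zero]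
    induction CoringMorita.comul A C c using BTensor.induction with
    | h m c =>
      refine (tmul_add _ _ _).symm.trans ?_
      exact (congrArg (tmul A m) (add_neg_cancel (t c))).trans (tmul_zero m)
    | hadd x y hx hy => rw [map_add, map_add, add_add_add_comm, hx, hy, add_zero]
  colinear := ht.colinear.neg

end IsBicolinear

variable (A C L D) in
/-- The ring `^C End^D(C)` of `C`-`D` bicomodule endomorphisms of `C`. -/
def bicomodEnd : Subring (AddMonoid.End C) where
  carrier := {u | IsBicolinear A C L D u}
  mul_mem' hs ht := hs.comp ht
  one_mem' := IsBicolinear.id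
  add_mem' hs ht := hs.add ht
  zero_mem' := IsBicolinear.zero
  neg_mem' ht := ht.neg

variable (A C L D) in
/-- The ring `^C End^D(C)`, with composition as multiplication. -/
def BicomodEnd : Type u := bicomodEnd A C L D

instance : Ring (BicomodEnd A C L D) := inferInstanceAs (Ring (bicomodEnd A C L D))

variable (A C L D M) in
/-- The group `_L Hom^D(D, M)`. -/
def homLD [IsPureExtension A C L D] : AddSubgroup (D →+ UObj A C L D M) where
  carrier := {p | (∀ (l : L) d, p (l • d) = l • p d) ∧ IsColinear L D p}
  add_mem' {v w} hv hw := ⟨fun l d => by simp [hv.1, hw.1], hv.2.add hw.2⟩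
  zero_mem' := ⟨fun l d => by simp, IsColinear.zero⟩
  neg_mem' {v} hv := ⟨fun l d => by simp [hv.1], hv.2.neg⟩

variable (A C L D M) in
/-- The bimodule `_L Hom^D(D, M)`. -/
def HomLD [IsPureExtension A C L D] : Type u := homLD A C L D M

instance [IsPureExtension A C L D] : AddCommGroup (HomLD A C L D M) :=
  inferInstanceAs (AddCommGroup (homLD A C L D M))

/-- The map `c ↦ q(c)(x)`. -/
def evalAt (q : C →+ (M →ₗ[Aᵐᵒᵖ] A)) (x : M) : C →+ A :=
  (LinearMap.evalAddMonoidHom x).comp q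

theorem evalAt_smul {q : C →+ (M →ₗ[Aᵐᵒᵖ] A)} (hq : ∀ (a : A) c, q (a • c) = a • q c) (x : M)
    (a : A) (c : C) : evalAt q x (a • c) = a * evalAt q x c :=
  DFunLike.congr_fun (hq a c) x

theorem dual_op_smul (ξ : M →ₗ[Aᵐᵒᵖ] A) (a : A) (x : M) :
    ξ.toAddMonoidHom (op a • x) = ξ.toAddMonoidHom x * a :=
  map_smul ξ (op a) x

variable (L) in
/-- `q : C → M^*` is `A`-`L` bilinear and `c^{(1)} q(c^{(2)})(x) = q(c)(x^{[0]}) x^{[1]}`. -/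
structure IsQ (q : C →+ (M →ₗ[Aᵐᵒᵖ] A)) : Prop where
  smul : ∀ (a : A) c, q (a • c) = a • q c
  op_smul : ∀ (l : L) c x, q (op l • c) x = q c (l • x)
  comul : ∀ c x, contract C (evalAt q x) (evalAt_smul smul x) (comul A C c)
    = lcontract C (q c).toAddMonoidHom (dual_op_smul (q c)) (coaction A C M x)

variable (A C L M) in
/-- The group of the maps `q : C → M^*` as in `IsQ`. -/
def homQ : AddSubgroup (C →+ (M →ₗ[Aᵐᵒᵖ] A)) where
  carrier := {q | IsQ L q}
  add_mem' {q r} hq hr :=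
    ⟨fun a c => by
        rw [AddMonoidHom.add_apply, AddMonoidHom.add_apply, hq.smul, hr.smul, smul_add],
      fun l c x => by
        rw [AddMonoidHom.add_apply, AddMonoidHom.add_apply, LinearMap.add_apply,
          LinearMap.add_apply, hq.op_smul, hr.op_smul],
      fun c x => by
        have h1 : ∀ z : BTensor A M C, lcontract C ((q + r) c).toAddMonoidHom
            (dual_op_smul _) z = lcontract C (q c).toAddMonoidHom (dual_op_smul _) z
              + lcontract C (r c).toAddMonoidHom (dual_op_smul _) z := by
          intro z
          induction z using BTensor.induction with
          | h m c => exact add_smul _ _ _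
          | hadd x y hx hy => simp only [map_add, hx, hy]; abel
        rw [h1, ← hq.comul, ← hr.comul]
        induction comul A C c using BTensor.induction with
        | h m c => exact add_smul (op (q c x)) (op (r c x)) m
        | hadd x y hx hy => simp only [map_add, hx, hy]; abel⟩
  zero_mem' :=
    ⟨fun a c => (smul_zero a).symm, fun _ _ _ => rfl,
      fun c x => by
        have h1 : ∀ z : BTensor A M C, lcontract C ((0 : C →+ (M →ₗ[Aᵐᵒᵖ] A)) c).toAddMonoidHom
            (dual_op_smul _) z = 0 := by
          intro z
          induction z using BTensor.induction with
          | h m c => exact zero_smul _ _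
          | hadd x y hx hy => rw [map_add, hx, hy, add_zero]
        rw [h1]
        induction comul A C c using BTensor.induction with
        | h m c => exact zero_smul _ m
        | hadd x y hx hy => rw [map_add, hx, hy, add_zero]⟩
  neg_mem' {q} hq :=
    ⟨fun a c => by rw [AddMonoidHom.neg_apply, AddMonoidHom.neg_apply, hq.smul, smul_neg],
      fun l c x => by
        rw [AddMonoidHom.neg_apply, AddMonoidHom.neg_apply, LinearMap.neg_apply,
          LinearMap.neg_apply, hq.op_smul],
      fun c x => by
        have h1 : ∀ z : BTensor A M C, lcontract C ((-q) c).toAddMonoidHom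
            (dual_op_smul _) z = -lcontract C (q c).toAddMonoidHom (dual_op_smul _) z := by
          intro z
          induction z using BTensor.induction with
          | h m c => exact neg_smul _ _
          | hadd x y hx hy => simp only [map_add, hx, hy]; abel
        rw [h1, ← hq.comul]
        induction comul A C c using BTensor.induction with
        | h m c => exact neg_smul (op (q c x)) m
        | hadd x y hx hy => simp only [map_add, hx, hy]; abel⟩

variable (A C L M) in
/-- The bimodule of the maps `q : C → M^*` as in `IsQ`. -/
def QMod : Type u := homQ A C L M

instance : AddCommGroup (QMod A C L M) := inferInstanceAs (AddCommGroup (homQ A C L M))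

end Extension

section Context

set_option linter.unusedSectionVars false

open BTensor

variable {A C L D : Type u} [Ring A] [AddCommGroup C] [Module A C] [Module Aᵐᵒᵖ C]
  [SMulCommClass A Aᵐᵒᵖ C] [Coring A C] [Ring L] [AddCommGroup D] [Module L D] [Module Lᵐᵒᵖ D]
  [SMulCommClass L Lᵐᵒᵖ D] [Coring L D] [Module Lᵐᵒᵖ C] [SMulCommClass A Lᵐᵒᵖ C]
  [CoringExtension A C L D]
  {M : Type u} [AddCommGroup M] [Module Aᵐᵒᵖ M] [RightComodule A C M]
  [Module L M] [SMulCommClass L Aᵐᵒᵖ M] [IsBicomodule L A C M]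

/-! #### The convolution ring -/

/-- The underlying map `D → T`. -/
def ConvRing.hom (v : ConvRing A C L D M) : D →+ ComodEnd A C M := v.1

theorem ConvRing.ext {v w : ConvRing A C L D M} (h : ∀ d, v.hom d = w.hom d) : v = w :=
  Subtype.ext (AddMonoidHom.ext h)

theorem ConvRing.hom_smul (v : ConvRing A C L D M) (l : L) (d : D) :
    v.hom (l • d) = lToEnd A C L M l * v.hom d := v.2.1 l d

theorem ConvRing.hom_op_smul (v : ConvRing A C L D M) (l : L) (d : D) :
    v.hom (op l • d) = v.hom d * lToEnd A C L M l := v.2.2 l d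

/-- `d ⊗ d' ↦ v(d) w(d')`. -/
def convMap (v w : ConvRing A C L D M) : BTensor L D D →+ ComodEnd A C M :=
  lift (fun d d' => v.hom d * w.hom d') (fun d e d' => by rw [map_add, add_mul])
    (fun d d' e => by rw [map_add, mul_add])
    (fun d l d' => by rw [v.hom_op_smul, w.hom_smul, mul_assoc])

theorem convMap_smul (v w : ConvRing A C L D M) (l : L) (z : BTensor L D D) :
    convMap v w (l • z) = lToEnd A C L M l * convMap v w z := by
  induction z using BTensor.induction with
  | h d e => exact (congrArg (· * w.hom e) (v.hom_smul l d)).trans (mul_assoc _ _ _)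
  | hadd x y hx hy => rw [smul_add, map_add, map_add, hx, hy, mul_add]

theorem convMap_op_smul (v w : ConvRing A C L D M) (l : L) (z : BTensor L D D) :
    convMap v w (op l • z) = convMap v w z * lToEnd A C L M l := by
  induction z using BTensor.induction with
  | h d e => exact (congrArg (v.hom d * ·) (w.hom_op_smul l e)).trans (mul_assoc _ _ _).symm
  | hadd x y hx hy => rw [smul_add, map_add, map_add, hx, hy, add_mul]

/-- The convolution product `(v w)(d) = v(d_{(1)}) w(d_{(2)})`. -/
instance : Mul (ConvRing A C L D M) where
  mul v w := ⟨(convMap v w).comp (comul L D),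
    fun l d => (congrArg _ (Coring.comul_smul l d)).trans (convMap_smul v w l _),
    fun l d => (congrArg _ (Coring.comul_op_smul l d)).trans (convMap_op_smul v w l _)⟩

/-- The unit `d ↦ ε(d) 1_T`. -/
instance : One (ConvRing A C L D M) where
  one := ⟨(lToEnd A C L M).toAddMonoidHom.comp (counit L D),
    fun l d => (congrArg _ (Coring.counit_smul l d)).trans (map_mul (lToEnd A C L M) _ _),
    fun l d => (congrArg _ (Coring.counit_op_smul l d)).trans (map_mul (lToEnd A C L M) _ _)⟩

theorem ConvRing.mul_hom (v w : ConvRing A C L D M) (d : D) :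
    (v * w).hom d = convMap v w (comul L D d) := rfl

theorem ConvRing.one_hom (d : D) :
    (1 : ConvRing A C L D M).hom d = lToEnd A C L M (counit L D d) := rfl

theorem ConvRing.add_hom (v w : ConvRing A C L D M) (d : D) :
    (v + w).hom d = v.hom d + w.hom d := rfl

theorem ConvRing.zero_hom (d : D) : (0 : ConvRing A C L D M).hom d = 0 := rfl

theorem rmap_comul (d : D) :
    rmap D (comul L D) Coring.comul_op_smul (comul L D d)
      = assoc.symm (lmap D (comul L D) Coring.comul_smul (comul L D d)) := by
  rw [← Coring.coassoc, AddEquiv.symm_apply_apply]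

theorem ConvRing.mul_assoc' (v w x : ConvRing A C L D M) : v * w * x = v * (w * x) := by
  refine ConvRing.ext fun d => ?_
  have h1 : ∀ z : BTensor L D D, convMap (v * w) x z
      = lift (A := L) (fun (z : BTensor L D D) (d : D) => convMap v w z * x.hom d)
        (fun z z' d => by rw [map_add, add_mul]) (fun z d d' => by rw [map_add, mul_add])
        (fun z l d => by rw [convMap_op_smul, x.hom_smul, mul_assoc])
        (rmap D (comul L D) Coring.comul_op_smul z) := by
    intro z
    induction z using BTensor.induction with
    | h d e => rfl
    | hadd x y hx hy => simp only [map_add, hx, hy]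
  have h2 : ∀ z : BTensor L D D, convMap v (w * x) z
      = lift (A := L) (fun (d : D) (z : BTensor L D D) => v.hom d * convMap w x z)
        (fun z z' d => by rw [map_add, add_mul]) (fun z d d' => by rw [map_add, mul_add])
        (fun z l d => by rw [convMap_smul, v.hom_op_smul, mul_assoc])
        (lmap D (comul L D) Coring.comul_smul z) := by
    intro z
    induction z using BTensor.induction with
    | h d e => rfl
    | hadd x y hx hy => simp only [map_add, hx, hy]
  rw [mul_hom, mul_hom, h1, h2, rmap_comul]
  induction lmap D (comul L D) Coring.comul_smul (comul L D d) using BTensor.induction with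
  | h d z =>
    induction z using BTensor.induction with
    | h e f => exact mul_assoc _ _ _
    | hadd x y hx hy => simp only [tmul_add, map_add, hx, hy]
  | hadd x y hx hy => simp only [map_add, hx, hy]

theorem ConvRing.one_mul' (v : ConvRing A C L D M) : 1 * v = v := by
  refine ConvRing.ext fun d => ?_
  conv_rhs => rw [← Coring.lcontract_comul (A := L) d]
  rw [mul_hom]
  induction comul L D d using BTensor.induction with
  | h d e => exact (v.hom_smul _ _).symm
  | hadd x y hx hy => simp only [map_add, hx, hy]

theorem ConvRing.mul_one' (v : ConvRing A C L D M) : v * 1 = v := by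
  refine ConvRing.ext fun d => ?_
  conv_rhs => rw [← Coring.contract_comul (A := L) d]
  rw [mul_hom]
  induction comul L D d using BTensor.induction with
  | h d e => exact (v.hom_op_smul _ _).symm
  | hadd x y hx hy => simp only [map_add, hx, hy]

theorem ConvRing.mul_add' (v w x : ConvRing A C L D M) : v * (w + x) = v * w + v * x := by
  refine ConvRing.ext fun d => ?_
  rw [add_hom, mul_hom, mul_hom, mul_hom]
  induction comul L D d using BTensor.induction with
  | h d e => exact mul_add _ _ _
  | hadd x y hx hy => simp only [map_add, hx, hy]; abel

theorem ConvRing.add_mul' (v w x : ConvRing A C L D M) : (v + w) * x = v * x + w * x := by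
  refine ConvRing.ext fun d => ?_
  rw [add_hom, mul_hom, mul_hom, mul_hom]
  induction comul L D d using BTensor.induction with
  | h d e => exact add_mul _ _ _
  | hadd x y hx hy => simp only [map_add, hx, hy]; abel

/-- The convolution ring `_L Hom_L(D, T)`. -/
instance : Ring (ConvRing A C L D M) :=
  { (inferInstance : AddCommGroup (ConvRing A C L D M)) with
    mul := (· * ·)
    one := 1
    mul_assoc := ConvRing.mul_assoc'
    one_mul := ConvRing.one_mul'
    mul_one := ConvRing.mul_one'
    left_distrib := ConvRing.mul_add'
    right_distrib := ConvRing.add_mul'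
    zero_mul := fun v => by
      have h := ConvRing.add_mul' 0 0 v
      rw [add_zero] at h
      exact left_eq_add.mp h
    mul_zero := fun v => by
      have h := ConvRing.mul_add' v 0 0
      rw [add_zero] at h
      exact left_eq_add.mp h
    zsmul := fun n v => n • v
    nsmul := fun n v => n • v }

/-! #### Endomorphisms of `C` -/

/-- The underlying map `C → C`. -/
def BicomodEnd.hom (u : BicomodEnd A C L D) : C →+ C := u.1

theorem BicomodEnd.ext {u u' : BicomodEnd A C L D} (h : ∀ c, u.hom c = u'.hom c) : u = u' :=
  Subtype.ext (AddMonoidHom.ext h)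

theorem BicomodEnd.isBicolinear (u : BicomodEnd A C L D) : IsBicolinear A C L D u.hom := u.2

theorem BicomodEnd.counit_smul (u : BicomodEnd A C L D) (a : A) (c : C) :
    ((counit A C).comp u.hom) (a • c) = a * ((counit A C).comp u.hom) c :=
  (congrArg _ (u.isBicolinear.smul a c)).trans (Coring.counit_smul a _)

/-! #### The left module `_L Hom^D(D, M)` of the convolution ring -/

variable [IsPureExtension A C L D]

/-- The underlying map `D → M`. -/
def HomLD.hom (p : HomLD A C L D M) : D →+ UObj A C L D M := p.1

theorem HomLD.ext {p p' : HomLD A C L D M} (h : ∀ d, p.hom d = p'.hom d) : p = p' :=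
  Subtype.ext (AddMonoidHom.ext h)

theorem HomLD.hom_smul (p : HomLD A C L D M) (l : L) (d : D) :
    p.hom (l • d) = l • p.hom d := p.2.1 l d

theorem HomLD.isColinear (p : HomLD A C L D M) : IsColinear L D p.hom := p.2.2

theorem HomLD.add_hom (p p' : HomLD A C L D M) (d : D) :
    (p + p').hom d = p.hom d + p'.hom d := rfl

/-- `d ⊗ d' ↦ v(d)(p(d'))`. -/
def convAct (v : ConvRing A C L D M) (p : HomLD A C L D M) :
    BTensor L D D →+ UObj A C L D M :=
  lift (fun d d' => v.hom d • p.hom d') (fun d e d' => by rw [map_add, add_smul])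
    (fun d d' e => by rw [map_add, smul_add])
    (fun d l d' => by rw [v.hom_op_smul, p.hom_smul, mul_smul, lToEnd_smulU])

theorem convAct_smul (v : ConvRing A C L D M) (p : HomLD A C L D M) (l : L) (z : BTensor L D D) :
    convAct v p (l • z) = l • convAct v p z := by
  induction z using BTensor.induction with
  | h d e =>
    refine (congrArg (· • p.hom e) (v.hom_smul l d)).trans ?_
    exact mul_smul _ _ _
  | hadd x y hx hy => rw [smul_add, map_add, map_add, hx, hy, smul_add]

theorem convAct_op_smul (v : ConvRing A C L D M) (p : HomLD A C L D M) (l : L)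
    (z : BTensor L D D) : convAct v p (op l • z) = op l • convAct v p z := by
  induction z using BTensor.induction with
  | h d e =>
    refine (congrArg (v.hom d • ·) (p.isColinear.op_smul l e)).trans ?_
    exact smul_comm _ _ _
  | hadd x y hx hy => rw [smul_add, map_add, map_add, hx, hy, smul_add]

theorem coact_convAct (v : ConvRing A C L D M) (p : HomLD A C L D M) (z : BTensor L D D) :
    coaction L D (UObj A C L D M) (convAct v p z)
      = rmap D (convAct v p) (convAct_op_smul v p)
        (assoc.symm (lmap D (comul L D) Coring.comul_smul z)) := by
  induction z using BTensor.induction with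
  | h d e =>
    refine (IsBicomodule.coact_smul (v.hom d) (p.hom e)).trans ?_
    rw [p.isColinear.coact, lmap_tmul]
    change v.hom d • rmap D p.hom p.isColinear.op_smul (comul L D e) = _
    induction comul L D e using BTensor.induction with
    | h d e => rfl
    | hadd x y hx hy => simp only [tmul_add, map_add, smul_add, hx, hy]
  | hadd x y hx hy => simp only [map_add, hx, hy]

/-- `(v p)(d) = v(d_{(1)})(p(d_{(2)}))`. -/
instance : SMul (ConvRing A C L D M) (HomLD A C L D M) where
  smul v p := ⟨(convAct v p).comp (comul L D),
    fun l d => (congrArg _ (Coring.comul_smul l d)).trans (convAct_smul v p l _),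
    ⟨fun l d => (congrArg _ (Coring.comul_op_smul l d)).trans (convAct_op_smul v p l _),
      fun d => (coact_convAct v p (comul L D d)).trans
        ((congrArg _ (rmap_comul d).symm).trans (rmap_comp' _ _ _ _ _))⟩⟩

theorem HomLD.smul_hom (v : ConvRing A C L D M) (p : HomLD A C L D M) (d : D) :
    (v • p).hom d = convAct v p (comul L D d) := rfl

instance homLDModule : Module (ConvRing A C L D M) (HomLD A C L D M) where
  one_smul p := by
    refine HomLD.ext fun d => ?_
    conv_rhs => rw [← Coring.lcontract_comul (A := L) d]
    rw [HomLD.smul_hom]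
    induction comul L D d using BTensor.induction with
    | h d e => exact (p.hom_smul _ _).symm
    | hadd x y hx hy => simp only [map_add, hx, hy]
  mul_smul v w p := by
    refine HomLD.ext fun d => ?_
    have h1 : ∀ z : BTensor L D D, convAct (v * w) p z
        = lift (A := L) (fun (z : BTensor L D D) (d : D) => convMap v w z • p.hom d)
          (fun z z' d => by rw [map_add, add_smul]) (fun z d d' => by rw [map_add, smul_add])
          (fun z l d => by rw [convMap_op_smul, p.hom_smul, mul_smul, lToEnd_smulU])
          (rmap D (comul L D) Coring.comul_op_smul z) := by
      intro z
      induction z using BTensor.induction with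
      | h d e => rfl
      | hadd x y hx hy => simp only [map_add, hx, hy]
    have h2 : ∀ z : BTensor L D D, convAct v (w • p) z
        = lift (A := L) (fun (d : D) (z : BTensor L D D) => v.hom d • convAct w p z)
          (fun z z' d => by rw [map_add, add_smul]) (fun z d d' => by rw [map_add, smul_add])
          (fun z l d => by rw [convAct_smul, v.hom_op_smul, mul_smul, lToEnd_smulU])
          (lmap D (comul L D) Coring.comul_smul z) := by
      intro z
      induction z using BTensor.induction with
      | h d e => rfl
      | hadd x y hx hy => simp only [map_add, hx, hy]
    rw [HomLD.smul_hom, HomLD.smul_hom, h1, h2, rmap_comul]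
    induction lmap D (comul L D) Coring.comul_smul (comul L D d) using BTensor.induction with
    | h d z =>
      induction z using BTensor.induction with
      | h e f => exact mul_smul (v.hom d) (w.hom e) (p.hom f)
      | hadd x y hx hy => simp only [tmul_add, map_add, hx, hy]
    | hadd x y hx hy => simp only [map_add, hx, hy]
  smul_zero v := by
    refine HomLD.ext fun d => ?_
    rw [HomLD.smul_hom]
    induction comul L D d using BTensor.induction with
    | h d e => exact smul_zero (v.hom d)
    | hadd x y hx hy => rw [map_add, hx, hy]; exact add_zero _
  smul_add v p p' := by
    refine HomLD.ext fun d => ?_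
    rw [HomLD.add_hom, HomLD.smul_hom, HomLD.smul_hom, HomLD.smul_hom]
    induction comul L D d using BTensor.induction with
    | h d e => exact smul_add (v.hom d) (p.hom e) (p'.hom e)
    | hadd x y hx hy => simp only [map_add, hx, hy]; abel
  add_smul v w p := by
    refine HomLD.ext fun d => ?_
    rw [HomLD.add_hom, HomLD.smul_hom, HomLD.smul_hom, HomLD.smul_hom]
    induction comul L D d using BTensor.induction with
    | h d e => exact add_smul (v.hom d) (w.hom d) (p.hom e)
    | hadd x y hx hy => simp only [map_add, hx, hy]; abel
  zero_smul p := by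
    refine HomLD.ext fun d => ?_
    rw [HomLD.smul_hom]
    induction comul L D d using BTensor.induction with
    | h d e => exact zero_smul (ComodEnd A C M) (p.hom e)
    | hadd x y hx hy => rw [map_add, hx, hy]; exact add_zero _

/-! #### The right action of `^C End^D(C)^op` on `_L Hom^D(D, M)` -/

variable (M) in
/-- The map `m ↦ m^{[0]} ε(u(m^{[1]}))`. -/
def endAct (u : BicomodEnd A C L D) : M →+ M :=
  (contract M ((counit A C).comp u.hom) u.counit_smul).comp (coaction A C M)

theorem coact_endAct (u : BicomodEnd A C L D) (m : M) :
    coaction A C M (endAct M u m) = lmap M u.hom u.isBicolinear.smul (coaction A C M m) := by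
  refine (coact_contract _ u.counit_smul m).trans ?_
  exact lmap_congr _ _ (contract_counit_comp u.isBicolinear.smul u.isBicolinear.comul) _

theorem endAct_smul (u : BicomodEnd A C L D) (t : ComodEnd A C M) (m : M) :
    endAct M u (t • m) = t • endAct M u m := by
  refine (congrArg (contract M _ u.counit_smul) (t.isColinear.coact m)).trans ?_
  exact contract_rmap _ _ t.toLin.toAddMonoidHom t.isColinear.op_smul _

theorem endAct_isColinear (u : BicomodEnd A C L D) :
    IsColinear L D (mapU A C L D (endAct M u)) := by
  refine mapU_isColinear _ (lmap M u.hom u.isBicolinear.smul) (coact_endAct u)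
    (lmap_op_smul _ _ u.isBicolinear.colinear.op_smul) fun z => ?_
  induction z using BTensor.induction with
  | h m c =>
    rw [lmap_tmul, tensorCoact_tmul, tensorCoact_tmul, u.isBicolinear.colinear.coact, rmap_comp',
      rmap_comp']
    rfl
  | hadd x y hx hy => simp only [map_add, hx, hy]

theorem endAct_mul (u u' : BicomodEnd A C L D) (m : M) :
    endAct M (u * u') m = endAct M u (endAct M u' m) := by
  apply coact_injective (A := A) (C := C)
  rw [coact_endAct, coact_endAct, coact_endAct, lmap_comp']
  rfl

theorem endAct_one (m : M) : endAct M (1 : BicomodEnd A C L D) m = m :=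
  RightComodule.contract_coact m

theorem endAct_add (u u' : BicomodEnd A C L D) (m : M) :
    endAct M (u + u') m = endAct M u m + endAct M u' m := by
  unfold endAct
  simp only [AddMonoidHom.comp_apply]
  induction coaction A C M m using BTensor.induction with
  | h m c =>
    refine (congrArg (fun a => op a • m) (map_add (counit A C) (u.hom c) (u'.hom c))).trans ?_
    exact add_smul _ _ _
  | hadd x y hx hy => simp only [map_add, hx, hy]; abel

theorem endAct_zero (m : M) : endAct M (0 : BicomodEnd A C L D) m = 0 := by
  have h := endAct_add (0 : BicomodEnd A C L D) 0 m
  rw [add_zero] at h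
  exact left_eq_add.mp h

/-- `(p u)(d) = p(d)^{[0]} ε(u(p(d)^{[1]}))`. -/
def HomLD.endSMul (u : BicomodEnd A C L D) (p : HomLD A C L D M) : HomLD A C L D M :=
  ⟨(mapU A C L D (endAct M u)).comp p.hom,
    fun l d => (congrArg _ (p.hom_smul l d)).trans
      (endAct_smul u (lToEnd A C L M l) ((toU A C L D M).symm (p.hom d))),
    (endAct_isColinear u).comp p.isColinear⟩

/-- The right action of the opposite ring of `^C End^D(C)` on `_L Hom^D(D, M)`. -/
instance homLDRightModule : Module (BicomodEnd A C L D)ᵐᵒᵖᵐᵒᵖ (HomLD A C L D M) where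
  smul u p := HomLD.endSMul (unop (unop u)) p
  one_smul p := HomLD.ext fun d => endAct_one ((toU A C L D M).symm (p.hom d))
  mul_smul u u' p := HomLD.ext fun d =>
    endAct_mul (unop (unop u)) (unop (unop u')) ((toU A C L D M).symm (p.hom d))
  smul_zero u := HomLD.ext fun _ => map_zero (endAct M (unop (unop u)))
  smul_add u p p' := HomLD.ext fun d => map_add (endAct M (unop (unop u)))
    ((toU A C L D M).symm (p.hom d)) ((toU A C L D M).symm (p'.hom d))
  add_smul u u' p := HomLD.ext fun d =>
    endAct_add (unop (unop u)) (unop (unop u')) ((toU A C L D M).symm (p.hom d))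
  zero_smul p := HomLD.ext fun d => endAct_zero ((toU A C L D M).symm (p.hom d))

theorem HomLD.op_smul_hom (u : BicomodEnd A C L D) (p : HomLD A C L D M) (d : D) :
    (op (op u) • p).hom d = mapU A C L D (endAct M u) (p.hom d) := rfl

instance : SMulCommClass (ConvRing A C L D M) (BicomodEnd A C L D)ᵐᵒᵖᵐᵒᵖ (HomLD A C L D M) where
  smul_comm v u p := by
    induction u using MulOpposite.rec' with
    | h u =>
      induction u using MulOpposite.rec' with
      | h u =>
        refine HomLD.ext fun d => ?_
        rw [HomLD.op_smul_hom, HomLD.smul_hom, HomLD.smul_hom]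
        induction comul L D d using BTensor.induction with
        | h d e => exact (endAct_smul u (v.hom d) ((toU A C L D M).symm (p.hom e))).symm
        | hadd x y hx hy => simp only [map_add, hx, hy]

end Context

section Context

set_option linter.unusedSectionVars false

open BTensor

variable {A C L D : Type u} [Ring A] [AddCommGroup C] [Module A C] [Module Aᵐᵒᵖ C]
  [SMulCommClass A Aᵐᵒᵖ C] [Coring A C] [Ring L] [AddCommGroup D] [Module L D] [Module Lᵐᵒᵖ D]
  [SMulCommClass L Lᵐᵒᵖ D] [Coring L D] [Module Lᵐᵒᵖ C] [SMulCommClass A Lᵐᵒᵖ C]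
  [CoringExtension A C L D]
  {M : Type u} [AddCommGroup M] [Module Aᵐᵒᵖ M] [RightComodule A C M]
  [Module L M] [SMulCommClass L Aᵐᵒᵖ M] [IsBicomodule L A C M]

/-! #### The bimodule of the maps `q : C → M^*` -/

/-- The underlying map `C → M^*`. -/
def QMod.hom (q : QMod A C L M) : C →+ (M →ₗ[Aᵐᵒᵖ] A) := q.1

theorem QMod.isQ (q : QMod A C L M) : IsQ L q.hom := q.2

theorem QMod.ext {q q' : QMod A C L M} (h : ∀ c x, q.hom c x = q'.hom c x) : q = q' :=
  Subtype.ext (AddMonoidHom.ext fun c => LinearMap.ext (h c))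

theorem QMod.add_hom (q q' : QMod A C L M) (c : C) : (q + q').hom c = q.hom c + q'.hom c := rfl

/-- The map `z ↦ z^1 q(z^2)(x)` on `X ⊗_A C`. -/
abbrev qContract (X : Type u) [AddCommGroup X] [Module Aᵐᵒᵖ X] (q : QMod A C L M) (x : M) :
    BTensor A X C →+ X :=
  contract X (evalAt q.hom x) (evalAt_smul q.isQ.smul x)

/-- The map `z ↦ q(c)(z^1) z^2` on `M ⊗_A C`. -/
abbrev qLContract (q : QMod A C L M) (c : C) : BTensor A M C →+ C :=
  lcontract C (q.hom c).toAddMonoidHom (dual_op_smul (q.hom c))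

theorem qContract_add {X : Type u} [AddCommGroup X] [Module Aᵐᵒᵖ X] (q : QMod A C L M) (x y : M)
    (z : BTensor A X C) : qContract X q (x + y) z = qContract X q x z + qContract X q y z := by
  induction z using BTensor.induction with
  | h m c =>
    refine (congrArg (fun a => op a • m) (map_add (q.hom c) x y)).trans ?_
    exact add_smul _ _ _
  | hadd x y hx hy => simp only [map_add, hx, hy]; abel

theorem qContract_op_smul {X : Type u} [AddCommGroup X] [Module Aᵐᵒᵖ X] (q : QMod A C L M) (x : M)
    (l : L) (z : BTensor A X C) : qContract X q x (op l • z) = qContract X q (l • x) z := by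
  induction z using BTensor.induction with
  | h m c => exact congrArg (fun a => op a • m) (q.isQ.op_smul l c x)
  | hadd x y hx hy => simp only [map_add, smul_add, hx, hy]

theorem qContract_op_smul_right {X : Type u} [AddCommGroup X] [Module Aᵐᵒᵖ X] (q : QMod A C L M)
    (x : M) (a : A) (z : BTensor A X C) : qContract X q (op a • x) z = op a • qContract X q x z := by
  induction z using BTensor.induction with
  | h m c =>
    refine (congrArg (fun b => op b • m) (map_smul (q.hom c) (op a) x)).trans ?_
    exact mul_smul (op a) (op (q.hom c x)) m
  | hadd x y hx hy => simp only [map_add, smul_add, hx, hy]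

/-- The map `c ⊗ d ↦ q(c)(y(d))`. -/
def qPair (q : QMod A C L M) (y : D →+ M) (hy : ∀ (l : L) d, y (l • d) = l • y d) :
    BTensor L C D →+ A :=
  lift (fun c d => q.hom c (y d)) (fun c c' d => by rw [map_add, LinearMap.add_apply])
    (fun c d d' => by rw [map_add, map_add]) (fun c l d => by rw [q.isQ.op_smul, hy])

theorem qPair_smul (q : QMod A C L M) (y : D →+ M) (hy : ∀ (l : L) d, y (l • d) = l • y d) (a : A)
    (z : BTensor L C D) : qPair q y hy (a • z) = a * qPair q y hy z := by
  induction z using BTensor.induction with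
  | h c d => exact DFunLike.congr_fun (q.isQ.smul a c) (y d)
  | hadd x y hx hy => simp only [map_add, smul_add, mul_add, hx, hy]

/-- The map `c ↦ q(c_{[0]})(y(c_{[1]}))`. -/
def qEval (q : QMod A C L M) (y : D →+ M) (hy : ∀ (l : L) d, y (l • d) = l • y d) : C →+ A :=
  (qPair q y hy).comp (coaction L D C)

theorem qEval_smul (q : QMod A C L M) (y : D →+ M) (hy : ∀ (l : L) d, y (l • d) = l • y d) (a : A)
    (c : C) : qEval q y hy (a • c) = a * qEval q y hy c :=
  (congrArg _ (CoringExtension.coact_smul a c)).trans (qPair_smul q y hy a _)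

/-- The map `(x ⊗ c) ⊗ d ↦ x q(c)(y(d))`. -/
def qTriple (X : Type u) [AddCommGroup X] [Module Aᵐᵒᵖ X] (q : QMod A C L M) (y : D →+ M)
    (hy : ∀ (l : L) d, y (l • d) = l • y d) : BTensor L (BTensor A X C) D →+ X :=
  lift (fun z d => qContract X q (y d) z) (fun z z' d => map_add _ z z')
    (fun z d d' => by rw [map_add, qContract_add]) (fun z l d => by rw [qContract_op_smul, hy])

theorem contract_qEval {X : Type u} [AddCommGroup X] [Module Aᵐᵒᵖ X] (q : QMod A C L M)
    (y : D →+ M) (hy : ∀ (l : L) d, y (l • d) = l • y d) (z : BTensor A X C) :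
    contract X (qEval q y hy) (qEval_smul q y hy) z
      = qTriple X q y hy (tensorCoact A C L D X z) := by
  induction z using BTensor.induction with
  | h x c =>
    rw [tensorCoact_tmul]
    change op (qPair q y hy (coaction L D C c)) • x = _
    induction coaction L D C c using BTensor.induction with
    | h c d => rfl
    | hadd x y hx hy => simp only [map_add, op_add, add_smul, hx, hy]
  | hadd x y hx hy => simp only [map_add, hx, hy]

/-- The map `c ⊗ d ↦ q(c)(y(d)^{[0]}) y(d)^{[1]}`. -/
def qCoact (q : QMod A C L M) (y : D →+ M) (hy : ∀ (l : L) d, y (l • d) = l • y d) :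
    BTensor L C D →+ C :=
  (qTriple C q y hy).comp (rmap D (comul A C) (CoringExtension.comul_op_smul (D := D)))

theorem qCoact_tmul (q : QMod A C L M) (y : D →+ M) (hy : ∀ (l : L) d, y (l • d) = l • y d) (c : C)
    (d : D) : qCoact q y hy (tmul L c d) = qLContract q c (coaction A C M (y d)) :=
  q.isQ.comul c (y d)

theorem contract_qEval_comul (q : QMod A C L M) (y : D →+ M)
    (hy : ∀ (l : L) d, y (l • d) = l • y d) (c : C) :
    contract C (qEval q y hy) (qEval_smul q y hy) (comul A C c)
      = qCoact q y hy (coaction L D C c) := by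
  rw [contract_qEval]
  refine congrArg (qTriple C q y hy) ?_
  exact (CoringExtension.comul_colinear c).symm

/-- `c ⊗ d ↦ q(c) ∘ v(d)`. -/
def qConv (q : QMod A C L M) (v : ConvRing A C L D M) : BTensor L C D →+ (M →ₗ[Aᵐᵒᵖ] A) :=
  lift (fun c d => op (v.hom d) • q.hom c) (fun c c' d => by rw [map_add, smul_add])
    (fun c d d' => by rw [map_add, op_add, add_smul])
    (fun c l d => LinearMap.ext fun x => by
      refine (q.isQ.op_smul l c (v.hom d • x)).trans ?_
      exact congrArg (fun t : ComodEnd A C M => q.hom c (t • x)) (v.hom_smul l d).symm)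

/-- The map `d ↦ v(d)(x)`. -/
def convEval (v : ConvRing A C L D M) (x : M) : D →+ M :=
  AddMonoidHom.mk' (fun d => v.hom d • x) (fun d d' => by rw [map_add, add_smul])

theorem convEval_smul (v : ConvRing A C L D M) (x : M) (l : L) (d : D) :
    convEval v x (l • d) = l • convEval v x d :=
  (congrArg (· • x) (v.hom_smul l d)).trans (mul_smul _ _ _)

theorem qConv_apply (q : QMod A C L M) (v : ConvRing A C L D M) (z : BTensor L C D) (x : M) :
    qConv q v z x = qPair q (convEval v x) (convEval_smul v x) z := by
  induction z using BTensor.induction with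
  | h c d => rfl
  | hadd x y hx hy => rw [map_add, map_add, LinearMap.add_apply, hx, hy]

theorem qConv_smul (q : QMod A C L M) (v : ConvRing A C L D M) (a : A) (z : BTensor L C D) :
    qConv q v (a • z) = a • qConv q v z :=
  LinearMap.ext fun x => by
    rw [qConv_apply, qPair_smul, LinearMap.smul_apply, qConv_apply, smul_eq_mul]

theorem qConv_op_smul (q : QMod A C L M) (v : ConvRing A C L D M) (l : L) (z : BTensor L C D)
    (x : M) : qConv q v (op l • z) x = qConv q v z (l • x) := by
  induction z using BTensor.induction with
  | h c d =>
    refine congrArg (fun t : ComodEnd A C M => q.hom c (t • x)) (v.hom_op_smul l d) |>.trans ?_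
    exact congrArg (q.hom c) (mul_smul (v.hom d) (lToEnd A C L M l) x)
  | hadd x y hx hy =>
    rw [smul_add, map_add, map_add, LinearMap.add_apply, hx, hy, LinearMap.add_apply]

theorem lcontract_dual_add (ξ η : M →ₗ[Aᵐᵒᵖ] A) (z : BTensor A M C) :
    lcontract C (ξ + η).toAddMonoidHom (dual_op_smul (ξ + η)) z
      = lcontract C ξ.toAddMonoidHom (dual_op_smul ξ) z
        + lcontract C η.toAddMonoidHom (dual_op_smul η) z := by
  induction z using BTensor.induction with
  | h m c => exact add_smul _ _ _
  | hadd x y hx hy => simp only [map_add, hx, hy]; abel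

/-- `(q v)(c) = q(c_{[0]}) v(c_{[1]})`. -/
def QMod.convSMul (v : ConvRing A C L D M) (q : QMod A C L M) : QMod A C L M :=
  ⟨(qConv q v).comp (coaction L D C), by
    refine ⟨fun a c => (congrArg _ (CoringExtension.coact_smul a c)).trans (qConv_smul q v a _),
      fun l c x => ?_, fun c x => ?_⟩
    · rw [AddMonoidHom.comp_apply, AddMonoidHom.comp_apply, RightComodule.coact_op_smul,
        qConv_op_smul]
    · have h1 : evalAt ((qConv q v).comp (coaction L D C)) x
          = qEval q (convEval v x) (convEval_smul v x) :=
        AddMonoidHom.ext fun c => qConv_apply q v _ x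
      have h2 := contract_qEval_comul q (convEval v x) (convEval_smul v x) c
      refine Eq.trans ?_ (h2.trans ?_)
      · congr 1
        simp only [h1]
      · rw [AddMonoidHom.comp_apply]
        induction coaction L D C c using BTensor.induction with
        | h c d =>
          rw [qCoact_tmul]
          refine (congrArg (qLContract q c) ((v.hom d).isColinear.coact x)).trans ?_
          induction coaction A C M x using BTensor.induction with
          | h m c => rfl
          | hadd x y hx hy => simp only [map_add, hx, hy]
        | hadd y z hy hz =>
          rw [map_add, hy, hz]
          rw [← lcontract_dual_add]
          simp only [map_add]⟩

theorem QMod.convSMul_hom (v : ConvRing A C L D M) (q : QMod A C L M) (c : C) :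
    (QMod.convSMul v q).hom c = qConv q v (coaction L D C c) := rfl

instance qModRightModule : Module (ConvRing A C L D M)ᵐᵒᵖ (QMod A C L M) where
  smul v q := QMod.convSMul (unop v) q
  one_smul q := by
    refine QMod.ext fun c x => ?_
    conv_rhs => rw [← RightComodule.contract_coact (A := L) (C := D) c]
    refine (DFunLike.congr_fun (QMod.convSMul_hom _ q c) x).trans ?_
    induction coaction L D C c using BTensor.induction with
    | h c d => exact (q.isQ.op_smul _ _ _).symm
    | hadd x y hx hy => simp only [map_add, LinearMap.add_apply, hx, hy]
  mul_smul v w q := by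
    refine QMod.ext fun c x => ?_
    have h1 : ∀ z : BTensor L C D, qConv (QMod.convSMul (unop w) q) (unop v) z x
        = lift (A := L) (fun (y : BTensor L C D) (d : D) =>
            qConv q (unop w) y ((unop v).hom d • x))
          (fun y y' d => by rw [map_add, LinearMap.add_apply])
          (fun y d d' => by rw [map_add, add_smul, map_add])
          (fun y l d => by rw [qConv_op_smul, (unop v).hom_smul, mul_smul, lToEnd_smul])
          (rmap D (coaction L D C) RightComodule.coact_op_smul z) := by
      intro z
      induction z using BTensor.induction with
      | h c d => rfl
      | hadd x y hx hy => simp only [map_add, LinearMap.add_apply, hx, hy]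
    have h2 : ∀ z : BTensor L C D, qConv q (unop w * unop v) z x
        = lift (A := L) (fun (c : C) (y : BTensor L D D) =>
            q.hom c (convMap (unop w) (unop v) y • x))
          (fun c c' y => by rw [map_add, LinearMap.add_apply])
          (fun c y y' => by rw [map_add, add_smul, map_add])
          (fun c l y => by rw [q.isQ.op_smul, convMap_smul, mul_smul, lToEnd_smul])
          (lmap C (comul L D) Coring.comul_smul z) := by
      intro z
      induction z using BTensor.induction with
      | h c d => rfl
      | hadd x y hx hy => simp only [map_add, LinearMap.add_apply, hx, hy]
    refine (h2 (coaction L D C c)).trans (Eq.trans ?_ (h1 (coaction L D C c)).symm)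
    rw [← RightComodule.coassoc]
    induction rmap D (coaction L D C) RightComodule.coact_op_smul (coaction L D C c)
      using BTensor.induction with
    | h y d =>
      induction y using BTensor.induction with
      | h c e => exact congrArg (q.hom c) (mul_smul ((unop w).hom e) ((unop v).hom d) x)
      | hadd x y hx hy => simp only [add_tmul, map_add, hx, hy]
    | hadd x y hx hy => simp only [map_add, hx, hy]
  smul_zero v := by
    refine QMod.ext fun c x => ?_
    refine (DFunLike.congr_fun (QMod.convSMul_hom _ 0 c) x).trans ?_
    induction coaction L D C c using BTensor.induction with
    | h c d => rfl
    | hadd x y hx hy => rw [map_add, LinearMap.add_apply, hx, hy]; exact add_zero _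
  smul_add v q q' := by
    refine QMod.ext fun c x => ?_
    refine (DFunLike.congr_fun (QMod.convSMul_hom _ (q + q') c) x).trans ?_
    change _ = qConv q (unop v) (coaction L D C c) x + qConv q' (unop v) (coaction L D C c) x
    induction coaction L D C c using BTensor.induction with
    | h c d => rfl
    | hadd x y hx hy => simp only [map_add, LinearMap.add_apply, hx, hy]; abel
  add_smul v w q := by
    refine QMod.ext fun c x => ?_
    refine (DFunLike.congr_fun (QMod.convSMul_hom _ q c) x).trans ?_
    change _ = qConv q (unop v) (coaction L D C c) x + qConv q (unop w) (coaction L D C c) x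
    induction coaction L D C c using BTensor.induction with
    | h c d => exact map_add (q.hom c) ((unop v).hom d • x) ((unop w).hom d • x)
    | hadd x y hx hy => simp only [map_add, LinearMap.add_apply, hx, hy]; abel
  zero_smul q := by
    refine QMod.ext fun c x => ?_
    refine (DFunLike.congr_fun (QMod.convSMul_hom _ q c) x).trans ?_
    induction coaction L D C c using BTensor.induction with
    | h c d => exact map_zero (q.hom c)
    | hadd x y hx hy => rw [map_add, LinearMap.add_apply, hx, hy]; exact add_zero _

theorem QMod.op_smul_hom (v : ConvRing A C L D M) (q : QMod A C L M) (c : C) :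
    (op v • q).hom c = qConv q v (coaction L D C c) := rfl

/-- `(u q)(c) = q(u(c))`. -/
def QMod.endSMul (u : BicomodEnd A C L D) (q : QMod A C L M) : QMod A C L M :=
  ⟨q.hom.comp u.hom,
    fun a c => (congrArg _ (u.isBicolinear.smul a c)).trans (q.isQ.smul a _),
    fun l c x => (congrArg (q.hom · x) (u.isBicolinear.colinear.op_smul l c)).trans
      (q.isQ.op_smul l _ x),
    fun c x => by
      refine Eq.trans ?_ (q.isQ.comul (u.hom c) x)
      rw [u.isBicolinear.comul]
      induction comul A C c using BTensor.induction with
      | h m c => rfl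
      | hadd x y hx hy => simp only [map_add, hx, hy]⟩

/-- The left action of the opposite ring of `^C End^D(C)`. -/
instance qModLeftModule : Module (BicomodEnd A C L D)ᵐᵒᵖ (QMod A C L M) where
  smul u q := QMod.endSMul (unop u) q
  one_smul _ := rfl
  mul_smul _ _ _ := rfl
  smul_zero _ := rfl
  smul_add _ _ _ := rfl
  add_smul u u' q := QMod.ext fun c x =>
    DFunLike.congr_fun (map_add q.hom ((unop u).hom c) ((unop u').hom c)) x
  zero_smul q := QMod.ext fun _ x => DFunLike.congr_fun (map_zero q.hom) x

theorem QMod.smul_hom (u : BicomodEnd A C L D) (q : QMod A C L M) (c : C) :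
    (op u • q).hom c = q.hom (u.hom c) := rfl

instance : SMulCommClass (BicomodEnd A C L D)ᵐᵒᵖ (ConvRing A C L D M)ᵐᵒᵖ (QMod A C L M) where
  smul_comm u v q := by
    induction u using MulOpposite.rec' with
    | h u =>
      induction v using MulOpposite.rec' with
      | h v =>
        refine QMod.ext fun c x => ?_
        rw [QMod.smul_hom, QMod.op_smul_hom, QMod.op_smul_hom, u.isBicolinear.colinear.coact]
        induction coaction L D C c using BTensor.induction with
        | h c d => rfl
        | hadd x y hx hy => simp only [map_add, LinearMap.add_apply, hx, hy]

end Context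

section Context

set_option linter.unusedSectionVars false

open BTensor

variable {A C L D : Type u} [Ring A] [AddCommGroup C] [Module A C] [Module Aᵐᵒᵖ C]
  [SMulCommClass A Aᵐᵒᵖ C] [Coring A C] [Ring L] [AddCommGroup D] [Module L D] [Module Lᵐᵒᵖ D]
  [SMulCommClass L Lᵐᵒᵖ D] [Coring L D] [Module Lᵐᵒᵖ C] [SMulCommClass A Lᵐᵒᵖ C]
  [CoringExtension A C L D] [IsPureExtension A C L D]
  {M : Type u} [AddCommGroup M] [Module Aᵐᵒᵖ M] [RightComodule A C M]
  [Module L M] [SMulCommClass L Aᵐᵒᵖ M] [IsBicomodule L A C M]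

/-! #### The connecting map `◆` -/

/-- The map underlying `p : D → M`, with values in the `C`-comodule `M`. -/
def HomLD.base (p : HomLD A C L D M) : D →+ M :=
  (toU A C L D M).symm.toAddMonoidHom.comp p.hom

theorem HomLD.base_smul (p : HomLD A C L D M) (l : L) (d : D) : p.base (l • d) = l • p.base d :=
  p.hom_smul l d

theorem HomLD.coact_base (p : HomLD A C L D M) (d : D) :
    coaction A C M (p.base d) = coactU A C L D M (p.hom d) := rfl

theorem HomLD.coact_base_op_smul (p : HomLD A C L D M) (l : L) (d : D) :
    coaction A C M (p.base (op l • d)) = op l • coaction A C M (p.base d) := by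
  rw [HomLD.coact_base, p.isColinear.op_smul, coactU_op_smul, HomLD.coact_base]

theorem HomLD.tensorCoact_base (p : HomLD A C L D M) (d : D) :
    tensorCoact A C L D M (coaction A C M (p.base d))
      = rmap D ((coaction A C M).comp p.base) p.coact_base_op_smul (comul L D d) := by
  rw [HomLD.coact_base, ← indCoact_spec]
  refine (congrArg _ (p.isColinear.coact d)).trans ?_
  exact rmap_comp' _ _ _ _ _

theorem lcontract_op_smul (ξ : M →+ A) (hξ : ∀ (a : A) m, ξ (op a • m) = ξ m * a) (l : L)
    (z : BTensor A M C) : lcontract C ξ hξ (op l • z) = op l • lcontract C ξ hξ z := by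
  induction z using BTensor.induction with
  | h m c => exact smul_comm (ξ m) (op l) c
  | hadd x y hx hy => simp only [map_add, smul_add, hx, hy]

theorem coact_lcontract (ξ : M →+ A) (hξ : ∀ (a : A) m, ξ (op a • m) = ξ m * a)
    (z : BTensor A M C) :
    coaction L D C (lcontract C ξ hξ z)
      = rmap D (lcontract C ξ hξ) (lcontract_op_smul ξ hξ) (tensorCoact A C L D M z) := by
  induction z using BTensor.induction with
  | h m c =>
    rw [tensorCoact_tmul, lcontract_tmul, CoringExtension.coact_smul]
    change ξ m • coaction L D C c = _
    induction coaction L D C c using BTensor.induction with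
    | h c d => rfl
    | hadd x y hx hy => simp only [map_add, smul_add, hx, hy]
  | hadd x y hx hy => simp only [map_add, hx, hy]

theorem qLContract_smul (q : QMod A C L M) (a : A) (c : C) (z : BTensor A M C) :
    qLContract q (a • c) z = a • qLContract q c z := by
  induction z using BTensor.induction with
  | h m c' =>
    refine (congrArg (fun ξ : M →ₗ[Aᵐᵒᵖ] A => ξ m • c') (q.isQ.smul a c)).trans ?_
    exact mul_smul a (q.hom c m) c'
  | hadd x y hx hy => simp only [map_add, smul_add, hx, hy]

theorem qCoact_smul (q : QMod A C L M) (y : D →+ M) (hy : ∀ (l : L) d, y (l • d) = l • y d) (a : A)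
    (w : BTensor L C D) : qCoact q y hy (a • w) = a • qCoact q y hy w := by
  induction w using BTensor.induction with
  | h c d =>
    rw [left_smul_tmul, qCoact_tmul, qCoact_tmul, qLContract_smul]
  | hadd x y hx hy => simp only [map_add, smul_add, hx, hy]

theorem qCoact_op_smul (q : QMod A C L M) (p : HomLD A C L D M) (l : L) (w : BTensor L C D) :
    qCoact q p.base p.base_smul (op l • w) = op l • qCoact q p.base p.base_smul w := by
  induction w using BTensor.induction with
  | h c d =>
    rw [right_smul_tmul, qCoact_tmul, qCoact_tmul, p.coact_base_op_smul]
    exact lcontract_op_smul _ _ _ _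
  | hadd x y hx hy => simp only [map_add, smul_add, hx, hy]

theorem coact_qCoact (q : QMod A C L M) (p : HomLD A C L D M) (w : BTensor L C D) :
    coaction L D C (qCoact q p.base p.base_smul w)
      = rmap D (qCoact q p.base p.base_smul) (qCoact_op_smul q p)
        (assoc.symm (lmap C (comul L D) Coring.comul_smul w)) := by
  induction w using BTensor.induction with
  | h c d =>
    rw [qCoact_tmul, lmap_tmul]
    refine (coact_lcontract _ _ _).trans ?_
    rw [p.tensorCoact_base]
    induction comul L D d using BTensor.induction with
    | h d e =>
      rw [assoc_symm_tmul, rmap_tmul, rmap_tmul, rmap_tmul, qCoact_tmul]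
      rfl
    | hadd x y hx hy => simp only [map_add, tmul_add, hx, hy]
  | hadd x y hx hy => simp only [map_add, hx, hy]

theorem contract_congr {X : Type u} [AddCommGroup X] [Module Aᵐᵒᵖ X] (g g' : C →+ A)
    (h : ∀ c, g c = g' c) {hg : ∀ (a : A) c, g (a • c) = a * g c}
    {hg' : ∀ (a : A) c, g' (a • c) = a * g' c} (z : BTensor A X C) :
    contract X g hg z = contract X g' hg' z := by
  obtain rfl : g = g' := AddMonoidHom.ext h
  rfl

/-- `(q ◆ p)(c) = q(c_{[0]})(p(c_{[1]})^{[0]}) p(c_{[1]})^{[1]}`. -/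
def blackEnd (q : QMod A C L M) (p : HomLD A C L D M) : BicomodEnd A C L D :=
  ⟨(qCoact q p.base p.base_smul).comp (coaction L D C), by
    refine ⟨fun a c => (congrArg _ (CoringExtension.coact_smul a c)).trans
      (qCoact_smul q p.base p.base_smul a _), fun c => ?_,
      ⟨fun l c => (congrArg _ (RightComodule.coact_op_smul l c)).trans (qCoact_op_smul q p l _),
        fun c => ?_⟩⟩
    · refine (congrArg (comul A C) (contract_qEval_comul q p.base p.base_smul c).symm).trans ?_
      refine (coact_contract (M := C) _ (qEval_smul q p.base p.base_smul) c).trans ?_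
      exact lmap_congr _ _ (contract_qEval_comul q p.base p.base_smul) _
    · refine (coact_qCoact q p _).trans ?_
      rw [← RightComodule.coassoc, AddEquiv.symm_apply_apply, rmap_comp']⟩

theorem blackEnd_hom (q : QMod A C L M) (p : HomLD A C L D M) (c : C) :
    (blackEnd q p).hom c = qCoact q p.base p.base_smul (coaction L D C c) := rfl

theorem blackEnd_hom' (q : QMod A C L M) (p : HomLD A C L D M) (c : C) :
    (blackEnd q p).hom c = contract C (qEval q p.base p.base_smul) (qEval_smul q p.base p.base_smul)
      (comul A C c) :=
  (contract_qEval_comul q p.base p.base_smul c).symm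

theorem counit_blackEnd (q : QMod A C L M) (p : HomLD A C L D M) (c : C) :
    counit A C ((blackEnd q p).hom c) = qEval q p.base p.base_smul c := by
  rw [blackEnd_hom']
  conv_rhs => rw [← Coring.lcontract_comul (A := A) c]
  induction comul A C c using BTensor.induction with
  | h c c' =>
    rw [contract_tmul, lcontract_tmul, Coring.counit_op_smul, qEval_smul]
  | hadd x y hx hy => simp only [map_add, hx, hy]

theorem blackEnd_add_left (q q' : QMod A C L M) (p : HomLD A C L D M) :
    blackEnd (q + q') p = blackEnd q p + blackEnd q' p := by
  refine BicomodEnd.ext fun c => ?_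
  change qCoact (q + q') p.base p.base_smul (coaction L D C c)
    = qCoact q p.base p.base_smul (coaction L D C c)
      + qCoact q' p.base p.base_smul (coaction L D C c)
  induction coaction L D C c using BTensor.induction with
  | h c d =>
    rw [qCoact_tmul, qCoact_tmul, qCoact_tmul]
    exact lcontract_dual_add _ _ _
  | hadd x y hx hy => simp only [map_add, hx, hy]; abel

theorem blackEnd_add_right (q : QMod A C L M) (p p' : HomLD A C L D M) :
    blackEnd q (p + p') = blackEnd q p + blackEnd q p' := by
  refine BicomodEnd.ext fun c => ?_
  change qCoact q (p + p').base (p + p').base_smul (coaction L D C c)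
    = qCoact q p.base p.base_smul (coaction L D C c)
      + qCoact q p'.base p'.base_smul (coaction L D C c)
  induction coaction L D C c using BTensor.induction with
  | h c d =>
    rw [qCoact_tmul, qCoact_tmul, qCoact_tmul, ← map_add, ← map_add]
    rfl
  | hadd x y hx hy => simp only [map_add, hx, hy]; abel

theorem blackEnd_balanced (q : QMod A C L M) (v : ConvRing A C L D M) (p : HomLD A C L D M) :
    blackEnd (op v • q) p = blackEnd q (v • p) := by
  refine BicomodEnd.ext fun c => ?_
  rw [blackEnd_hom', blackEnd_hom']
  refine contract_congr _ _ (fun c => ?_) _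
  have h1 : ∀ z : BTensor L C D, qPair (op v • q) p.base p.base_smul z
      = lift (A := L) (fun (y : BTensor L C D) (d : D) => qConv q v y (p.base d))
        (fun y y' d => by rw [map_add, LinearMap.add_apply])
        (fun y d d' => by rw [map_add, map_add])
        (fun y l d => by rw [qConv_op_smul, p.base_smul])
        (rmap D (coaction L D C) RightComodule.coact_op_smul z) := by
    intro z
    induction z using BTensor.induction with
    | h c d => rfl
    | hadd x y hx hy => simp only [map_add, hx, hy]
  have h2 : ∀ z : BTensor L C D, qPair q (v • p).base (v • p).base_smul z
      = lift (A := L) (fun (c : C) (y : BTensor L D D) =>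
          q.hom c ((toU A C L D M).symm (convAct v p y)))
        (fun c c' y => by rw [map_add, LinearMap.add_apply])
        (fun c y y' => by rw [map_add, map_add, map_add])
        (fun c l y => by rw [q.isQ.op_smul, convAct_smul]; rfl)
        (lmap C (comul L D) Coring.comul_smul z) := by
    intro z
    induction z using BTensor.induction with
    | h c d => rfl
    | hadd x y hx hy => simp only [map_add, hx, hy]
  refine (h1 (coaction L D C c)).trans (Eq.trans ?_ (h2 (coaction L D C c)).symm)
  rw [← RightComodule.coassoc]
  induction rmap D (coaction L D C) RightComodule.coact_op_smul (coaction L D C c)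
    using BTensor.induction with
  | h y d =>
    induction y using BTensor.induction with
    | h c e => rfl
    | hadd x y hx hy => simp only [add_tmul, map_add, hx, hy]
  | hadd x y hx hy => simp only [map_add, hx, hy]

theorem blackEnd_smul (u : BicomodEnd A C L D) (q : QMod A C L M) (p : HomLD A C L D M) :
    blackEnd (op u • q) p = blackEnd q p * u := by
  refine BicomodEnd.ext fun c => ?_
  change _ = qCoact q p.base p.base_smul (coaction L D C (u.hom c))
  rw [blackEnd_hom, u.isBicolinear.colinear.coact]
  induction coaction L D C c using BTensor.induction with
  | h c d =>
    rw [rmap_tmul, qCoact_tmul, qCoact_tmul]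
    rfl
  | hadd x y hx hy => simp only [map_add, hx, hy]

theorem blackEnd_op_smul (u : BicomodEnd A C L D) (q : QMod A C L M) (p : HomLD A C L D M) :
    blackEnd q (op (op u) • p) = u * blackEnd q p := by
  refine BicomodEnd.ext fun c => ?_
  change _ = u.hom (qCoact q p.base p.base_smul (coaction L D C c))
  rw [blackEnd_hom]
  induction coaction L D C c using BTensor.induction with
  | h c d =>
    rw [qCoact_tmul, qCoact_tmul]
    refine (congrArg (qLContract q c) (coact_endAct u (p.base d))).trans ?_
    induction coaction A C M (p.base d) using BTensor.induction with
    | h m c' => exact (u.isBicolinear.smul _ _).symm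
    | hadd x y hx hy => simp only [map_add, hx, hy]
  | hadd x y hx hy => simp only [map_add, hx, hy]

/-! #### The connecting map `◇` -/

/-- The map `x ↦ z^1 q(z^2)(x)`, for `z ∈ M ⊗_A C`. -/
def qEnd (q : QMod A C L M) (z : BTensor A M C) : M →ₗ[Aᵐᵒᵖ] M where
  toFun x := qContract M q x z
  map_add' x y := qContract_add q x y z
  map_smul' a x := qContract_op_smul_right q x (unop a) z

theorem qLContract_add (q : QMod A C L M) (c c' : C) (w : BTensor A M C) :
    qLContract q (c + c') w = qLContract q c w + qLContract q c' w :=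
  (congrArg (fun ξ : M →ₗ[Aᵐᵒᵖ] A => lcontract C ξ.toAddMonoidHom (dual_op_smul ξ) w)
    (map_add q.hom c c')).trans (lcontract_dual_add (q.hom c) (q.hom c') w)

theorem qEnd_op_smul (q : QMod A C L M) (z : BTensor A M C) (a : A) (m : M) :
    (qEnd q z).toAddMonoidHom (op a • m) = op a • (qEnd q z).toAddMonoidHom m :=
  map_smul (qEnd q z) (op a) m

theorem rmap_qEnd_add (q : QMod A C L M) (x y w : BTensor A M C) :
    rmap C (qEnd q (x + y)).toAddMonoidHom (qEnd_op_smul q (x + y)) w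
      = rmap C (qEnd q x).toAddMonoidHom (qEnd_op_smul q x) w
        + rmap C (qEnd q y).toAddMonoidHom (qEnd_op_smul q y) w := by
  induction w using BTensor.induction with
  | h m c =>
    refine (congrArg (tmul A · c) (map_add (qContract M q m) x y)).trans ?_
    exact add_tmul _ _ _
  | hadd z w hz hw => simp only [map_add, hz, hw]; abel

theorem rmap_qEnd (q : QMod A C L M) (z w : BTensor A M C) :
    rmap C (qEnd q z).toAddMonoidHom (qEnd_op_smul q z) w
      = lmap M (AddMonoidHom.mk' (fun c => qLContract q c w) (fun c c' => qLContract_add q c c' w))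
        (fun a c => qLContract_smul q a c w) z := by
  induction z using BTensor.induction with
  | h m c =>
    change _ = tmul A m (qLContract q c w)
    induction w using BTensor.induction with
    | h m' c' => exact smul_tmul m (q.hom c m') c'
    | hadd x y hx hy => rw [map_add, map_add, tmul_add, hx, hy]
  | hadd x y hx hy => rw [map_add, rmap_qEnd_add, hx, hy]

/-- The endomorphism `y ↦ x^{[0]} q(x^{[1]})(y)` of `M`. -/
def qLam (q : QMod A C L M) : M →+ ComodEnd A C M :=
  AddMonoidHom.mk' (fun x => ⟨qEnd q (coaction A C M x),
    ⟨qEnd_op_smul q (coaction A C M x), fun y => by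
      refine Eq.trans ?_ (rmap_qEnd q (coaction A C M x) (coaction A C M y)).symm
      refine (coact_contract _ (evalAt_smul q.isQ.smul y) x).trans ?_
      exact lmap_congr _ _ (fun c => q.isQ.comul c y) _⟩⟩)
    (fun x x' => ComodEnd.ext fun y => by
      refine Eq.trans ?_ (add_smul _ _ y).symm
      refine (congrArg (qContract M q y) (map_add (coaction A C M) x x')).trans ?_
      exact map_add (qContract M q y) _ _)

theorem qLam_smul (q : QMod A C L M) (x y : M) :
    qLam q x • y = qContract M q y (coaction A C M x) := rfl

theorem qLam_mul (q : QMod A C L M) (t : ComodEnd A C M) (x : M) :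
    qLam q (t • x) = t * qLam q x := by
  refine ComodEnd.ext fun y => ?_
  rw [mul_smul, qLam_smul, qLam_smul]
  refine (congrArg (qContract M q y) (t.isColinear.coact x)).trans ?_
  exact contract_rmap _ _ t.toLin.toAddMonoidHom t.isColinear.op_smul _

/-- `(p ◇ q)(d) = p(d)^{[0]} q(p(d)^{[1]})(-)`. -/
def whiteConv (p : HomLD A C L D M) (q : QMod A C L M) : ConvRing A C L D M :=
  ⟨(qLam q).comp p.base,
    fun l d => (congrArg (qLam q) (p.base_smul l d)).trans
      (qLam_mul q (lToEnd A C L M l) (p.base d)),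
    fun l d => ComodEnd.ext fun y => by
      refine (congrArg (qContract M q y) (p.coact_base_op_smul l d)).trans ?_
      refine (qContract_op_smul q y l _).trans ?_
      exact (mul_smul (qLam q (p.base d)) (lToEnd A C L M l) y).symm⟩

theorem whiteConv_hom (p : HomLD A C L D M) (q : QMod A C L M) (d : D) :
    (whiteConv p q).hom d = qLam q (p.base d) := rfl

theorem whiteConv_add_left (p p' : HomLD A C L D M) (q : QMod A C L M) :
    whiteConv (p + p') q = whiteConv p q + whiteConv p' q :=
  ConvRing.ext fun d => map_add (qLam q) (p.base d) (p'.base d)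

theorem whiteConv_add_right (p : HomLD A C L D M) (q q' : QMod A C L M) :
    whiteConv p (q + q') = whiteConv p q + whiteConv p q' := by
  refine ConvRing.ext fun d => ComodEnd.ext fun y => ?_
  rw [ConvRing.add_hom, add_smul, whiteConv_hom, whiteConv_hom, whiteConv_hom, qLam_smul,
    qLam_smul, qLam_smul]
  induction coaction A C M (p.base d) using BTensor.induction with
  | h m c => exact add_smul (op (q.hom c y)) (op (q'.hom c y)) m
  | hadd x y hx hy => simp only [map_add, hx, hy]; abel

theorem whiteConv_balanced (p : HomLD A C L D M) (u : BicomodEnd A C L D) (q : QMod A C L M) :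
    whiteConv (op (op u) • p) q = whiteConv p (op u • q) := by
  refine ConvRing.ext fun d => ComodEnd.ext fun y => ?_
  rw [whiteConv_hom, whiteConv_hom, qLam_smul, qLam_smul]
  refine (congrArg (qContract M q y) (coact_endAct u (p.base d))).trans ?_
  induction coaction A C M (p.base d) using BTensor.induction with
  | h m c => rfl
  | hadd x y hx hy => simp only [map_add, hx, hy]

theorem whiteConv_smul (v : ConvRing A C L D M) (p : HomLD A C L D M) (q : QMod A C L M) :
    whiteConv (v • p) q = v * whiteConv p q := by
  refine ConvRing.ext fun d => ?_
  rw [ConvRing.mul_hom]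
  change qLam q ((toU A C L D M).symm (convAct v p (comul L D d))) = _
  induction comul L D d using BTensor.induction with
  | h d e => exact qLam_mul q (v.hom d) (p.base e)
  | hadd x y hx hy => simp only [map_add, hx, hy]

theorem contract_qEval_base (q : QMod A C L M) (y : D →+ M)
    (hy : ∀ (l : L) d, y (l • d) = l • y d) (p : HomLD A C L D M) (d : D) :
    contract M (qEval q y hy) (qEval_smul q y hy) (coaction A C M (p.base d))
      = qTriple M q y hy
        (rmap D ((coaction A C M).comp p.base) p.coact_base_op_smul (comul L D d)) := by
  rw [contract_qEval, p.tensorCoact_base]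

theorem whiteConv_op_smul (v : ConvRing A C L D M) (p : HomLD A C L D M) (q : QMod A C L M) :
    whiteConv p (op v • q) = whiteConv p q * v := by
  refine ConvRing.ext fun d => ComodEnd.ext fun y => ?_
  rw [ConvRing.mul_hom, whiteConv_hom, qLam_smul]
  refine (contract_congr _ (qEval q (convEval v y) (convEval_smul v y))
    (fun c => qConv_apply q v _ y) (hg' := qEval_smul q _ _) _).trans ?_
  rw [contract_qEval_base]
  induction comul L D d using BTensor.induction with
  | h d e => exact (mul_smul (qLam q (p.base d)) (v.hom e) y).symm
  | hadd x y hx hy => simp only [map_add, add_smul, hx, hy]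

/-! #### The Morita context -/

theorem whiteConv_smul_eq (p : HomLD A C L D M) (q : QMod A C L M) (p' : HomLD A C L D M) :
    whiteConv p q • p' = op (op (blackEnd q p')) • p := by
  refine HomLD.ext fun d => (toU A C L D M).symm.injective ?_
  refine Eq.trans ?_ (contract_congr (qEval q p'.base p'.base_smul) _
    (fun c => (counit_blackEnd q p' c).symm) (hg := qEval_smul q _ _)
    (hg' := (blackEnd q p').counit_smul) _)
  refine Eq.trans ?_ (contract_qEval_base q p'.base p'.base_smul p d).symm
  rw [HomLD.smul_hom]
  induction comul L D d using BTensor.induction with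
  | h d e => rfl
  | hadd x y hx hy => simp only [map_add, hx, hy]

theorem hom_lcontract (q : QMod A C L M) (ξ : M →ₗ[Aᵐᵒᵖ] A) (x : M) (z : BTensor A M C) :
    q.hom (lcontract C ξ.toAddMonoidHom (dual_op_smul ξ) z) x = ξ (qContract M q x z) := by
  induction z using BTensor.induction with
  | h m c =>
    refine (DFunLike.congr_fun (q.isQ.smul (ξ m) c) x).trans ?_
    exact (dual_op_smul ξ (q.hom c x) m).symm
  | hadd x y hx hy => simp only [map_add, LinearMap.add_apply, hx, hy]

theorem blackEnd_smul_eq (q : QMod A C L M) (p : HomLD A C L D M) (q' : QMod A C L M) :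
    (op (blackEnd q p) : (BicomodEnd A C L D)ᵐᵒᵖ) • q' = op (whiteConv p q') • q := by
  refine QMod.ext fun c x => ?_
  rw [QMod.smul_hom, QMod.op_smul_hom, blackEnd_hom]
  induction coaction L D C c using BTensor.induction with
  | h c d =>
    rw [qCoact_tmul]
    exact hom_lcontract q' (q.hom c) x _
  | hadd x y hx hy => simp only [map_add, LinearMap.add_apply, hx, hy]

variable (A C L D M) in
/-- The Morita context
`(_L Hom_L(D, T), ^C End^D(C)^op, _L Hom^D(D, M), Q, ◆, ◇)` of the `L`-`C` bicomodule `M`. -/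
def moritaContext : MoritaContext (ConvRing A C L D M) (BicomodEnd A C L D)ᵐᵒᵖ (HomLD A C L D M)
    (QMod A C L M) where
  black := lift (fun q p => op (blackEnd q p))
    (fun q q' p => by rw [blackEnd_add_left, op_add])
    (fun q p p' => by rw [blackEnd_add_right, op_add])
    (fun q v p => by rw [blackEnd_balanced])
  white := lift (fun p q => whiteConv p q) whiteConv_add_left whiteConv_add_right
    (fun p u q => whiteConv_balanced p (unop u) q)
  black_smul s z := by
    induction z using BTensor.induction with
    | h q p => exact congrArg op (blackEnd_smul (unop s) q p)
    | hadd x y hx hy => rw [smul_add, map_add, map_add, hx, hy, mul_add]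
  black_op_smul s z := by
    induction z using BTensor.induction with
    | h q p => exact congrArg op (blackEnd_op_smul (unop s) q p)
    | hadd x y hx hy => rw [smul_add, map_add, map_add, hx, hy, add_mul]
  white_smul r z := by
    induction z using BTensor.induction with
    | h p q => exact whiteConv_smul r p q
    | hadd x y hx hy => rw [smul_add, map_add, map_add, hx, hy, mul_add]
  white_op_smul r z := by
    induction z using BTensor.induction with
    | h p q => exact whiteConv_op_smul r p q
    | hadd x y hx hy => rw [smul_add, map_add, map_add, hx, hy, add_mul]
  white_smul_eq p q p' := whiteConv_smul_eq p q p'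
  black_smul_eq q p q' := blackEnd_smul_eq q p q'

end Context

end CoringMorita

open CoringMorita

/-! Write `M` for `Σ`. The elements of `P = _L Hom^D(D, M)` and of `Q` are bicomodule maps in
disguise, and `◆`, `◇` are the two ways of composing them.

On one side, `T ⊗_L D` is extended from `L` to `T`, so the `T`-`D` bicomodule maps `T ⊗_L D → M` are
exactly `t ⊗ d ↦ t p(d)` with `p ∈ P` (`HomLD.lift`, `exists_lift_eq`). On the other side, `T ⊗_L D`
is cofree as a `D`-comodule, so a bicomodule map `M → T ⊗_L D` amounts to a map `f : M → T` that is
left `T`-linear and right `L`-linear. Each `q ∈ Q` gives such an `f`, namely `f(x) = x^{[0]}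
q(x^{[1]})(-)` (`QMod.colift`). If `M` is Galois, every `f` arises in this way: the bijection `M^*
⊗_T M → C` allows `q` to be defined by `ξ(x^{[0]}) x^{[1]} ↦ ξ ∘ f(x)`, and bijectivity of the
canonical map at `N = M` gives `f` back (`contract_dualOfEnd`, `exists_colift_eq`).

In these terms the composite `M → T ⊗_L D → M` is `x ↦ x^{[0]} ε((q ◆ p)(x^{[1]}))` (`lift_colift`),
and the composite `T ⊗_L D → M → T ⊗_L D` is `t ⊗ d ↦ t (p ◇ q)(d_{(1)}) ⊗ d_{(2)}` (`colift_lift`).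
A connecting map is surjective if and only if a finite sum of its values is `1`. A bicomodule is a
direct summand of a finite power of another if and only if its identity is a finite sum of
composites through the other. Hence both conditions are the same equation, read in two ways.

The Galois property itself comes from `◆`: if `∑ q_k ◆ p_k = 1`, then `n ⊗ c ↦ ∑ n q_k(c_{[0]})(-) ⊗
p_k(c_{[1]})` inverts the canonical map for every `N` (`isGaloisComodule_of_sum_blackEnd`).
Conversely, for Galois `M` the elements `ξ(x^{[0]}) x^{[1]}` exhaust `C` additively, so an
endomorphism of `C` that induces the identity on `M` is the identity
(`BicomodEnd.eq_one_of_endAct`). For `◇` no such passage is needed, since an endomorphism of `T ⊗_L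
D` is determined by its composite with `T ⊗_L ε` at the elements `1 ⊗ d`. -/

namespace CoringMorita

/-! ### Direct summands as retracts -/

section Retract

set_option linter.unusedSectionVars false

open BTensor

variable {S A C M N X : Type u} [Ring S] [Ring A] [AddCommGroup C] [Module A C] [Module Aᵐᵒᵖ C]
  [SMulCommClass A Aᵐᵒᵖ C] [Coring A C]
  [AddCommGroup M] [Module Aᵐᵒᵖ M] [RightComodule A C M] [Module S M] [SMulCommClass S Aᵐᵒᵖ M]
  [AddCommGroup N] [Module Aᵐᵒᵖ N] [RightComodule A C N] [Module S N] [SMulCommClass S Aᵐᵒᵖ N]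
  [AddCommGroup X] [Module Aᵐᵒᵖ X]

/-- The comodule structure on the image of an idempotent endomorphism `j ∘ π` of `N`. -/
abbrev retractComodule (j : X →+ N) (π : N →+ X) (hj : ∀ (a : A) x, j (op a • x) = op a • j x)
    (hπ : ∀ (a : A) n, π (op a • n) = op a • π n) (h : ∀ x, π (j x) = x)
    (he : IsColinear A C (j.comp π)) : RightComodule A C X where
  coact := (rmap C π hπ).comp ((coaction A C N).comp j)
  coact_op_smul a x := by
    simp only [AddMonoidHom.comp_apply]
    rw [hj, RightComodule.coact_op_smul, rmap_op_smul]
  coassoc x := by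
    simp only [AddMonoidHom.comp_apply]
    have key : rmap C (j.comp π) he.op_smul (coaction A C N (j x)) = coaction A C N (j x) := by
      rw [← he.coact, AddMonoidHom.comp_apply, h]
    rw [lmap_rmap, ← RightComodule.coassoc, ← assoc_rmap_rmap, rmap_comp', rmap_comp']
    conv_rhs => rw [← key, rmap_comp']
    rfl
  contract_coact x := by
    simp only [AddMonoidHom.comp_apply]
    rw [contract_rmap, RightComodule.contract_coact, h]

theorem IsColinear.sub {f g : M →+ N} (hf : IsColinear A C f) (hg : IsColinear A C g) :
    IsColinear A C (f - g) :=
  sub_eq_add_neg f g ▸ hf.add hg.neg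

variable [IsBicomodule S A C M] [IsBicomodule S A C N]

-- Tensoring with `C` need not be exact, so the kernel of an arbitrary colinear map has no evident
-- coaction. The kernel of a retraction `r` does: it is the image of the idempotent `1 - i ∘ r`, and
-- a split image inherits the coaction of `N`. In the other direction the projection along a
-- complementary subcomodule is colinear because it can be tested on the two summands separately.
variable (S A C M N) in
theorem isDirectSummand_iff_retract :
    IsDirectSummand S A C M N ↔ ∃ (i : M →ₗ[S] N) (r : N →ₗ[S] M),
      IsColinear A C i.toAddMonoidHom ∧ IsColinear A C r.toAddMonoidHom ∧ ∀ m, r (i m) = m := by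
  constructor
  · rintro ⟨X, _, _, _, _, _, _, i, j, hi, hj, hb⟩
    let e : (M × X) ≃ₗ[S] N := LinearEquiv.ofBijective (i.coprod j) hb
    have he : ∀ m x, e.symm (i m + j x) = (m, x) := fun m x =>
      e.symm_apply_apply (m, x)
    let r : N →ₗ[S] M := (LinearMap.fst S M X).comp e.symm.toLinearMap
    have hr : ∀ m x, r (i m + j x) = m := fun m x => congrArg Prod.fst (he m x)
    have hri : ∀ m, r (i m) = m := fun m => by simpa using hr m 0
    have hrj : ∀ x, r (j x) = 0 := fun x => by simpa using hr 0 x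
    have hs : ∀ (a : A) n, r.toAddMonoidHom (op a • n) = op a • r.toAddMonoidHom n := fun a n => by
      obtain ⟨⟨m, x⟩, rfl⟩ := hb.2 n
      refine Eq.trans ?_ (congrArg (op a • ·) (hr m x).symm)
      refine Eq.trans (congrArg r ?_) (hr (op a • m) (op a • x))
      exact (smul_add _ _ _).trans (congrArg₂ _ (hi.op_smul a m).symm (hj.op_smul a x).symm)
    refine ⟨i, r, hi, ⟨hs, fun n => ?_⟩, hri⟩
    obtain ⟨⟨m, x⟩, rfl⟩ := hb.2 n
    have h1 : coaction A C N (i m) = rmap C i.toAddMonoidHom hi.op_smul (coaction A C M m) :=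
      hi.coact m
    have h2 : coaction A C N (j x) = rmap C j.toAddMonoidHom hj.op_smul (coaction A C X x) :=
      hj.coact x
    -- The coaction of `j x` has its first leg in the image of `j`, on which `r` vanishes.
    have h3 : rmap C r.toAddMonoidHom hs (coaction A C N (j x)) = 0 := by
      rw [h2, rmap_comp']
      induction coaction A C X x using BTensor.induction with
      | h x c => exact (congrArg (tmul A · c) (hrj x)).trans (zero_tmul c)
      | hadd x y hx hy => rw [map_add, hx, hy, add_zero]
    have h4 : rmap C r.toAddMonoidHom hs (coaction A C N (i m)) = coaction A C M m := by
      rw [h1, rmap_comp']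
      refine (rmap_congr _ (AddMonoidHom.id M) hri _).trans (rmap_id _ ?_)
      exact fun _ _ => rfl
    change coaction A C M (r (i m + j x)) = rmap C r.toAddMonoidHom hs (coaction A C N (i m + j x))
    rw [hr, map_add, map_add, h3, h4, add_zero]
  · rintro ⟨i, r, hi, hr, h⟩
    let X := LinearMap.ker r
    let j : X →ₗ[S] N := X.subtype
    have hjinj : Function.Injective j := X.injective_subtype
    -- As the kernel of an `S`-linear map, `X` is a priori only an `S`-module. The right `A`-action
    -- of `N` restricts to it because colinearity of `r` includes right `A`-linearity.
    let : SMul Aᵐᵒᵖ X := ⟨fun a x => ⟨a • j x, by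
      have := hr.op_smul (unop a) (j x)
      exact this.trans ((congrArg (a • ·) x.2).trans (smul_zero a))⟩⟩
    let : Module Aᵐᵒᵖ X := Function.Injective.module Aᵐᵒᵖ j.toAddMonoidHom hjinj fun _ _ => rfl
    let π : N →ₗ[S] X := (LinearMap.id - i.comp r).codRestrict X (fun n => by
      simp [X, h])
    have hjπ : ∀ n, j (π n) = n - i (r n) := fun n => rfl
    have hπj : ∀ x, π (j x) = x := fun x => hjinj (by
      rw [hjπ, show r (j x) = 0 from x.2, map_zero, sub_zero])
    have hj : ∀ (a : A) x, j.toAddMonoidHom (op a • x) = op a • j.toAddMonoidHom x := fun _ _ => rfl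
    -- Colinearity of `π` makes no sense before `X` has a coaction. The idempotent `j ∘ π = 1 - i ∘
    -- r` is an endomorphism of `N`, and its colinearity suffices for `retractComodule`.
    have he : IsColinear A C (j.toAddMonoidHom.comp π.toAddMonoidHom) :=
      IsColinear.id.sub (hi.comp hr)
    have hπ : ∀ (a : A) n, π.toAddMonoidHom (op a • n) = op a • π.toAddMonoidHom n :=
      fun a n => hjinj (he.op_smul a n)
    let : RightComodule A C X := retractComodule j.toAddMonoidHom π.toAddMonoidHom hj hπ hπj he
    have : SMulCommClass S Aᵐᵒᵖ X := ⟨fun s a x => hjinj (smul_comm s a (j x))⟩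
    have hcoact : ∀ x : X, coaction A C X x = rmap C π.toAddMonoidHom hπ (coaction A C N (j x)) :=
      fun _ => rfl
    have : IsBicomodule S A C X := ⟨fun s x => by
      rw [hcoact, hcoact, map_smul, IsBicomodule.coact_smul, rmap_smul]
      exact fun s n => map_smul π s n⟩
    refine ⟨X, inferInstance, inferInstance, inferInstance, inferInstance, inferInstance,
      inferInstance, i, j, hi, ⟨hj, fun x => ?_⟩, ?_, fun n => ⟨(r n, π n), ?_⟩⟩
    · rw [hcoact, rmap_comp', ← he.coact]
      exact (congrArg (fun y => coaction A C N (j y)) (hπj x)).symm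
    · rintro ⟨m, x⟩ ⟨m', x'⟩ hm
      have h1 : ∀ m (x : X), r (i m + j x) = m := fun m x => by
        rw [map_add, h, show r (j x) = 0 from x.2, add_zero]
      have h2 : m = m' := by rw [← h1 m x, ← h1 m' x']; exact congrArg r hm
      subst h2
      exact Prod.ext rfl (hjinj (add_left_cancel hm))
    · exact (congrArg (i (r n) + ·) (hjπ n)).trans (add_sub_cancel _ _)

/-! ### Finite powers of a bicomodule -/

variable {ι : Type} [Fintype ι] [DecidableEq ι]

theorem incl_isColinear (k : ι) : IsColinear A C (incl N k) :=
  ⟨incl_op_smul k, fun n => powCoact_incl k n⟩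

theorem eval_isColinear (k : ι) : IsColinear A C (Pi.evalAddMonoidHom (fun _ : ι => N) k) := by
  have hs : ∀ (a : A) n, Pi.evalAddMonoidHom (fun _ : ι => N) k (op a • n)
      = op a • Pi.evalAddMonoidHom (fun _ : ι => N) k n := fun _ _ => rfl
  refine ⟨hs, fun n => ?_⟩
  refine Eq.trans ?_ (congrArg _ (powCoact_apply n).symm)
  -- Only the `k`-th term of the componentwise coaction survives; the others pass through the zero
  -- map from the `l`-th inclusion to the `k`-th projection.
  rw [map_sum, Finset.sum_eq_single k]
  · rw [rmap_comp']
    refine Eq.symm ((rmap_congr _ (AddMonoidHom.id N) (fun n => ?_) _).trans (rmap_id _ ?_))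
    · exact Pi.single_eq_same (M := fun _ => N) k n
    · exact fun _ _ => rfl
  · intro l _ hl
    rw [rmap_comp']
    induction coaction A C N (n l) using BTensor.induction with
    | h x c =>
      exact (congrArg (tmul A · c) (Pi.single_eq_of_ne (M := fun _ => N) hl.symm x)).trans
        (zero_tmul c)
    | hadd x y hx hy => rw [map_add, hx, hy, add_zero]
  · simp

omit [DecidableEq ι] in
theorem IsColinear.sum {f : ι → M →+ N} (hf : ∀ k, IsColinear A C (f k)) :
    IsColinear A C (∑ k, f k) := by
  refine Finset.sum_induction f (IsColinear A C) (fun _ _ => IsColinear.add) IsColinear.zero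
    fun k _ => hf k

-- Maps into and out of a finite power are families of components, so a retraction is the same as a
-- decomposition of the identity of `M` into composites through `N`. This form is compared below
-- with finite sums of values of `◆` and `◇`.
variable (S A C M N ι) in
theorem isDirectSummand_pow_iff :
    IsDirectSummand S A C M (ι → N) ↔ ∃ (i : ι → M →ₗ[S] N) (r : ι → N →ₗ[S] M),
      (∀ k, IsColinear A C (i k).toAddMonoidHom) ∧ (∀ k, IsColinear A C (r k).toAddMonoidHom) ∧
        ∀ m, ∑ k, r k (i k m) = m := by
  rw [isDirectSummand_iff_retract]
  constructor
  · rintro ⟨i, r, hi, hr, h⟩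
    refine ⟨fun k => (LinearMap.proj k).comp i, fun k => r.comp (LinearMap.single S (fun _ => N) k),
      fun k => (eval_isColinear k).comp hi, fun k => hr.comp (incl_isColinear k), fun m => ?_⟩
    simp only [LinearMap.comp_apply]
    rw [← map_sum]
    refine (congrArg r ?_).trans (h m)
    exact Finset.univ_sum_single (i m)
  · rintro ⟨i, r, hi, hr, h⟩
    refine ⟨LinearMap.pi i, ∑ k, (r k).comp (LinearMap.proj k), ?_, ?_, fun m => ?_⟩
    -- Rewriting the map into the power as a sum over inclusions gives its colinearity term by term;
    -- the map out of the power is treated alike with projections.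
    · have : (LinearMap.pi i).toAddMonoidHom = ∑ k, (incl N k).comp (i k).toAddMonoidHom := by
        refine AddMonoidHom.ext fun m => ?_
        rw [AddMonoidHom.finsetSum_apply]
        exact (Finset.univ_sum_single (fun k => i k m)).symm
      rw [this]
      exact IsColinear.sum fun k => (incl_isColinear k).comp (hi k)
    · have : (∑ k, (r k).comp (LinearMap.proj k)).toAddMonoidHom
          = ∑ k, (r k).toAddMonoidHom.comp (Pi.evalAddMonoidHom (fun _ : ι => N) k) := by
        refine AddMonoidHom.ext fun m => ?_
        rw [AddMonoidHom.finsetSum_apply]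
        exact LinearMap.sum_apply _ _ _
      rw [this]
      exact IsColinear.sum fun k => (hr k).comp (eval_isColinear k)
    · rw [LinearMap.sum_apply]
      exact h m

end Retract

/-! ### Colinear maps into a cofree comodule -/

section Cofree

open BTensor

theorem BTensor.exists_sum_tmul {A M N : Type*} [Ring A] [AddCommGroup M] [AddCommGroup N]
    [Module Aᵐᵒᵖ M] [Module A N] (z : BTensor A M N) :
    ∃ (s : ℕ) (m : Fin s → M) (n : Fin s → N), z = ∑ k, tmul A (m k) (n k) := by
  induction z using BTensor.induction with
  | h m n => exact ⟨1, fun _ => m, fun _ => n, by simp⟩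
  | hadd x y hx hy =>
    obtain ⟨s, m, n, rfl⟩ := hx
    obtain ⟨s', m', n', rfl⟩ := hy
    exact ⟨s + s', Fin.append m m', Fin.append n n', by simp [Fin.sum_univ_add]⟩

variable {A C X Y : Type*} [Ring A] [AddCommGroup C] [Module A C] [Module Aᵐᵒᵖ C]
  [SMulCommClass A Aᵐᵒᵖ C] [Coring A C] [AddCommGroup X] [Module Aᵐᵒᵖ X] [RightComodule A C X]
  [AddCommGroup Y] [Module Aᵐᵒᵖ Y]

variable (A C Y) in
/-- The map `Y ⊗_A ε : Y ⊗_A C → Y`. -/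
abbrev cofreeCounit : BTensor A Y C →+ Y :=
  contract Y (counit A C) Coring.counit_smul

theorem cofreeCounit_op_smul (a : A) (z : BTensor A Y C) :
    cofreeCounit A C Y (op a • z) = op a • cofreeCounit A C Y z := by
  induction z using BTensor.induction with
  | h y c =>
    rw [right_smul_tmul, contract_tmul, contract_tmul, Coring.counit_op_smul, op_mul, mul_smul]
  | hadd x y hx hy => rw [smul_add, map_add, map_add, smul_add, hx, hy]

theorem coaction_cofree (z : BTensor A Y C) : coaction A C (BTensor A Y C) z
    = assoc.symm (lmap Y (comul A C) Coring.comul_smul z) := rfl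

/-- A triangle identity of the adjunction between the forgetful functor and `- ⊗_A C`. It is the
left counit law: `y ε(c^{(1)}) ⊗ c^{(2)} = y ⊗ ε(c^{(1)}) c^{(2)} = y ⊗ c`. -/
theorem rmap_cofreeCounit_coaction (z : BTensor A Y C) :
    rmap C (cofreeCounit A C Y) cofreeCounit_op_smul (coaction A C (BTensor A Y C) z) = z := by
  rw [coaction_cofree]
  induction z using BTensor.induction with
  | h y c =>
    rw [lmap_tmul]
    conv_rhs => rw [← Coring.lcontract_comul (A := A) c]
    induction comul A C c using BTensor.induction with
    | h c c' => exact smul_tmul y (counit A C c) c'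
    | hadd x y hx hy => simp only [tmul_add, map_add, hx, hy]
  | hadd x y hx hy => simp only [map_add, hx, hy]

/-- The map `x ↦ f(x^{[0]}) ⊗ x^{[1]}`. -/
def toCofree (f : X →+ Y) (hf : ∀ (a : A) x, f (op a • x) = op a • f x) : X →+ BTensor A Y C :=
  (rmap C f hf).comp (coaction A C X)

theorem toCofree_apply (f : X →+ Y) (hf : ∀ (a : A) x, f (op a • x) = op a • f x) (x : X) :
    toCofree (C := C) f hf x = rmap C f hf (coaction A C X x) := rfl

/-- Coassociativity of `X`: the coaction of `Y ⊗_A C` acts on the leg that `f` leaves alone. -/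
theorem toCofree_isColinear (f : X →+ Y) (hf : ∀ (a : A) x, f (op a • x) = op a • f x) :
    IsColinear A C (toCofree (C := C) f hf) := by
  have hs : ∀ (a : A) x, toCofree (C := C) f hf (op a • x) = op a • toCofree (C := C) f hf x :=
    fun a x => by
      rw [toCofree_apply, RightComodule.coact_op_smul, rmap_op_smul, toCofree_apply]
  refine ⟨hs, fun x => ?_⟩
  rw [coaction_cofree, toCofree_apply, lmap_rmap, ← RightComodule.coassoc, ← assoc_rmap_rmap,
    AddEquiv.symm_apply_apply, rmap_comp']
  rfl

theorem cofreeCounit_toCofree (f : X →+ Y) (hf : ∀ (a : A) x, f (op a • x) = op a • f x) (x : X) :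
    cofreeCounit A C Y (toCofree f hf x) = f x := by
  rw [toCofree_apply, contract_rmap, RightComodule.contract_coact]

/-- The uniqueness half of the universal property of a cofree comodule. By the triangle identity a
colinear map `g` is recovered from its composite with `Y ⊗_A ε`. -/
theorem IsColinear.eq_toCofree {g : X →+ BTensor A Y C} (hg : IsColinear A C g)
    {f : X →+ Y} (hf : ∀ (a : A) x, f (op a • x) = op a • f x)
    (h : ∀ x, f x = cofreeCounit A C Y (g x)) (x : X) : toCofree f hf x = g x := by
  rw [← rmap_cofreeCounit_coaction (g x), hg.coact, rmap_comp']
  exact rmap_congr f _ h (hf := hf) _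

end Cofree

section Bicomodule

set_option linter.unusedSectionVars false

open BTensor

variable {A C L D : Type u} [Ring A] [AddCommGroup C] [Module A C] [Module Aᵐᵒᵖ C]
  [SMulCommClass A Aᵐᵒᵖ C] [Coring A C] [Ring L] [AddCommGroup D] [Module L D] [Module Lᵐᵒᵖ D]
  [SMulCommClass L Lᵐᵒᵖ D] [Coring L D] [Module Lᵐᵒᵖ C] [SMulCommClass A Lᵐᵒᵖ C]
  [CoringExtension A C L D] [IsPureExtension A C L D]
  {M : Type u} [AddCommGroup M] [Module Aᵐᵒᵖ M] [RightComodule A C M]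
  [Module L M] [SMulCommClass L Aᵐᵒᵖ M] [IsBicomodule L A C M]

/-! ### The bicomodule maps `T ⊗_L D → M` -/

/-- The map `t ⊗ d ↦ t p(d)`. -/
def HomLD.lift (p : HomLD A C L D M) :
    BTensor L (ComodEnd A C M) D →ₗ[ComodEnd A C M] UObj A C L D M where
  toFun := BTensor.lift (fun t d => t • p.hom d) (fun t t' d => add_smul t t' (p.hom d))
    (fun t d d' => by rw [map_add, smul_add])
    (fun t l d => by rw [p.hom_smul, end_op_smul_def, mul_smul, lToEnd_smulU])
  map_add' := map_add _
  map_smul' s z := by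
    induction z using BTensor.induction with
    | h t d => exact mul_smul s t (p.hom d)
    | hadd x y hx hy => rw [smul_add, map_add, map_add, hx, hy, smul_add]

theorem HomLD.lift_tmul (p : HomLD A C L D M) (t : ComodEnd A C M) (d : D) :
    p.lift (tmul L t d) = t • p.hom d := rfl

/-- The coaction of `M` is left `T`-linear and that of `T ⊗_L D` leaves `T` alone, so the claim
reduces to the colinearity of `p`. -/
theorem HomLD.lift_isColinear (p : HomLD A C L D M) :
    IsColinear L D p.lift.toAddMonoidHom := by
  have hs : ∀ (l : L) z, p.lift.toAddMonoidHom (op l • z) = op l • p.lift.toAddMonoidHom z := by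
    intro l z
    induction z using BTensor.induction with
    | h t d =>
      refine (congrArg (t • ·) (p.isColinear.op_smul l d)).trans ?_
      exact smul_comm t (op l) (p.hom d)
    | hadd x y hx hy => rw [smul_add, map_add, map_add, hx, hy, smul_add]
  refine ⟨hs, fun z => ?_⟩
  rw [coaction_cofree]
  induction z using BTensor.induction with
  | h t d =>
    refine (IsBicomodule.coact_smul t (p.hom d)).trans ?_
    rw [p.isColinear.coact, lmap_tmul]
    change t • rmap D p.hom p.isColinear.op_smul (comul L D d) = _
    induction comul L D d using BTensor.induction with
    | h d e => rfl
    | hadd x y hx hy => simp only [tmul_add, map_add, smul_add, hx, hy]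
  | hadd x y hx hy => simp only [map_add, hx, hy]

/-- `T ⊗_L D` is generated over `T` by the elements `1 ⊗ d`, and `d ↦ 1 ⊗ d` is left `L`-linear and
right `D`-colinear. Restriction of `F` along this map is therefore an element of `_L Hom^D(D, M)`
that determines `F`. -/
theorem exists_lift_eq (F : BTensor L (ComodEnd A C M) D →ₗ[ComodEnd A C M] UObj A C L D M)
    (hF : IsColinear L D F.toAddMonoidHom) : ∃ p : HomLD A C L D M, p.lift = F := by
  let j : D →+ BTensor L (ComodEnd A C M) D := tmulHom D 1
  have hj : IsColinear L D j := by
    refine ⟨tmulHom_op_smul 1, fun d => ?_⟩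
    change assoc.symm (tmul L (1 : ComodEnd A C M) (comul L D d)) = rmap D j _ (comul L D d)
    induction comul L D d using BTensor.induction with
    | h d e => rfl
    | hadd x y hx hy => simp only [tmul_add, map_add, hx, hy]
  have hl : ∀ (l : L) d, F (j (l • d)) = l • F (j d) := fun l d => by
    -- `F` is only known to be `T`-linear, so `l` is carried to the factor `T`: `1 ⊗ l d = l ⊗ d = l
    -- (1 ⊗ d)`, with `l` read in `T`.
    have h1 : j (l • d) = lToEnd A C L M l • j d := by
      refine (smul_tmul (1 : ComodEnd A C M) l d).symm.trans ?_
      refine congrArg (tmul L · d) ?_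
      exact (one_mul (lToEnd A C L M l)).trans (mul_one (lToEnd A C L M l)).symm
    rw [h1, map_smul, lToEnd_smulU]
  refine ⟨⟨F.toAddMonoidHom.comp j, hl, hF.comp hj⟩, LinearMap.ext fun z => ?_⟩
  induction z using BTensor.induction with
  | h t d =>
    refine (map_smul F t (j d)).symm.trans (congrArg F ?_)
    exact congrArg (tmul L · d) (mul_one t)
  | hadd x y hx hy => rw [map_add, map_add, hx, hy]

/-! ### The bicomodule maps `M → T ⊗_L D` -/

/-- The map `qLam q`, on the induced `D`-comodule. -/
def qLamU (q : QMod A C L M) : UObj A C L D M →+ ComodEnd A C M :=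
  (qLam q).comp (toU A C L D M).symm.toAddMonoidHom

/-- The right `L`-linearity of `q`, that is `q(c l)(y) = q(c)(l y)`, is used here together with that
of the coaction for the induced action on `M`. It is what allows `qLamU q` to be tensored with `D`
over `L`. -/
theorem qLamU_op_smul (q : QMod A C L M) (l : L) (x : UObj A C L D M) :
    qLamU q (op l • x) = op l • qLamU q x := by
  refine ComodEnd.ext fun y => ?_
  refine (congrArg (qContract M q y) (coactU_op_smul l x)).trans ?_
  refine (qContract_op_smul q y l _).trans ?_
  exact (mul_smul (qLamU q x) (lToEnd A C L M l) y).symm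

theorem qLamU_smul (q : QMod A C L M) (t : ComodEnd A C M) (x : UObj A C L D M) :
    qLamU q (t • x) = t • qLamU q x :=
  qLam_mul q t ((toU A C L D M).symm x)

variable (D) in
/-- The map `x ↦ x_{[0]}^{[0]} q(x_{[0]}^{[1]})(-) ⊗ x_{[1]}`. -/
noncomputable def QMod.colift (q : QMod A C L M) :
    UObj A C L D M →ₗ[ComodEnd A C M] BTensor L (ComodEnd A C M) D where
  toFun := toCofree (qLamU q) (qLamU_op_smul q)
  map_add' := map_add _
  map_smul' t x := by
    rw [toCofree_apply, IsBicomodule.coact_smul, rmap_smul _ _ (qLamU_smul q)]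
    rfl

theorem QMod.colift_apply (q : QMod A C L M) (x : UObj A C L D M) :
    q.colift D x = rmap D (qLamU q) (qLamU_op_smul q) (coaction L D (UObj A C L D M) x) := rfl

theorem QMod.colift_isColinear (q : QMod A C L M) :
    IsColinear L D (q.colift D).toAddMonoidHom :=
  toCofree_isColinear (qLamU q) (qLamU_op_smul q)

/-! ### The composites -/

/-- The composite sends `x` to `x_{[0]}^{[0]} q(x_{[0]}^{[1]})(p(x_{[1]}))`. The defining property
of the induced coaction replaces the coactions on `x` by the `D`-coaction on the second leg of
`ϱ(x)`, which gives `x^{[0]} q(x^{[1]}_{[0]})(p(x^{[1]}_{[1]}))`, and `c ↦ q(c_{[0]})(p(c_{[1]}))`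
is `ε ∘ (q ◆ p)`. -/
theorem lift_colift (q : QMod A C L M) (p : HomLD A C L D M) (x : UObj A C L D M) :
    p.lift (q.colift D x) = mapU A C L D (endAct M (blackEnd q p)) x := by
  -- The induced coaction is characterised only through `ϱ ⊗_L D`, so the composite is first
  -- factored through that map.
  have h1 : ∀ z : BTensor L (UObj A C L D M) D,
      p.lift (rmap D (qLamU q) (qLamU_op_smul q) z)
        = toU A C L D M (qTriple M q p.base p.base_smul
            (rmap D (coactU A C L D M) coactU_op_smul z)) := by
    intro z
    induction z using BTensor.induction with
    | h x d => rfl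
    | hadd x y hx hy => simp only [map_add, hx, hy]
  rw [QMod.colift_apply, h1]
  refine congrArg (toU A C L D M) ?_
  refine (congrArg (qTriple M q p.base p.base_smul) (indCoact_spec x)).trans ?_
  refine (contract_qEval q p.base p.base_smul _).symm.trans ?_
  exact contract_congr _ _ (fun c => (counit_blackEnd q p c).symm)
    (hg' := (blackEnd q p).counit_smul) _

theorem ConvRing.hom_op_smul_eq (v : ConvRing A C L D M) (l : L) (d : D) :
    v.hom (op l • d) = op l • v.hom d := v.2.2 l d

/-- By `T`-linearity it is enough to take `t = 1`. Colinearity of `p` turns the coaction of `p(d)`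
into `p(d_{(1)}) ⊗ d_{(2)}`, and `qLam q ∘ p` is `p ◇ q` by definition. -/
theorem colift_lift (q : QMod A C L M) (p : HomLD A C L D M) (t : ComodEnd A C M) (d : D) :
    q.colift D (p.lift (tmul L t d))
      = t • toCofree (X := D) (whiteConv p q).hom (whiteConv p q).hom_op_smul_eq d := by
  rw [HomLD.lift_tmul, map_smul, QMod.colift_apply, p.isColinear.coact, rmap_comp']
  rfl

end Bicomodule

section Galois

set_option linter.unusedSectionVars false

open BTensor

variable {A C L D : Type u} [Ring A] [AddCommGroup C] [Module A C] [Module Aᵐᵒᵖ C]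
  [SMulCommClass A Aᵐᵒᵖ C] [Coring A C] [Ring L] [AddCommGroup D] [Module L D] [Module Lᵐᵒᵖ D]
  [SMulCommClass L Lᵐᵒᵖ D] [Coring L D] [Module Lᵐᵒᵖ C] [SMulCommClass A Lᵐᵒᵖ C]
  [CoringExtension A C L D] [IsPureExtension A C L D]
  {M : Type u} [AddCommGroup M] [Module Aᵐᵒᵖ M] [RightComodule A C M]
  [Module L M] [SMulCommClass L Aᵐᵒᵖ M] [IsBicomodule L A C M]

/-! ### The inverse of the canonical map -/

theorem linear_op_smul {N : Type*} [AddCommGroup N] [Module Aᵐᵒᵖ N] (φ : M →ₗ[Aᵐᵒᵖ] N) (a : A)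
    (m : M) : φ.toAddMonoidHom (op a • m) = op a • φ.toAddMonoidHom m :=
  map_smul φ (op a) m

theorem can_tmul {N : Type*} [AddCommGroup N] [Module Aᵐᵒᵖ N] (φ : M →ₗ[Aᵐᵒᵖ] N) (x : M) :
    can A C M N (tmul (ComodEnd A C M) φ x)
      = rmap C φ.toAddMonoidHom (linear_op_smul φ) (coaction A C M x) := rfl

/-- The map `N ⊗_A C → Hom_A(M, N)`, `n ⊗ c ↦ n q(c)(-)`. -/
def qHom (N : Type u) [AddCommGroup N] [Module Aᵐᵒᵖ N] (q : QMod A C L M) :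
    BTensor A N C →+ (M →ₗ[Aᵐᵒᵖ] N) :=
  AddMonoidHom.mk' (fun z =>
    { toFun := fun x => qContract N q x z
      map_add' := fun x y => qContract_add q x y z
      map_smul' := fun a x => qContract_op_smul_right q x (unop a) z })
    (fun z z' => LinearMap.ext fun x => map_add (qContract N q x) z z')

section

variable {N : Type u} [AddCommGroup N] [Module Aᵐᵒᵖ N]

theorem qHom_op_smul (q : QMod A C L M) (l : L) (z : BTensor A N C) :
    qHom N q (op l • z) = op (lToEnd A C L M l) • qHom N q z :=
  LinearMap.ext fun x => qContract_op_smul q x l z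

theorem qHom_rmap (q : QMod A C L M) (φ : M →ₗ[Aᵐᵒᵖ] N) (x : M) :
    qHom N q (rmap C φ.toAddMonoidHom (linear_op_smul φ) (coaction A C M x))
      = op (qLam q x) • φ :=
  LinearMap.ext fun y =>
    contract_rmap (evalAt q.hom y) (evalAt_smul q.isQ.smul y) φ.toAddMonoidHom (linear_op_smul φ)
      (coaction A C M x)

variable (N) in
/-- The map `(n ⊗ c) ⊗ d ↦ n q(c)(-) ⊗ p(d)`. -/
def canInvAux (q : QMod A C L M) (p : HomLD A C L D M) :
    BTensor L (BTensor A N C) D →+ BTensor (ComodEnd A C M) (M →ₗ[Aᵐᵒᵖ] N) M :=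
  BTensor.lift (fun z d => tmul (ComodEnd A C M) (qHom N q z) (p.base d))
    (fun z z' d => by rw [map_add, add_tmul]) (fun z d d' => by rw [map_add, tmul_add])
    (fun z l d => by rw [qHom_op_smul, p.base_smul, smul_tmul, lToEnd_smul])

/-- On `n ⊗ c` the composite gives `n q(c_{[0]})(p(c_{[1]})^{[0]}) ⊗ p(c_{[1]})^{[1]}`; moving the
scalar in `A` across the tensor leaves `n ⊗ (q ◆ p)(c)`. -/
theorem can_canInvAux (q : QMod A C L M) (p : HomLD A C L D M) (z : BTensor A N C) :
    can A C M N (canInvAux N q p (tensorCoact A C L D N z))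
      = lmap N (blackEnd q p).hom (blackEnd q p).isBicolinear.smul z := by
  induction z using BTensor.induction with
  | h n c =>
    rw [tensorCoact_tmul, lmap_tmul, blackEnd_hom]
    induction coaction L D C c using BTensor.induction with
    | h c d =>
      rw [qCoact_tmul]
      refine (can_tmul (qHom N q (tmul A n c)) (p.base d)).trans ?_
      induction coaction A C M (p.base d) using BTensor.induction with
      | h m c' => exact smul_tmul n (q.hom c m) c'
      | hadd x y hx hy => simp only [map_add, tmul_add, hx, hy]
    | hadd x y hx hy => simp only [map_add, tmul_add, hx, hy]
  | hadd x y hx hy => simp only [map_add, hx, hy]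

/-- On `φ ⊗ x` the linear map `φ` comes out of the contraction with `q`, and the endomorphism `qLam
q` moves across `⊗_T`. What remains in the second factor is `p.lift ∘ q.colift`, which `lift_colift`
evaluates. -/
theorem canInvAux_can (q : QMod A C L M) (p : HomLD A C L D M)
    (z : BTensor (ComodEnd A C M) (M →ₗ[Aᵐᵒᵖ] N) M) :
    canInvAux N q p (tensorCoact A C L D N (can A C M N z))
      = lmap (M →ₗ[Aᵐᵒᵖ] N) (endAct M (blackEnd q p)) (endAct_smul _) z := by
  induction z using BTensor.induction with
  | h φ x =>
    -- The identity is proved for all `y` in `M ⊗_L D` and then used for `y` the induced coaction of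
    -- `x`, which `indCoact_spec` relates to the `D`-coaction of `C`.
    have h1 : ∀ y : BTensor L (UObj A C L D M) D,
        canInvAux N q p (rmap D (rmap C φ.toAddMonoidHom (linear_op_smul φ))
          (rmap_op_smul _ _) (rmap D (coactU A C L D M) coactU_op_smul y))
        = tmul (ComodEnd A C M) φ ((toU A C L D M).symm
            (p.lift (rmap D (qLamU q) (qLamU_op_smul q) y))) := by
      intro y
      induction y using BTensor.induction with
      | h x d =>
        refine (congrArg (tmul (ComodEnd A C M) · (p.base d))
          (qHom_rmap q φ ((toU A C L D M).symm x))).trans ?_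
        exact smul_tmul φ _ (p.base d)
      | hadd x y hx hy => simp only [map_add, tmul_add, hx, hy]
    rw [can_tmul, tensorCoact_rmap]
    refine (congrArg (fun w => canInvAux N q p (rmap D (rmap C φ.toAddMonoidHom
      (linear_op_smul φ)) (rmap_op_smul _ _) w))
      (indCoact_spec (toU A C L D M x)).symm).trans ?_
    refine (h1 _).trans ?_
    exact congrArg (fun w => tmul (ComodEnd A C M) φ ((toU A C L D M).symm w))
      (lift_colift q p (toU A C L D M x))
  | hadd x y hx hy => simp only [map_add, hx, hy]

end

theorem endAct_sum {ι : Type*} (s : Finset ι) (u : ι → BicomodEnd A C L D) (m : M) :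
    endAct M (∑ k ∈ s, u k) m = ∑ k ∈ s, endAct M (u k) m := by
  classical
  induction s using Finset.induction_on with
  | empty => exact endAct_zero m
  | insert k s hk ih => rw [Finset.sum_insert hk, Finset.sum_insert hk, endAct_add, ih]

theorem BicomodEnd.sum_hom {ι : Type*} (s : Finset ι) (u : ι → BicomodEnd A C L D) (c : C) :
    (∑ k ∈ s, u k).hom c = ∑ k ∈ s, (u k).hom c := by
  classical
  induction s using Finset.induction_on with
  | empty => rfl
  | insert k s hk ih => rw [Finset.sum_insert hk, Finset.sum_insert hk, ← ih]; rfl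

theorem ConvRing.sum_hom {ι : Type*} (s : Finset ι) (v : ι → ConvRing A C L D M) (d : D) :
    (∑ k ∈ s, v k).hom d = ∑ k ∈ s, (v k).hom d := by
  classical
  induction s using Finset.induction_on with
  | empty => rfl
  | insert k s hk ih => rw [Finset.sum_insert hk, Finset.sum_insert hk, ← ih]; rfl

/-- The sum of the maps `canInvAux` inverts the canonical map on both sides: one composite is `N ⊗_A
u` and the other is `Hom_A(M, N) ⊗_T` the action of `u` on `M`, where `u = ∑ q_k ◆ p_k = 1`. -/
theorem isGaloisComodule_of_sum_blackEnd {ι : Type*} [Fintype ι] (q : ι → QMod A C L M)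
    (p : ι → HomLD A C L D M) (h : ∑ k, blackEnd (q k) (p k) = 1) : IsGaloisComodule A C M := by
  intro N _ _
  let inv : BTensor A N C →+ BTensor (ComodEnd A C M) (M →ₗ[Aᵐᵒᵖ] N) M :=
    ∑ k, (canInvAux N (q k) (p k)).comp (tensorCoact A C L D N)
  have hinv : ∀ z, inv z = ∑ k, canInvAux N (q k) (p k) (tensorCoact A C L D N z) := fun z => by
    simp [inv, AddMonoidHom.finsetSum_apply]
  refine Function.bijective_iff_has_inverse.2 ⟨inv, fun z => ?_, fun z => ?_⟩
  · rw [hinv]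
    simp only [canInvAux_can]
    induction z using BTensor.induction with
    | h φ x =>
      simp only [lmap_tmul]
      refine (map_sum (tmulHom M φ) _ _).symm.trans (congrArg (tmul _ φ) ?_)
      rw [← endAct_sum, h, endAct_one]
    | hadd x y hx hy => simp only [map_add, Finset.sum_add_distrib, hx, hy]
  · rw [hinv, map_sum]
    simp only [can_canInvAux]
    induction z using BTensor.induction with
    | h n c =>
      simp only [lmap_tmul]
      refine (map_sum (tmulHom C n) _ _).symm.trans (congrArg (tmul _ n) ?_)
      rw [← BicomodEnd.sum_hom, h]
      rfl
    | hadd x y hx hy => simp only [map_add, Finset.sum_add_distrib, hx, hy]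

/-! ### Consequences of the Galois property -/

theorem regular_op_smul (a b : A) : AddMonoidHom.id A (op a • b) = AddMonoidHom.id A b * a := rfl

variable (A C M) in
/-- The canonical map `M^* ⊗_T M → C`, `ξ ⊗ x ↦ ξ(x^{[0]}) x^{[1]}`. -/
def canA : BTensor (ComodEnd A C M) (M →ₗ[Aᵐᵒᵖ] A) M →+ C :=
  (lcontract C (AddMonoidHom.id A) regular_op_smul).comp (can A C M A)

theorem canA_tmul (ξ : M →ₗ[Aᵐᵒᵖ] A) (x : M) : canA A C M (tmul _ ξ x)
    = lcontract C ξ.toAddMonoidHom (dual_op_smul ξ) (coaction A C M x) := by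
  change lcontract C (AddMonoidHom.id A) regular_op_smul (can A C M A (tmul _ ξ x)) = _
  rw [can_tmul]
  induction coaction A C M x using BTensor.induction with
  | h m c => rfl
  | hadd x y hx hy => simp only [map_add, hx, hy]

/-- The Galois condition at `N = A`, followed by the isomorphism `A ⊗_A C ≅ C`. -/
theorem canA_bijective (h : IsGaloisComodule A C M) : Function.Bijective (canA A C M) := by
  refine Function.Bijective.comp
    (g := lcontract C (AddMonoidHom.id A) regular_op_smul) (Function.bijective_iff_has_inverse.2
      ⟨(tmulHom C (1 : A) : C →+ BTensor A A C), fun z => ?_, fun c => one_smul A c⟩) (h A)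
  induction z using BTensor.induction with
  | h a c =>
    refine (smul_tmul (1 : A) a c).symm.trans (congrArg (tmul A · c) ?_)
    exact one_mul a
  | hadd x y hx hy => rw [map_add, map_add, hx, hy]

/-- Every element of `C` is a sum of elements `ξ(x^{[0]}) x^{[1]}`. Left `A`-linearity gives
`u(ξ(x^{[0]}) x^{[1]}) = ξ(x^{[0]}) u(x^{[1]})`, and `x^{[0]} ⊗ u(x^{[1]})` is the coaction of the
image of `x` under `u`, here `x` itself. -/
theorem BicomodEnd.eq_one_of_endAct (h : IsGaloisComodule A C M) {u : BicomodEnd A C L D}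
    (hu : ∀ x : M, endAct M u x = x) : u = 1 := by
  refine BicomodEnd.ext fun c => ?_
  obtain ⟨z, rfl⟩ := (canA_bijective h).2 c
  change u.hom _ = canA A C M z
  induction z using BTensor.induction with
  | h ξ x =>
    rw [canA_tmul]
    conv_rhs => rw [← hu x, coact_endAct]
    induction coaction A C M x using BTensor.induction with
    | h m c => exact u.isBicolinear.smul (ξ m) c
    | hadd x y hx hy => simp only [map_add, hx, hy]
  | hadd x y hx hy => rw [map_add, map_add, hx, hy]

/-- For `n ∈ N`, the map `A → N`, `a ↦ n a`. -/
def orbitMap {N : Type u} [AddCommGroup N] [Module Aᵐᵒᵖ N] (n : N) : A →ₗ[Aᵐᵒᵖ] N where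
  toFun a := op a • n
  map_add' a b := by rw [op_add, add_smul]
  map_smul' a b := mul_smul a (op b) n

/-- Composition with `orbitMap n`. -/
def orbitComp {N : Type u} [AddCommGroup N] [Module Aᵐᵒᵖ N] (n : N) :
    (M →ₗ[Aᵐᵒᵖ] A) →+ (M →ₗ[Aᵐᵒᵖ] N) :=
  AddMonoidHom.mk' (fun ξ => (orbitMap n).comp ξ)
    (fun ξ η => LinearMap.ext fun x => map_add (orbitMap n) (ξ x) (η x))

/-- Naturality of the canonical map along `A → N`, `a ↦ n a`. It produces an explicit preimage of `n
⊗ c` from a preimage of `c` in `M^* ⊗_T M`. -/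
theorem can_rmap_orbitComp {N : Type u} [AddCommGroup N] [Module Aᵐᵒᵖ N] (n : N)
    (w : BTensor (ComodEnd A C M) (M →ₗ[Aᵐᵒᵖ] A) M) :
    can A C M N (rmap M (orbitComp n) (fun _ _ => rfl) w) = tmul A n (canA A C M w) := by
  induction w using BTensor.induction with
  | h ξ x =>
    rw [canA_tmul]
    refine (can_tmul ((orbitMap n).comp ξ) x).trans ?_
    induction coaction A C M x using BTensor.induction with
    | h m c => exact smul_tmul n (ξ m) c
    | hadd x y hx hy => simp only [map_add, tmul_add, hx, hy]
  | hadd x y hx hy => simp only [map_add, tmul_add, hx, hy]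

/-- For `c = ξ(y^{[0]}) y^{[1]}` this moves `c ↦ c^{(1)} g(c^{(2)})` onto the second leg of the
coaction of `y`, by left `A`-linearity of `Δ`. -/
theorem contract_comul_lcontract (g : C →+ A) (hg : ∀ (a : A) c, g (a • c) = a * g c)
    (ξ : M →ₗ[Aᵐᵒᵖ] A) (z : BTensor A M C) :
    contract C g hg (comul A C (lcontract C ξ.toAddMonoidHom (dual_op_smul ξ) z))
      = lcontract C ξ.toAddMonoidHom (dual_op_smul ξ) (lmap M ((contract C g hg).comp (comul A C))
        (fun a c => (congrArg _ (Coring.comul_smul a c)).trans (contract_smul g hg a _)) z) := by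
  induction z using BTensor.induction with
  | h m c =>
    exact (congrArg (contract C g hg) (Coring.comul_smul (ξ m) c)).trans
      (contract_smul g hg (ξ m) (comul A C c))
  | hadd x y hx hy => simp only [map_add, hx, hy]

/-! ### The element of `Q` attached to a `T`-linear map `M → T` -/

section LeftT

variable (f : M →+ ComodEnd A C M) (hf : ∀ (t : ComodEnd A C M) x, f (t • x) = t * f x)

/-- The map `Hom_A(M, N) ⊗_T M → Hom_A(M, N)`, `φ ⊗ y ↦ φ ∘ f(y)`. -/
def homEval (N : Type u) [AddCommGroup N] [Module Aᵐᵒᵖ N] :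
    BTensor (ComodEnd A C M) (M →ₗ[Aᵐᵒᵖ] N) M →+ (M →ₗ[Aᵐᵒᵖ] N) :=
  BTensor.lift (fun φ y => op (f y) • φ) (fun φ ψ y => smul_add _ φ ψ)
    (fun φ y y' => by rw [map_add, op_add, add_smul])
    (fun φ t y => by rw [hf, op_mul, mul_smul])

variable (h : IsGaloisComodule A C M)

/-- The map `C → M^*` that corresponds to `f`, `ξ(x^{[0]}) x^{[1]} ↦ ξ ∘ f(x)`. -/
noncomputable def dualOfEnd : C →+ (M →ₗ[Aᵐᵒᵖ] A) :=
  (homEval f hf A).comp (AddEquiv.ofBijective (canA A C M) (canA_bijective h)).symm.toAddMonoidHom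

theorem dualOfEnd_canA (w : BTensor (ComodEnd A C M) (M →ₗ[Aᵐᵒᵖ] A) M) :
    dualOfEnd f hf h (canA A C M w) = homEval f hf A w :=
  congrArg (homEval f hf A)
    ((AddEquiv.ofBijective (canA A C M) (canA_bijective h)).symm_apply_apply w)

/-- `canA` is left `A`-linear for the action of `A` on `M^*`, and so is `ξ ⊗ x ↦ ξ ∘ f(x)`. -/
theorem dualOfEnd_smul (a : A) (c : C) :
    dualOfEnd f hf h (a • c) = a • dualOfEnd f hf h c := by
  obtain ⟨w, rfl⟩ := (canA_bijective h).2 c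
  have hs : ∀ (t : ComodEnd A C M) (ξ : M →ₗ[Aᵐᵒᵖ] A),
      DistribSMul.toAddMonoidHom (M →ₗ[Aᵐᵒᵖ] A) a (op t • ξ)
        = op t • DistribSMul.toAddMonoidHom (M →ₗ[Aᵐᵒᵖ] A) a ξ := fun _ _ => rfl
  have h1 : ∀ w, a • canA A C M w
      = canA A C M (rmap M (DistribSMul.toAddMonoidHom (M →ₗ[Aᵐᵒᵖ] A) a) hs w) := by
    intro w
    induction w using BTensor.induction with
    | h ξ x =>
      rw [rmap_tmul, canA_tmul, canA_tmul]
      induction coaction A C M x using BTensor.induction with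
      | h m c => exact (mul_smul a (ξ m) c).symm
      | hadd x y hx hy => simp only [map_add, smul_add, hx, hy]
    | hadd x y hx hy => simp only [map_add, smul_add, hx, hy]
  rw [h1, dualOfEnd_canA, dualOfEnd_canA]
  induction w using BTensor.induction with
  | h ξ x => rfl
  | hadd x y hx hy => simp only [map_add, smul_add, hx, hy]

/-- This recovers `f` from the map `q` built out of it: `y^{[0]} q(y^{[1]})(x) = f(y)(x)`. Only the
case `N = A` enters the definition of `q`, whereas here the canonical map must be injective at `N =
M`. There `id ⊗ y` is the unique preimage of `ϱ(y)`, and evaluation `φ ⊗ y ↦ φ ∘ f(y)` sends it to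
`f(y)`. -/
theorem contract_dualOfEnd (x y : M) :
    contract M (evalAt (dualOfEnd f hf h) x) (evalAt_smul (dualOfEnd_smul f hf h) x)
      (coaction A C M y) = f y • x := by
  -- Contraction with `q` agrees with `homEval` on a suitable preimage of each `z`; for a pure
  -- tensor `n ⊗ c` the preimage is that of `can_rmap_orbitComp`.
  have h1 : ∀ z : BTensor A M C, ∃ W, can A C M M W = z ∧ homEval f hf M W x
      = contract M (evalAt (dualOfEnd f hf h) x) (evalAt_smul (dualOfEnd_smul f hf h) x) z := by
    intro z
    induction z using BTensor.induction with
    | h n c =>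
      obtain ⟨w, rfl⟩ := (canA_bijective h).2 c
      refine ⟨_, can_rmap_orbitComp n w, ?_⟩
      rw [contract_tmul]
      change _ = op (dualOfEnd f hf h (canA A C M w) x) • n
      rw [dualOfEnd_canA]
      induction w using BTensor.induction with
      | h ξ y => rfl
      | hadd x y hx hy => simp only [map_add, LinearMap.add_apply, op_add, add_smul, hx, hy]
    | hadd z z' hz hz' =>
      obtain ⟨W, hW, hW'⟩ := hz
      obtain ⟨V, hV, hV'⟩ := hz'
      exact ⟨W + V, by rw [map_add, hW, hV],
        by rw [map_add, LinearMap.add_apply, hW', hV', map_add]⟩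
  obtain ⟨W, hW, hW'⟩ := h1 (coaction A C M y)
  -- The preimage found above was not canonical; injectivity identifies it.
  have h2 : W = tmul (ComodEnd A C M) (LinearMap.id : M →ₗ[Aᵐᵒᵖ] M) y := by
    refine (h M).1 (hW.trans ?_)
    exact (rmap_id (coaction A C M y) fun _ _ => rfl).symm
  rw [← hW', h2]
  rfl

/-- Since `ϱ(y l) = ϱ(y) l`, right multiplication by `l` on `C` corresponds under `canA` to the
induced action on the factor `M` of `M^* ⊗_T M`. By `hl` the map `f` turns that action into
precomposition with `l`. -/
theorem dualOfEnd_op_smul (hC : ∀ (l : L) (c : C), comul A C (op l • c) = op l • comul A C c)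
    (hl : ∀ (l : L) x, f (indAct A C L M l x) = f x * lToEnd A C L M l)
    (l : L) (c : C) (x : M) : dualOfEnd f hf h (op l • c) x = dualOfEnd f hf h c (l • x) := by
  obtain ⟨w, rfl⟩ := (canA_bijective h).2 c
  have hg : ∀ (a : A) c, (counit A C).comp (rmulHom C l) (a • c)
      = a * (counit A C).comp (rmulHom C l) c := fun a c =>
    (congrArg _ (rmulHom_smul l a c)).trans (Coring.counit_smul a _)
  -- The induced action commutes with `T`, hence is defined on the second factor of a tensor product
  -- over `T`.
  have hs : ∀ (t : ComodEnd A C M) x, indAct A C L M l (t • x) = t • indAct A C L M l x :=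
    fun t x => (congrArg (contract M ((counit A C).comp (rmulHom C l)) hg)
      (t.isColinear.coact x)).trans
        (contract_rmap _ hg t.toLin.toAddMonoidHom t.isColinear.op_smul _)
  have h1 : ∀ w, op l • canA A C M w
      = canA A C M (lmap (M →ₗ[Aᵐᵒᵖ] A) (indAct A C L M l) hs w) := by
    intro w
    induction w using BTensor.induction with
    | h ξ x =>
      rw [lmap_tmul, canA_tmul, canA_tmul, coact_indAct hC]
      exact (lcontract_op_smul _ _ l _).symm
    | hadd x y hx hy => simp only [map_add, smul_add, hx, hy]
  rw [h1, dualOfEnd_canA, dualOfEnd_canA]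
  induction w using BTensor.induction with
  | h ξ y =>
    change ξ (f (indAct A C L M l y) • x) = ξ (f y • l • x)
    rw [hl, mul_smul, lToEnd_smul]
  | hadd x y hx hy => simp only [map_add, LinearMap.add_apply, hx, hy]

/-- For `c = ξ(y^{[0]}) y^{[1]}`, coassociativity and `contract_dualOfEnd` show that `c^{(1)}
q(c^{(2)})(x)` is `ξ(z^{[0]}) z^{[1]}` with `z = f(y)(x)`. As `f(y)` is `C`-colinear, this equals
`ξ(f(y)(x^{[0]})) x^{[1]} = q(c)(x^{[0]}) x^{[1]}`. -/
theorem dualOfEnd_isQ (hC : ∀ (l : L) (c : C), comul A C (op l • c) = op l • comul A C c)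
    (hl : ∀ (l : L) x, f (indAct A C L M l x) = f x * lToEnd A C L M l) :
    IsQ L (dualOfEnd f hf h) where
  smul := dualOfEnd_smul f hf h
  op_smul := dualOfEnd_op_smul f hf h hC hl
  comul c x := by
    obtain ⟨w, rfl⟩ := (canA_bijective h).2 c
    rw [dualOfEnd_canA]
    induction w using BTensor.induction with
    | h ξ y =>
      have h1 := coact_contract (evalAt (dualOfEnd f hf h) x)
        (evalAt_smul (dualOfEnd_smul f hf h) x) y
      rw [contract_dualOfEnd] at h1
      have h3 : coaction A C M (f y • x) = rmap C (f y).toLin.toAddMonoidHom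
          (f y).isColinear.op_smul (coaction A C M x) := (f y).isColinear.coact x
      rw [canA_tmul, contract_comul_lcontract, ← h1, h3]
      change _ = lcontract C (op (f y) • ξ).toAddMonoidHom _ (coaction A C M x)
      induction coaction A C M x using BTensor.induction with
      | h m c => rfl
      | hadd x y hx hy => simp only [map_add, hx, hy]
    | hadd w w' hw hw' =>
      rw [map_add, map_add, map_add, hw, hw', map_add, ← lcontract_dual_add]

end LeftT

/-- By cofreeness `G` is determined by `f = (T ⊗_L ε) ∘ G`, which is left `T`-linear and right
`L`-linear. The Galois property turns `f` into an element `q` of `Q` with `qLam q = f`. -/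
theorem exists_colift_eq (h : IsGaloisComodule A C M)
    (G : UObj A C L D M →ₗ[ComodEnd A C M] BTensor L (ComodEnd A C M) D)
    (hG : IsColinear L D G.toAddMonoidHom) : ∃ q : QMod A C L M, q.colift D = G := by
  let f : M →+ ComodEnd A C M := (cofreeCounit L D (ComodEnd A C M)).comp
    (G.toAddMonoidHom.comp (toU A C L D M).toAddMonoidHom)
  have hf : ∀ (t : ComodEnd A C M) x, f (t • x) = t * f x := fun t x =>
    (congrArg (cofreeCounit L D (ComodEnd A C M)) (map_smul G t (toU A C L D M x))).trans
      (contract_smul _ _ t _)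
  have hl : ∀ (l : L) x, f (indAct A C L M l x) = f x * lToEnd A C L M l := fun l x =>
    (congrArg (cofreeCounit L D (ComodEnd A C M)) (hG.op_smul l (toU A C L D M x))).trans
      (cofreeCounit_op_smul l _)
  let q : QMod A C L M := ⟨dualOfEnd f hf h,
    dualOfEnd_isQ f hf h (CoringExtension.comul_op_smul (D := D)) hl⟩
  refine ⟨q, LinearMap.ext fun x => ?_⟩
  refine hG.eq_toCofree (qLamU_op_smul q) (fun x => ?_) x
  exact ComodEnd.ext fun y => contract_dualOfEnd f hf h y ((toU A C L D M).symm x)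

end Galois

section Surjectivity

set_option linter.unusedSectionVars false

open BTensor

variable {A C L D : Type u} [Ring A] [AddCommGroup C] [Module A C] [Module Aᵐᵒᵖ C]
  [SMulCommClass A Aᵐᵒᵖ C] [Coring A C] [Ring L] [AddCommGroup D] [Module L D] [Module Lᵐᵒᵖ D]
  [SMulCommClass L Lᵐᵒᵖ D] [Coring L D] [Module Lᵐᵒᵖ C] [SMulCommClass A Lᵐᵒᵖ C]
  [CoringExtension A C L D] [IsPureExtension A C L D]
  {M : Type u} [AddCommGroup M] [Module Aᵐᵒᵖ M] [RightComodule A C M]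
  [Module L M] [SMulCommClass L Aᵐᵒᵖ M] [IsBicomodule L A C M]

/-! ### Surjectivity of the connecting maps -/

/-- The image of a connecting map is an ideal, so it is everything as soon as it contains `1`. The
same argument serves for `◇`. -/
theorem MoritaContext.black_surjective_iff {R S P Q : Type*} [Ring R] [Ring S] [AddCommGroup P]
    [Module R P] [Module Sᵐᵒᵖ P] [SMulCommClass R Sᵐᵒᵖ P] [AddCommGroup Q] [Module S Q]
    [Module Rᵐᵒᵖ Q] [SMulCommClass S Rᵐᵒᵖ Q] (c : MoritaContext R S P Q) :
    Function.Surjective c.black ↔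
      ∃ (s : ℕ) (q : Fin s → Q) (p : Fin s → P), ∑ k, c.black (tmul R (q k) (p k)) = 1 := by
  constructor
  · intro h
    obtain ⟨z, hz⟩ := h 1
    obtain ⟨s, q, p, rfl⟩ := exists_sum_tmul z
    exact ⟨s, q, p, by rw [← map_sum, hz]⟩
  · rintro ⟨s, q, p, h⟩ x
    exact ⟨x • ∑ k, tmul R (q k) (p k), by rw [c.black_smul, map_sum, h, mul_one]⟩

theorem MoritaContext.white_surjective_iff {R S P Q : Type*} [Ring R] [Ring S] [AddCommGroup P]
    [Module R P] [Module Sᵐᵒᵖ P] [SMulCommClass R Sᵐᵒᵖ P] [AddCommGroup Q] [Module S Q]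
    [Module Rᵐᵒᵖ Q] [SMulCommClass S Rᵐᵒᵖ Q] (c : MoritaContext R S P Q) :
    Function.Surjective c.white ↔
      ∃ (s : ℕ) (p : Fin s → P) (q : Fin s → Q), ∑ k, c.white (tmul S (p k) (q k)) = 1 := by
  constructor
  · intro h
    obtain ⟨z, hz⟩ := h 1
    obtain ⟨s, p, q, rfl⟩ := exists_sum_tmul z
    exact ⟨s, p, q, by rw [← map_sum, hz]⟩
  · rintro ⟨s, p, q, h⟩ x
    exact ⟨x • ∑ k, tmul S (p k) (q k), by rw [c.white_smul, map_sum, h, mul_one]⟩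

/-! ### The criterion for `◆` -/

variable (A C L D M) in
theorem black_surjective_iff_sum :
    Function.Surjective (moritaContext A C L D M).black ↔
      ∃ (s : ℕ) (q : Fin s → QMod A C L M) (p : Fin s → HomLD A C L D M),
        ∑ k, blackEnd (q k) (p k) = 1 := by
  rw [MoritaContext.black_surjective_iff]
  refine exists_congr fun s => exists_congr fun q => exists_congr fun p => ?_
  -- The connecting map takes values in the opposite of `^C End^D(C)`, which has the same sums and
  -- the same unit.
  have h : ∑ k, (moritaContext A C L D M).black (tmul _ (q k) (p k))
      = op (∑ k, blackEnd (q k) (p k)) := (Finset.op_sum _ _).symm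
  rw [h, op_eq_one_iff]

theorem sum_lift_colift {ι : Type*} [Fintype ι] (q : ι → QMod A C L M) (p : ι → HomLD A C L D M)
    (x : M) : ∑ k, (p k).lift ((q k).colift D (toU A C L D M x))
      = toU A C L D M (endAct M (∑ k, blackEnd (q k) (p k)) x) := by
  rw [endAct_sum, map_sum]
  exact Finset.sum_congr rfl fun k _ => lift_colift (q k) (p k) (toU A C L D M x)

-- The equation `∑ q_k ◆ p_k = 1` holds in `^C End^D(C)`, whereas the direct summand condition says
-- only that the sum acts as the identity on `M`. The Galois property bridges the two, and also
-- supplies the `q_k`.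
variable (A C L D M) in
theorem black_surjective_iff :
    Function.Surjective (moritaContext A C L D M).black ↔ IsGaloisComodule A C M ∧
      ∃ s : ℕ, IsDirectSummand (ComodEnd A C M) L D (UObj A C L D M)
        (Fin s → BTensor L (ComodEnd A C M) D) := by
  rw [black_surjective_iff_sum]
  constructor
  · rintro ⟨s, q, p, h⟩
    refine ⟨isGaloisComodule_of_sum_blackEnd q p h, s, ?_⟩
    refine (isDirectSummand_pow_iff _ _ _ _ _ _).2 ⟨fun k => (q k).colift D, fun k => (p k).lift,
      fun k => (q k).colift_isColinear, fun k => (p k).lift_isColinear, fun x => ?_⟩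
    refine (sum_lift_colift q p ((toU A C L D M).symm x)).trans ?_
    rw [h, endAct_one, AddEquiv.apply_symm_apply]
  · rintro ⟨hG, s, h⟩
    obtain ⟨i, r, hi, hr, h⟩ := (isDirectSummand_pow_iff _ _ _ _ _ _).1 h
    choose q hq using fun k => exists_colift_eq hG (i k) (hi k)
    choose p hp using fun k => exists_lift_eq (r k) (hr k)
    -- It remains to see that the sum acts on `M` as the identity, which is the splitting identity
    -- once the given components are written as `colift` and `lift`.
    refine ⟨s, q, p, BicomodEnd.eq_one_of_endAct (M := M) hG fun x => ?_⟩
    apply (toU A C L D M).injective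
    rw [← sum_lift_colift]
    simp only [hq, hp]
    exact h _

/-! ### The criterion for `◇` -/

theorem sum_colift_lift {ι : Type*} [Fintype ι] (q : ι → QMod A C L M) (p : ι → HomLD A C L D M)
    (t : ComodEnd A C M) (d : D) : ∑ k, (q k).colift D ((p k).lift (tmul L t d))
      = t • toCofree (X := D) (∑ k, whiteConv (p k) (q k)).hom
        (∑ k, whiteConv (p k) (q k)).hom_op_smul_eq d := by
  have h1 : ∀ z : BTensor L D D, ∑ k, rmap D (whiteConv (p k) (q k)).hom
        (whiteConv (p k) (q k)).hom_op_smul_eq z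
      = rmap D (∑ k, whiteConv (p k) (q k)).hom (∑ k, whiteConv (p k) (q k)).hom_op_smul_eq z := by
    intro z
    induction z using BTensor.induction with
    | h d e =>
      simp only [rmap_tmul, ConvRing.sum_hom]
      exact (map_sum (AddMonoidHom.mk' (fun t : ComodEnd A C M => tmul L t e)
        (fun t t' => add_tmul t t' e)) _ _).symm
    | hadd x y hx hy => simp only [map_add, Finset.sum_add_distrib, hx, hy]
  rw [toCofree_apply, ← h1, Finset.smul_sum]
  exact Finset.sum_congr rfl fun k _ => colift_lift (q k) (p k) t d

/-- The left counit law of `D`: the unit `d ↦ ε(d) 1_T` of the convolution ring corresponds to the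
identity of `T ⊗_L D`. -/
theorem toCofree_one (d : D) : toCofree (X := D) (1 : ConvRing A C L D M).hom
    (1 : ConvRing A C L D M).hom_op_smul_eq d = tmul L 1 d := by
  rw [toCofree_apply]
  conv_rhs => rw [← Coring.lcontract_comul (A := L) d]
  change rmap D _ (1 : ConvRing A C L D M).hom_op_smul_eq (comul L D d) = _
  induction comul L D d using BTensor.induction with
  | h d e =>
    refine Eq.trans ?_ (smul_tmul (1 : ComodEnd A C M) (counit L D d) e)
    exact congrArg (tmul L · e) (one_mul (lToEnd A C L M (counit L D d))).symm
  | hadd x y hx hy => simp only [map_add, tmul_add, hx, hy]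

/-- The composite is `t ⊗ d ↦ t v(d_{(1)}) ⊗ d_{(2)}` with `v = ∑ p_k ◇ q_k`, and `v` can be read
off from it by taking `t = 1` and applying `T ⊗_L ε`. So the composite is the identity exactly when
`v` is the convolution unit. -/
theorem sum_whiteConv_eq_one_iff {ι : Type*} [Fintype ι] (q : ι → QMod A C L M)
    (p : ι → HomLD A C L D M) : ∑ k, whiteConv (p k) (q k) = 1 ↔
      ∀ z, ∑ k, (q k).colift D ((p k).lift z) = z := by
  constructor
  · intro h z
    induction z using BTensor.induction with
    | h t d =>
      rw [sum_colift_lift]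
      simp only [h]
      rw [toCofree_one]
      exact congrArg (tmul L · d) (mul_one t)
    | hadd x y hx hy => simp only [map_add, Finset.sum_add_distrib, hx, hy]
  · intro h
    refine ConvRing.ext fun d => ?_
    have h1 := (sum_colift_lift q p 1 d).symm.trans (h _)
    rw [one_smul] at h1
    -- Applying `T ⊗_L ε` extracts `v(d) = ε(d) 1_T` from `v(d_{(1)}) ⊗ d_{(2)} = 1 ⊗ d`.
    have h2 := congrArg (cofreeCounit L D (ComodEnd A C M)) h1
    rw [cofreeCounit_toCofree] at h2
    exact h2.trans (one_mul (lToEnd A C L M (counit L D d)))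

variable (A C L D M) in
theorem white_surjective_iff_sum :
    Function.Surjective (moritaContext A C L D M).white ↔
      ∃ (s : ℕ) (p : Fin s → HomLD A C L D M) (q : Fin s → QMod A C L M),
        ∑ k, whiteConv (p k) (q k) = 1 :=
  MoritaContext.white_surjective_iff _

-- The components `T ⊗_L D → M` always come from elements of `P`; the Galois property makes the
-- components `M → T ⊗_L D` come from `Q`. The splitting identity is then `∑ p_k ◇ q_k = 1`.
variable (A C L D) in
theorem white_surjective_iff (hG : IsGaloisComodule A C M) :
    Function.Surjective (moritaContext A C L D M).white ↔
      ∃ z : ℕ, IsDirectSummand (ComodEnd A C M) L D (BTensor L (ComodEnd A C M) D)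
        (Fin z → UObj A C L D M) := by
  rw [white_surjective_iff_sum]
  refine exists_congr fun s => Iff.trans ?_ (isDirectSummand_pow_iff _ _ _ _ _ _).symm
  constructor
  · rintro ⟨p, q, h⟩
    exact ⟨fun k => (p k).lift, fun k => (q k).colift D, fun k => (p k).lift_isColinear,
      fun k => (q k).colift_isColinear, (sum_whiteConv_eq_one_iff q p).1 h⟩
  · rintro ⟨i, r, hi, hr, h⟩
    choose p hp using fun k => exists_lift_eq (i k) (hi k)
    choose q hq using fun k => exists_colift_eq hG (r k) (hr k)
    refine ⟨p, q, (sum_whiteConv_eq_one_iff q p).2 fun z => ?_⟩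
    simp only [hp, hq]
    exact h z

end Surjectivity

end CoringMorita

open CoringMorita
theorem mainTheorem2 {A C L D Sg : Type u}
    -- the `A`-coring `C` and the `L`-coring `D`
    [Ring A] [AddCommGroup C] [Module A C] [Module Aᵐᵒᵖ C] [SMulCommClass A Aᵐᵒᵖ C] [Coring A C]
    [Ring L] [AddCommGroup D] [Module L D] [Module Lᵐᵒᵖ D] [SMulCommClass L Lᵐᵒᵖ D] [Coring L D]
    -- `D` is a pure right extension of `C`
    [Module Lᵐᵒᵖ C] [SMulCommClass A Lᵐᵒᵖ C] [CoringExtension A C L D] [IsPureExtension A C L D]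
    -- the `L`-`C` bicomodule `Sg`
    [AddCommGroup Sg] [Module Aᵐᵒᵖ Sg] [RightComodule A C Sg] [Module L Sg]
    [SMulCommClass L Aᵐᵒᵖ Sg] [IsBicomodule L A C Sg] :
    (Function.Surjective (moritaContext A C L D Sg).black ↔
      IsGaloisComodule A C Sg ∧
        ∃ s : ℕ, IsDirectSummand (ComodEnd A C Sg) L D (UObj A C L D Sg)
          (Fin s → BTensor L (ComodEnd A C Sg) D)) ∧
    ((moritaContext A C L D Sg).IsStrict ↔
      IsGaloisComodule A C Sg ∧
        (∃ s : ℕ, IsDirectSummand (ComodEnd A C Sg) L D (UObj A C L D Sg)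
          (Fin s → BTensor L (ComodEnd A C Sg) D)) ∧
        ∃ z : ℕ, IsDirectSummand (ComodEnd A C Sg) L D (BTensor L (ComodEnd A C Sg) D)
          (Fin z → UObj A C L D Sg)) := by
  refine ⟨black_surjective_iff A C L D Sg, ?_⟩
  rw [← and_assoc, ← black_surjective_iff]
  -- Surjectivity of `◆` already yields the Galois property, under which the criterion for `◇`
  -- applies.
  exact and_congr_right fun h =>
    white_surjective_iff A C L D ((black_surjective_iff A C L D Sg).1 h).1
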